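/- \textbf{Conventions.} Let $\mathbb{D}$ be the unit disc of $\mathbb{C}$, $q(w)=w^7$, $q^l$ its $l$-th iterate (so $q^l(w)=w^{7^l}$), $r_k=e^{2i\pi k/3}$ for $k=0,1,2$, and $s_k=-r_k$; these six points are repelling fixed points of $q$. For real parameters $\alpha_1,\alpha_2,\epsilon_1,\epsilon_2$ and $l\ge 1$ set $$F_l(z,w)=\Big(z+(\alpha_1z+\epsilon_1w)\tfrac{w^3+1}{2}-\alpha_2z-\epsilon_2w,\; q^l(w)\Big),\qquad (z,w)\in\mathbb{C}^2 .$$ A \emph{history} of $f$ is a sequence $\widehat x=(x_i)_{i\le0}$ with $f(x_i)=x_{i+1}$; the space of histories has the product topology, and $\widehat f$ is the induced homeomorphism, $\widehat f((x_i))=(f(x_i))$. The natural extension $\widehat\Lambda$ of $\Lambda$ is the set of histories with all $x_i\in\Lambda$. The unstable manifold $W^u_{\widehat x}$ is the set of points $y_0$ having a history $(y_i)_{i\le 0}$ with $\mathrm{dist}(y_i,x_i)\to0$ as $i\to-\infty$. For $S\subset\mathbb{C}^2$, $\bigcap_{n\in\mathbb{Z}}f^n(S)$ denotes the set of points having a complete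 orbit in $S$, i.e. the projection of $\bigcap_{n\in\mathbb{Z}}\widehat f^{\,n}(\{\widehat x: x_0\in S\})$. A compact set $\Lambda$ with $f(\Lambda)=\Lambda$ is \emph{hyperbolic} if over $\widehat\Lambda$ the tangent bundle has a continuous $Df$-invariant splitting $E^s\oplus E^u$, with complex dimensions constant on $\widehat\Lambda$, such that for some $C>0$, $0<\lambda<1$ and all $n\ge0$: $\|Df^nu\|\le C\lambda^n\|u\|$ on $E^s$ and $\|v\|\le C\lambda^n\|Df^nv\|$ on $E^u$. It is \emph{repelling} if $\dim_{\mathbb C} E^u=2$ and \emph{saddle} if $\dim_{\mathbb C} E^u=1$. It is \emph{basic} if $f|_\Lambda$ is transitive and $\widehat\Lambda=\bigcap_{n\in\mathbb{Z}}\widehat f^{\,n}(\widehat U)$ for some neighbourhood $\widehat U$ of $\widehat\Lambda$ in the space of histories. \emph{Repelling blender.} Let $H_i,V_i\subset\mathbb{C}$ be open, $Z=\bigcup_i H_i\times V_i$, $\delta>0$, $C_\delta=\{(a,b)\in\mathbb C^2:|a|<\delta|b|\}$, and let $f(z,w)=(h(z,w),p(w))$ be holomorphic on $Z$ with $h(Z)$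 contained in a compact subset of $\bigcup_iH_i$ and with $D_xf(C_\delta)\subset C_{\delta'}$ for some $\delta'<\delta$ and all $x\in Z$. The set $\Lambda=\bigcap_{n\ge0}f^{-n}(\overline Z)$ is a \emph{blender of repelling type} (relative to $H_i,V_i,\delta$) if it is contained in a repelling hyperbolic set of $f$ and, for every holomorphic $g$ on $Z$ sufficiently $C^1$-close to $f$, every $i$ and every holomorphic $\sigma:V_i\to H_i$ with $|\sigma'|<\delta$, the graph $\{(\sigma(w),w):w\in V_i\}$ contains a point whose $g$-orbit stays in $Z$ (so it meets $\bigcap_{n\ge0}g^{-n}(\overline Z)$). \emph{Saddle blender.} Let $Z$ be a bounded open set with $\overline Z\subset f(Z)$. The set $\Lambda=\bigcap_{n\ge0}f^{-n}(\overline Z)$ is a \emph{blender of saddle type} if, for every holomorphic $g$ sufficiently uniformly close to $f$ on a suitable fixed neighbourhood of $\overline Z$ (in particular for $g=f$), $\bigcap_{n\ge0}g^{-n}(\overline Z)$ is a saddle hyperbolic set of $g$. \emph{Neighbourhood systems.} A neighbourhood system of three repelling fixed points $p_0,p_1,p_2$ of $q$ is a family of bounded connected open sets $V_i^l\ni p_i$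 ($l\ge0$) with $q(V_i^{l+1})=V_i^l$ and diameters at most $C\theta^l$ for some $C$ and some $0<\theta<1$, such that for some $A>0$ and all large $l$ and all $i,j$: $|(q^l)'|\ge A|q'(p_i)|^l>1$ on $V_i^l$, $\overline{\bigcup_jV_j^l}\subset q^l(V_i^l)$, and $q^l$ is a biholomorphism from $V_i^l\cap q^{-l}(V_j^l)$ onto $V_j^l$. \textbf{Proposition.} There exist neighbourhood systems $(V_i^l)$ of $(r_i)$ and $(U_i^l)$ of $(s_i)$, open sets $H_0,H_1,H_2$ with $\frac12\mathbb{D}\subset H_i$ for each $i$ and $\bigcup_iH_i=\mathbb{D}$, real numbers $1/10>\alpha_1>\alpha_2>0$, $\epsilon_1,\epsilon_2,R,\delta>0$ and an integer $l_0\ge1$ such that for all $l\ge l_0$ one has $\overline{\bigcup_iV_i^l}\subset q^l(U_j^l)$ for every $j$, and: \begin{itemize} \item $\Lambda_r^l=\bigcap_{n\ge0}F_l^{-n}\big(\overline{\bigcup_iH_i\times V_i^l}\big)$ is a blender of repelling type of $F_l$ (relative to $H_i,V_i^l,\delta$), contained in $\overline{\mathbb{D}}\times\bigcup_iV_i^l$;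 \item $\Lambda_s^l=\bigcap_{n\ge0}F_l^{-n}\big(\overline{\bigcup_i\frac14\mathbb{D}\times U_i^l}\big)$ is a blender of saddle type of $F_l$, contained in $\frac14\overline{\mathbb{D}}\times\bigcup_iU_i^l$; \item for each $\widehat x\in\widehat{\Lambda_s^l}$ the unstable manifold $W^u_{\widehat x}$ intersects $\Lambda_r^l$; \item the sets $\widetilde\Lambda_r^l=\bigcap_{n\in\mathbb{Z}}F_l^n(R\mathbb{D}\times\bigcup_iV_i^l)$ and $\widetilde\Lambda_s^l=\bigcap_{n\in\mathbb{Z}}F_l^n(R\mathbb{D}\times\bigcup_iU_i^l)$ are basic sets of repelling and of saddle type respectively, $\Lambda_r^l\subset\widetilde\Lambda_r^l$, $\Lambda_s^l\subset\widetilde\Lambda_s^l$, and on the natural extension of each of them $\widehat F_l$ is topologically mixing with topological entropy $\log 3$. \end{itemize} -/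

import Mathlib

namespace Blender

open Set Filter Topology

/-! ### Natural extensions and invariant sets -/

section Orbits

variable {X : Type*}

/-- The histories of `f` that stay in `L`.  A history `(x_i)_{i ≤ 0}`, `f (x_i) = x_{i+1}`, is
coded as the sequence `k ↦ x_{-k}`.  For `L = univ` this is the natural extension of `X`, and for
an invariant set `L` it is the natural extension of `L`. -/
def natExt (f : X → X) (L : Set X) : Set (ℕ → X) :=
  {x | ∀ k, x k ∈ L ∧ f (x (k + 1)) = x k}

/-- The lift of `f` to histories.  As `f (x_i) = x_{i+1}`, it is `f` applied entrywise. -/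
def hatMap (f : X → X) (x : ℕ → X) : ℕ → X := fun k => f (x k)

/-- The `n`-th iterate of the inverse of `hatMap f` on histories: forget the last `n` entries. -/
def hatShift (n : ℕ) (x : ℕ → X) : ℕ → X := fun k => x (k + n)

/-- `⋂_{n ∈ ℤ} f̂ ^ n (U)`, a subset of the natural extension of the whole space. -/
def hatInter (f : X → X) (U : Set (ℕ → X)) : Set (ℕ → X) :=
  {x | x ∈ natExt f univ ∧ ∀ n, (hatMap f)^[n] x ∈ U ∧ hatShift n x ∈ U}

/-- `⋂_{n ≥ 0} f ^ (-n) (S)`: the points whose forward orbit stays in `S`. -/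
def staySet (f : X → X) (S : Set X) : Set X := {x | ∀ n, f^[n] x ∈ S}

/-- `⋂_{n ∈ ℤ} f ^ n (S)` for a non-invertible `f`, formed in the natural extension and projected
back: the points that have a complete orbit (past and future) in `S`. -/
def maxInvSet (f : X → X) (S : Set X) : Set X :=
  (fun x : ℕ → X => x 0) '' hatInter f {x | x 0 ∈ S}

/-- Topological transitivity of `f` restricted to `L`. -/
def IsTransitiveOn [TopologicalSpace X] (f : X → X) (L : Set X) : Prop :=
  ∀ U V : Set X, IsOpen U → IsOpen V → (L ∩ U).Nonempty → (L ∩ V).Nonempty →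
    ∃ n : ℕ, ∃ x ∈ L ∩ U, f^[n] x ∈ V

/-- Topological mixing of `f` restricted to `L`. -/
def IsMixingOn [TopologicalSpace X] (f : X → X) (L : Set X) : Prop :=
  ∀ U V : Set X, IsOpen U → IsOpen V → (L ∩ U).Nonempty → (L ∩ V).Nonempty →
    ∃ n₀ : ℕ, ∀ n ≥ n₀, ∃ x ∈ L ∩ U, f^[n] x ∈ V

/-- The unstable manifold of a history `x`: the points having a history that is backward
asymptotic to `x`. -/
def unstableManifold [PseudoMetricSpace X] (f : X → X) (x : ℕ → X) : Set X :=
  {p | ∃ y ∈ natExt f univ, y 0 = p ∧ Tendsto (fun k => dist (y k) (x k)) atTop (𝓝 0)}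

end Orbits

/-! ### Hyperbolic sets of holomorphic maps in two complex variables -/

/-- `L` is a hyperbolic set of `f` with unstable dimension `u` and stable dimension `2 - u`.
The splitting `E^s ⊕ E^u` over the natural extension of `L` is coded by the projection `P x` with
range `E^u_x` and kernel `E^s_x`; continuity of the splitting is continuity of `P`, and
invariance of both bundles is the intertwining relation.  (`Df` maps `E^u` onto `E^u` because it
is injective there and `E^u` has constant rank.) -/
def IsHyperbolicSet (f : ℂ × ℂ → ℂ × ℂ) (L : Set (ℂ × ℂ)) (u : ℕ) : Prop :=
  IsCompact L ∧ f '' L = L ∧ (∀ x ∈ L, ∀ᶠ y in 𝓝 x, DifferentiableAt ℂ f y) ∧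
  ∃ P : (ℕ → ℂ × ℂ) → (ℂ × ℂ →L[ℂ] ℂ × ℂ),
    ContinuousOn P (natExt f L) ∧
    (∀ x ∈ natExt f L,
      (P x).comp (P x) = P x ∧
      Module.finrank ℂ (LinearMap.range (P x : ℂ × ℂ →ₗ[ℂ] ℂ × ℂ)) = u ∧
      (fderiv ℂ f (x 0)).comp (P x) = (P (hatMap f x)).comp (fderiv ℂ f (x 0))) ∧
    ∃ C lam : ℝ, 0 < C ∧ 0 < lam ∧ lam < 1 ∧
      ∀ x ∈ natExt f L, ∀ n : ℕ, ∀ v : ℂ × ℂ,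
        (P x v = 0 → ‖fderiv ℂ f^[n] (x 0) v‖ ≤ C * lam ^ n * ‖v‖) ∧
        (P x v = v → ‖v‖ ≤ C * lam ^ n * ‖fderiv ℂ f^[n] (x 0) v‖)

/-- Repelling hyperbolic set: no stable direction. -/
def IsRepellingHyperbolicSet (f : ℂ × ℂ → ℂ × ℂ) (L : Set (ℂ × ℂ)) : Prop :=
  IsHyperbolicSet f L 2

/-- Saddle hyperbolic set: one stable and one unstable direction. -/
def IsSaddleHyperbolicSet (f : ℂ × ℂ → ℂ × ℂ) (L : Set (ℂ × ℂ)) : Prop :=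
  IsHyperbolicSet f L 1

/-- A hyperbolic set is basic if `f` is transitive on it and its natural extension is locally
maximal in the natural extension of the ambient space. -/
def IsBasicSet (f : ℂ × ℂ → ℂ × ℂ) (L : Set (ℂ × ℂ)) (u : ℕ) : Prop :=
  IsHyperbolicSet f L u ∧ IsTransitiveOn f L ∧
  ∃ U : Set (ℕ → ℂ × ℂ), IsOpen U ∧ natExt f L ⊆ U ∧ hatInter f U = natExt f L

/-! ### Blenders -/

/-- `f` contracts the constant cone field `C_δ = {(a, b) : |a| < δ |b|}` on `S`. -/
def ContractsCone (f : ℂ × ℂ → ℂ × ℂ) (δ : ℝ) (S : Set (ℂ × ℂ)) : Prop :=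
  ∃ δ' : ℝ, 0 < δ' ∧ δ' < δ ∧ ∀ x ∈ S, ∀ v : ℂ × ℂ, ‖v.1‖ < δ * ‖v.2‖ →
    ‖(fderiv ℂ f x v).1‖ < δ' * ‖(fderiv ℂ f x v).2‖

/-- `Z = ⋃ i, H i × V i`. -/
def boxes (H V : Fin 3 → Set ℂ) : Set (ℂ × ℂ) := ⋃ i, H i ×ˢ V i

/-- `L` is a blender of repelling type of the skew product `f`, relative to the open sets `H i`
and `V i` and to the cone field `C_δ`.  With `Z = ⋃ i, H i × V i`: `f` maps `Z` into `K × ℂ` for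
some compact subset `K` of `⋃ i, H i` and contracts `C_δ` on `Z`;
`L = ⋂_{n ≥ 0} f ^ (-n) (closure Z)`; for `f` and for all holomorphic maps `g` on `Z` that are
`C^1`-close to `f` there, each vertical graph over `V i` in `H i × V i` tangent to `C_δ` contains
a point whose `g`-orbit never leaves `Z` (this point lies in
`⋂_{n ≥ 0} g ^ (-n) (closure Z)`; asking for `Z` itself uses no value of `g` off its domain);
and `L` is contained in a repelling hyperbolic set of `f`. -/
structure IsRepellingBlender (f : ℂ × ℂ → ℂ × ℂ) (H V : Fin 3 → Set ℂ) (δ : ℝ)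
    (L : Set (ℂ × ℂ)) : Prop where
  isOpen_left : ∀ i, IsOpen (H i)
  isOpen_right : ∀ i, IsOpen (V i)
  pos : 0 < δ
  holo : DifferentiableOn ℂ f (boxes H V)
  skew : ∃ (h : ℂ × ℂ → ℂ) (p : ℂ → ℂ), ∀ x ∈ boxes H V, f x = (h x, p x.2)
  maps : ∃ K : Set ℂ, IsCompact K ∧ K ⊆ ⋃ i, H i ∧ ∀ x ∈ boxes H V, (f x).1 ∈ K
  cone : ContractsCone f δ (boxes H V)
  eq : L = staySet f (closure (boxes H V))
  robust : ∃ η : ℝ, 0 < η ∧ ∀ g : ℂ × ℂ → ℂ × ℂ, DifferentiableOn ℂ g (boxes H V) →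
    (∀ x ∈ boxes H V, ‖g x - f x‖ ≤ η ∧ ‖fderiv ℂ g x - fderiv ℂ f x‖ ≤ η) →
    ∀ (i : Fin 3) (σ : ℂ → ℂ), DifferentiableOn ℂ σ (V i) → MapsTo σ (V i) (H i) →
      (∀ w ∈ V i, ‖deriv σ w‖ < δ) →
      ∃ w ∈ V i, (σ w, w) ∈ staySet g (boxes H V)
  repelling : ∃ M : Set (ℂ × ℂ), IsRepellingHyperbolicSet f M ∧ L ⊆ M

/-- `L = ⋂_{n ≥ 0} f ^ (-n) (closure Z)` is a blender of saddle type of `f`: `Z` is open with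
`closure Z ⊆ f (Z)` and, for `f` and all holomorphic maps `g` uniformly close to `f` on a
neighbourhood of `closure Z`, the set `⋂_{n ≥ 0} g ^ (-n) (closure Z)` is a saddle hyperbolic set
of `g`. -/
structure IsSaddleBlender (f : ℂ × ℂ → ℂ × ℂ) (Z L : Set (ℂ × ℂ)) : Prop where
  isOpen : IsOpen Z
  bounded : Bornology.IsBounded Z
  covers : closure Z ⊆ f '' Z
  eq : L = staySet f (closure Z)
  robust : ∃ N : Set (ℂ × ℂ), IsOpen N ∧ closure Z ⊆ N ∧ DifferentiableOn ℂ f N ∧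
    ∃ η : ℝ, 0 < η ∧ ∀ g : ℂ × ℂ → ℂ × ℂ, DifferentiableOn ℂ g N →
      (∀ x ∈ N, ‖g x - f x‖ ≤ η) → IsSaddleHyperbolicSet g (staySet g (closure Z))

/-! ### The maps -/

/-- A system of open connected neighbourhoods `V l i` of three repelling fixed points `r i` of
`q`, shrinking under the inverse branches of `q` that fix the points `r i`. -/
structure IsNbhdSystem (q : ℂ → ℂ) (r : Fin 3 → ℂ) (V : ℕ → Fin 3 → Set ℂ) : Prop where
  isOpen : ∀ l i, IsOpen (V l i)
  connected : ∀ l i, IsConnected (V l i)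
  mem : ∀ l i, r i ∈ V l i
  image : ∀ l i, q '' V (l + 1) i = V l i
  diam : ∃ C θ : ℝ, 0 < θ ∧ θ < 1 ∧ ∀ l i,
    Bornology.IsBounded (V l i) ∧ Metric.diam (V l i) ≤ C * θ ^ l
  expand : ∃ (A : ℝ) (l₀ : ℕ), 0 < A ∧ 1 ≤ l₀ ∧ ∀ l ≥ l₀, ∀ i,
    1 < A * ‖deriv q (r i)‖ ^ l ∧
    (∀ w ∈ V l i, A * ‖deriv q (r i)‖ ^ l ≤ ‖deriv q^[l] w‖) ∧
    closure (⋃ j, V l j) ⊆ q^[l] '' V l i ∧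
    ∀ j, BijOn q^[l] (V l i ∩ q^[l] ⁻¹' V l j) (V l j)

/-- `q(w) = w ^ 7`. -/
def q (w : ℂ) : ℂ := w ^ 7

/-- The three cube roots of unity. -/
noncomputable def rPt (k : Fin 3) : ℂ := Complex.exp (2 * Real.pi * Complex.I * ((k : ℕ) : ℂ) / 3)

/-- Their opposites, the three cube roots of `-1`. -/
noncomputable def sPt (k : Fin 3) : ℂ := -rPt k

/-- `F_l(z,w) = (z + (α₁ z + ε₁ w)(w³ + 1)/2 - α₂ z - ε₂ w, q^l(w))`, where `q^l` is the `l`-th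
iterate, so that `q^l(w) = w ^ (7 ^ l)`. -/
noncomputable def F (α₁ α₂ ε₁ ε₂ : ℝ) (l : ℕ) (x : ℂ × ℂ) : ℂ × ℂ :=
  (x.1 + (α₁ * x.1 + ε₁ * x.2) * (x.2 ^ 3 + 1) / 2 - α₂ * x.1 - ε₂ * x.2, q^[l] x.2)

end Blender

open Blender

namespace Blender

open Set Filter Topology

/-! ### Neighbourhoods of the sixth roots of unity in logarithmic coordinates -/

/-! All parameters are explicit: `α₁ = 1/50`, `α₂ = 1/100`, `ε₁ = 3/25`, `ε₂ = 1/50`. Over the point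
r_i the fibre map is then z ↦ (101/100) z + r_i/10, a weak expansion, and over s_i it is z ↦
(99/100) z - s_i/50, a weak contraction. The neighbourhoods of these points shrink like `7 ^ (-l)`,
so for `l ≥ 20` the fibre maps are constant there up to tiny errors, while the base expands by at
least `10 ^ 14`. Writing w = p exp(ζ / 7^l) near a sixth root of unity p turns `q^[l]` into ζ ↦ p
exp ζ. Full-branch covering, injectivity and inverse branches thereby reduce to the exponential on
one rectangle.

Both blenders rest on one planar fact, the field `sector` of `IsTriple`: every z makes an angle of
at least 2π/3 with one of three equally spaced directions, so adding a small multiple of that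
direction moves z towards 0.

Repelling side: some expansion z ↦ (101/100) z + r_j/10 sends any given z of the unit disc into a
smaller disc. A nearly vertical graph over a neighbourhood of r_i is stretched over the
neighbourhoods of all the r_j, so j can be chosen to make the image contain another such graph
inside the next domain (`IsGoodGraph.exists_image`). Nested compact sets then yield a point that
never leaves (`exists_mem_staySet`), and the slack in the inequalities gives robustness.

Saddle side: the images of the disc of radius 1/4 under the three contractions cover its closure,
also after perturbation (`exists_preimage_saddle`). The set of points that stay is therefore
invariant, and cone estimates make it hyperbolic (`isHyperbolicSet_one`). Cauchy estimates turn
uniform closeness into C^1 closeness.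

Heteroclinic intersections: a history in the saddle set lifts to all points of a small disc around
some r_j. Since the fibres contract, the past determines the z-coordinate. The unstable manifold
thus contains a nearly vertical graph with |z| < 1/2, to which the repelling blender property
applies (`unstableManifold_inter_nonempty`).

Basic sets: complete orbits correspond to bi-infinite itineraries. The base coordinate is determined
by the future, and z by the future over the r_i and by the past over the s_i. The natural extension
is thus conjugate to the full shift on three symbols (`IsCoding`), which gives transitivity, mixing
and entropy `log 3`. -/

/-- A rectangle on whose closure the exponential is injective. -/
def strip : Set ℂ := Ioo (-3 : ℝ) 3 ×ℂ Ioo (-(5 / 2) : ℝ) (15 / 4)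

/-- The closure of `strip`. -/
def cstrip : Set ℂ := Icc (-3 : ℝ) 3 ×ℂ Icc (-(5 / 2) : ℝ) (15 / 4)

/-- The neighbourhood of `p` corresponding to `strip` scaled by `7 ^ (-l)`. -/
noncomputable def nbh (p : ℂ) (l : ℕ) : Set ℂ := (fun ζ => p * Complex.exp (ζ / 7 ^ l)) '' strip

lemma mem_strip {ζ : ℂ} : ζ ∈ strip ↔
    (-3 < ζ.re ∧ ζ.re < 3) ∧ (-(5 / 2) < ζ.im ∧ ζ.im < 15 / 4) := Iff.rfl

lemma mem_cstrip {ζ : ℂ} : ζ ∈ cstrip ↔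
    (-3 ≤ ζ.re ∧ ζ.re ≤ 3) ∧ (-(5 / 2) ≤ ζ.im ∧ ζ.im ≤ 15 / 4) := Iff.rfl

lemma strip_subset_cstrip : strip ⊆ cstrip := fun _ h =>
  ⟨⟨h.1.1.le, h.1.2.le⟩, ⟨h.2.1.le, h.2.2.le⟩⟩

lemma isCompact_cstrip : IsCompact cstrip := isCompact_Icc.reProdIm isCompact_Icc

lemma isOpen_strip : IsOpen strip := isOpen_Ioo.reProdIm isOpen_Ioo

lemma zero_mem_strip : (0 : ℂ) ∈ strip := by rw [mem_strip]; norm_num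

lemma convex_strip : Convex ℝ strip := by
  have h : strip = Complex.reLm ⁻¹' Ioo (-3 : ℝ) 3 ∩ Complex.imLm ⁻¹' Ioo (-(5 / 2) : ℝ) (15 / 4) := rfl
  rw [h]
  exact ((convex_Ioo _ _).linear_preimage _).inter ((convex_Ioo _ _).linear_preimage _)

lemma norm_le_of_mem_cstrip {ζ : ℂ} (h : ζ ∈ cstrip) : ‖ζ‖ ≤ 7 := by
  rw [mem_cstrip] at h
  have h1 : |ζ.re| ≤ 3 := abs_le.2 h.1
  have h2 : |ζ.im| ≤ 15 / 4 := abs_le.2 ⟨by linarith [h.2.1], h.2.2⟩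
  linarith [Complex.norm_le_abs_re_add_abs_im ζ]

/-- The height 25/4 of the rectangle is smaller than 2π. It is placed asymmetrically so that it
contains the angle π from s_i to r_i as well as the angles ±2π/3 inside one triple. -/
lemma exp_injOn_cstrip {ζ ζ' : ℂ} (h : ζ ∈ cstrip) (h' : ζ' ∈ cstrip)
    (e : Complex.exp ζ = Complex.exp ζ') : ζ = ζ' := by
  obtain ⟨n, hn⟩ := Complex.exp_eq_exp_iff_exists_int.1 e
  rw [mem_cstrip] at h h'
  have him : ζ.im = ζ'.im + n * (2 * Real.pi) := by
    have := congrArg Complex.im hn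
    simpa using this
  have hpi := Real.pi_gt_d2
  have hn0 : n = 0 := by
    by_contra hne
    rcases lt_or_gt_of_ne hne with h0 | h0
    · have : (n : ℝ) ≤ -1 := by exact_mod_cast Int.le_sub_one_of_lt h0
      nlinarith [h.2.1, h'.2.2]
    · have : (1 : ℝ) ≤ n := by exact_mod_cast h0
      nlinarith [h'.2.1, h.2.2]
  simpa [hn0] using hn

/-! ### Iterates of q in logarithmic coordinates. -/

lemma q_iterate (l : ℕ) (w : ℂ) : q^[l] w = w ^ 7 ^ l := by
  induction l generalizing w with
  | zero => simp
  | succ n ih => rw [Function.iterate_succ_apply, ih, q, ← pow_mul, pow_succ']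

lemma pow_seven_pow {p : ℂ} (hp : p ^ 6 = 1) (l : ℕ) : p ^ 7 ^ l = p := by
  induction l with
  | zero => simp
  | succ n ih =>
    rw [pow_succ, pow_mul, ih, show (7 : ℕ) = 6 + 1 from rfl, pow_succ, hp, one_mul]

/-- As 7 is congruent to 1 modulo 6, p is fixed and taking the power only multiplies the logarithm
by 7^l. This linearises q at all six fixed points simultaneously. -/
lemma q_iterate_exp {p : ℂ} (hp : p ^ 6 = 1) (l : ℕ) (ζ : ℂ) :
    q^[l] (p * Complex.exp (ζ / 7 ^ l)) = p * Complex.exp ζ := by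
  rw [q_iterate, mul_pow, pow_seven_pow hp, ← Complex.exp_nat_mul]
  congr 2
  push_cast
  field_simp

lemma norm_eq_one_of_pow_six {p : ℂ} (hp : p ^ 6 = 1) : ‖p‖ = 1 :=
  Complex.norm_eq_one_of_pow_eq_one hp (by norm_num)

lemma norm_exp_sub_exp_le {c : ℝ} {a b : ℂ} (ha : a.re ≤ c) (hb : b.re ≤ c) :
    ‖Complex.exp a - Complex.exp b‖ ≤ Real.exp c * ‖a - b‖ := by
  have hconv : Convex ℝ {z : ℂ | z.re ≤ c} := convex_halfSpace_re_le c
  refine hconv.norm_image_sub_le_of_norm_deriv_le (f := Complex.exp) (C := Real.exp c)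
    (fun x _ => Complex.differentiableAt_exp) (fun x hx => ?_) hb ha
  rw [Complex.deriv_exp, Complex.norm_exp]
  exact Real.exp_le_exp.2 hx

lemma exp_three_le : Real.exp 3 ≤ 21 := by
  have h := Real.exp_one_lt_d9
  have h3 : Real.exp 3 = Real.exp 1 ^ 3 := by rw [← Real.exp_nat_mul]; norm_num
  rw [h3]
  calc Real.exp 1 ^ 3 ≤ (2.7182818286 : ℝ) ^ 3 := by gcongr
    _ ≤ 21 := by norm_num

lemma exp_one_le : Real.exp 1 ≤ 3 := by linarith [Real.exp_one_lt_d9]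

lemma seven_pow_pos (l : ℕ) : (0 : ℝ) < 7 ^ l := by positivity

lemma seven_pow_large {l : ℕ} (hl : 20 ≤ l) : (10 : ℝ) ^ 16 ≤ 7 ^ l :=
  calc (10 : ℝ) ^ 16 ≤ 7 ^ 20 := by norm_num
    _ ≤ 7 ^ l := pow_le_pow_right₀ (by norm_num) hl

lemma norm_seven_pow (l : ℕ) : ‖(7 : ℂ) ^ l‖ = 7 ^ l := by simp

lemma closure_nbh_subset (p : ℂ) (l : ℕ) :
    closure (nbh p l) ⊆ (fun ζ => p * Complex.exp (ζ / 7 ^ l)) '' cstrip := by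
  refine closure_minimal (image_mono strip_subset_cstrip) (IsCompact.isClosed ?_)
  exact isCompact_cstrip.image (by fun_prop)

lemma closure_iUnion_nbh (p : Fin 3 → ℂ) (l : ℕ) :
    closure (⋃ i, nbh (p i) l) = ⋃ i, closure (nbh (p i) l) :=
  closure_iUnion_of_finite _

lemma norm_sub_le_of_mem_closure_nbh {p w : ℂ} (hp : p ^ 6 = 1) {l : ℕ} (hl : 20 ≤ l)
    (hw : w ∈ closure (nbh p l)) : ‖w - p‖ ≤ 14 / 7 ^ l := by
  obtain ⟨ζ, hζ, rfl⟩ := closure_nbh_subset p l hw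
  have h7 := norm_le_of_mem_cstrip hζ
  have hL := seven_pow_large hl
  have hn : ‖ζ / 7 ^ l‖ ≤ 7 / 7 ^ l := by
    rw [norm_div, norm_seven_pow]; gcongr
  have h1 : ‖ζ / 7 ^ l‖ ≤ 1 := hn.trans (by rw [div_le_one (seven_pow_pos l)]; linarith)
  calc ‖p * Complex.exp (ζ / 7 ^ l) - p‖ = ‖Complex.exp (ζ / 7 ^ l) - 1‖ := by
        rw [← mul_sub_one, norm_mul, norm_eq_one_of_pow_six hp, one_mul]
    _ ≤ 2 * ‖ζ / 7 ^ l‖ := Complex.norm_exp_sub_one_le h1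
    _ ≤ 2 * (7 / 7 ^ l) := by gcongr
    _ = 14 / 7 ^ l := by ring

lemma isOpen_nbh {p : ℂ} (hp : p ^ 6 = 1) (l : ℕ) : IsOpen (nbh p l) := by
  have hp0 : p ≠ 0 := by rintro rfl; norm_num at hp
  have h1 : IsOpenMap (fun ζ : ℂ => ζ / 7 ^ l) := by
    have := (Homeomorph.mulRight₀ ((7 : ℂ) ^ l)⁻¹ (by simp)).isOpenMap
    simpa [div_eq_mul_inv] using this
  have h2 : IsOpenMap (fun ζ : ℂ => p * ζ) := (Homeomorph.mulLeft₀ p hp0).isOpenMap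
  exact (h2.comp (Complex.isOpenMap_exp.comp h1)) _ isOpen_strip

lemma isConnected_nbh (p : ℂ) (l : ℕ) : IsConnected (nbh p l) :=
  (convex_strip.isConnected ⟨0, zero_mem_strip⟩).image _ (by fun_prop)

lemma mem_nbh_self (p : ℂ) (l : ℕ) : p ∈ nbh p l := ⟨0, zero_mem_strip, by simp⟩

lemma q_image_nbh {p : ℂ} (hp : p ^ 6 = 1) (l : ℕ) : q '' nbh p (l + 1) = nbh p l := by
  unfold nbh
  rw [image_image]
  refine image_congr fun ζ _ => ?_
  have := q_iterate_exp hp 1 (ζ / 7 ^ l)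
  simp only [Function.iterate_one, pow_one] at this
  rw [← this, div_div, ← pow_succ]

lemma diam_nbh {p : ℂ} (hp : p ^ 6 = 1) (l : ℕ) :
    Bornology.IsBounded (nbh p l) ∧ Metric.diam (nbh p l) ≤ 294 * (1 / 7 : ℝ) ^ l := by
  have key : ∀ x ∈ nbh p l, ∀ y ∈ nbh p l, dist x y ≤ 294 * (1 / 7 : ℝ) ^ l := by
    rintro _ ⟨ζ, hζ, rfl⟩ _ ⟨ξ, hξ, rfl⟩
    have hre : ∀ ζ ∈ strip, (ζ / 7 ^ l : ℂ).re ≤ 3 := by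
      intro ζ hζ
      have e : (ζ / 7 ^ l : ℂ).re = ζ.re / 7 ^ l := by
        have := Complex.div_ofReal_re ζ (7 ^ l)
        simpa using this
      rw [e, div_le_iff₀ (seven_pow_pos l)]
      have : (1 : ℝ) ≤ 7 ^ l := one_le_pow₀ (by norm_num)
      have h3 := hζ.1.2
      nlinarith
    have h1 := norm_le_of_mem_cstrip (strip_subset_cstrip hζ)
    have h2 := norm_le_of_mem_cstrip (strip_subset_cstrip hξ)
    simp only [dist_eq_norm]
    calc ‖p * Complex.exp (ζ / 7 ^ l) - p * Complex.exp (ξ / 7 ^ l)‖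
        = ‖Complex.exp (ζ / 7 ^ l) - Complex.exp (ξ / 7 ^ l)‖ := by
          rw [← mul_sub, norm_mul, norm_eq_one_of_pow_six hp, one_mul]
      _ ≤ Real.exp 3 * ‖ζ / 7 ^ l - ξ / 7 ^ l‖ := norm_exp_sub_exp_le (hre _ hζ) (hre _ hξ)
      _ = Real.exp 3 * (‖ζ - ξ‖ / 7 ^ l) := by rw [← sub_div, norm_div, norm_seven_pow]
      _ ≤ 21 * (14 / 7 ^ l) := by
          gcongr
          · exact exp_three_le
          · linarith [norm_sub_le ζ ξ]
      _ = 294 * (1 / 7 : ℝ) ^ l := by rw [one_div, inv_pow]; ring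
  exact ⟨Metric.isBounded_iff.2 ⟨_, fun x hx y hy => key x hx y hy⟩,
    Metric.diam_le_of_forall_dist_le (by positivity) key⟩

lemma deriv_q_iterate (l : ℕ) (w : ℂ) : deriv q^[l] w = 7 ^ l * w ^ (7 ^ l - 1) := by
  have : q^[l] = fun w => w ^ 7 ^ l := funext (q_iterate l)
  rw [this]
  simp

/-- The modulus of the power of w is exp of (7^l - 1)/7^l times Re ζ, hence at least exp(-3), and
exp 3 ≤ 21. -/
lemma le_norm_deriv_q_iterate {p w : ℂ} (hp : p ^ 6 = 1) {l : ℕ}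
    (hw : w ∈ closure (nbh p l)) : 1 / 21 * 7 ^ l ≤ ‖(7 : ℂ) ^ l * w ^ (7 ^ l - 1)‖ := by
  obtain ⟨ζ, hζ, rfl⟩ := closure_nbh_subset p l hw
  have h1 : (1 : ℝ) ≤ 7 ^ l := one_le_pow₀ (by norm_num)
  have e : (ζ / 7 ^ l : ℂ).re = ζ.re / 7 ^ l := by
    have := Complex.div_ofReal_re ζ (7 ^ l)
    simpa using this
  have hcast : ((7 ^ l - 1 : ℕ) : ℝ) = 7 ^ l - 1 := by
    rw [Nat.cast_sub (Nat.one_le_pow _ _ (by norm_num))]; simp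
  have hexp : 1 / 21 ≤ Real.exp (-3) := by
    rw [Real.exp_neg, ← one_div]
    exact one_div_le_one_div_of_le (Real.exp_pos _) exp_three_le
  rw [norm_mul, norm_seven_pow, norm_pow, norm_mul, norm_eq_one_of_pow_six hp, one_mul,
    Complex.norm_exp, e, ← Real.exp_nat_mul, hcast, mul_comm]
  refine mul_le_mul_of_nonneg_left (hexp.trans (Real.exp_le_exp.2 ?_)) (by positivity)
  rw [mul_div_assoc', le_div_iff₀ (by positivity)]
  have := hζ.1.1
  nlinarith

/-- The points `p i` are sixth roots of unity, at angles at most `2π/3` of each other, and every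
`z` is moved towards `0` by adding a multiple of one of them. -/
structure IsTriple (p : Fin 3 → ℂ) : Prop where
  pow : ∀ i, p i ^ 6 = 1
  ang : ∀ i j, ∃ θ : ℝ, |θ| ≤ 21 / 10 ∧ p j = p i * Complex.exp (θ * Complex.I)
  sep : ∀ i j, i ≠ j → 1 ≤ ‖p i - p j‖
  sector : ∀ (z : ℂ) (t : ℝ), 0 ≤ t → ∃ j, ‖z + t * p j‖ ^ 2 ≤ ‖z‖ ^ 2 - t * ‖z‖ + t ^ 2

/-- The range of θ enlarged by 1/10 on each side still fits in the imaginary extent of `strip`; the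
upper bound 16/5 exceeds π, for the passage from s_i to r_i. -/
lemma exists_log_of_angle {p p' : ℂ} {θ : ℝ} (h : p' = p * Complex.exp (θ * Complex.I))
    (h1 : -(21 / 10) ≤ θ) (h2 : θ ≤ 16 / 5) {ξ : ℂ} (hξ : ‖ξ‖ ≤ 1 / 10) :
    θ * Complex.I + ξ ∈ strip ∧
      p * Complex.exp (θ * Complex.I + ξ) = p' * Complex.exp ξ := by
  refine ⟨?_, by rw [Complex.exp_add, h, mul_assoc]⟩
  have hre := abs_le.1 ((Complex.abs_re_le_norm ξ).trans hξ)
  have him := abs_le.1 ((Complex.abs_im_le_norm ξ).trans hξ)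
  rw [mem_strip]
  simp
  refine ⟨⟨?_, ?_⟩, ?_, ?_⟩ <;> linarith [hre.1, hre.2, him.1, him.2]

lemma norm_div_seven_pow_le {l : ℕ} (hl : 20 ≤ l) {ζ : ℂ} (hζ : ζ ∈ cstrip) :
    ‖ζ / 7 ^ l‖ ≤ 1 / 10 := by
  rw [norm_div, norm_seven_pow, div_le_iff₀ (seven_pow_pos l)]
  linarith [norm_le_of_mem_cstrip hζ, seven_pow_large hl]

/-- Seen from p, the tiny neighbourhood of p' sits in logarithmic coordinates close to iθ, well
inside the rectangle, so it is covered by the image of the whole rectangle under the exponential. -/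
lemma closure_nbh_subset_image {p p' : ℂ} (hp : p ^ 6 = 1) {θ : ℝ}
    (h : p' = p * Complex.exp (θ * Complex.I))
    (h1 : -(21 / 10) ≤ θ) (h2 : θ ≤ 16 / 5) {l : ℕ} (hl : 20 ≤ l) :
    closure (nbh p' l) ⊆ q^[l] '' nbh p l := by
  intro w hw
  obtain ⟨ζ, hζ, rfl⟩ := closure_nbh_subset p' l hw
  obtain ⟨hm, he⟩ := exists_log_of_angle h h1 h2 (norm_div_seven_pow_le hl hζ)
  exact ⟨_, ⟨_, hm, rfl⟩, by rw [q_iterate_exp hp, he]⟩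

lemma q_iterate_injOn_closure_nbh {p : ℂ} (hp : p ^ 6 = 1) (l : ℕ) :
    InjOn q^[l] (closure (nbh p l)) := by
  intro w hw w' hw' e
  obtain ⟨ζ, hζ, rfl⟩ := closure_nbh_subset p l hw
  obtain ⟨ζ', hζ', rfl⟩ := closure_nbh_subset p l hw'
  have hp0 : p ≠ 0 := by rintro rfl; norm_num at hp
  simp only [q_iterate_exp hp] at e
  rw [exp_injOn_cstrip hζ hζ' (mul_left_cancel₀ hp0 e)]

/-- A point of the closure of `nbh (p i) l` that is mapped to the closure of `⋃ j, nbh (p j) l` is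
not on the boundary. -/
lemma IsTriple.mem_nbh {p : Fin 3 → ℂ} (hp : IsTriple p) {l : ℕ} (hl : 20 ≤ l) {i : Fin 3} {w : ℂ}
    (hw : w ∈ closure (nbh (p i) l)) (hq : q^[l] w ∈ closure (⋃ j, nbh (p j) l)) :
    w ∈ nbh (p i) l := by
  rw [closure_iUnion_nbh] at hq
  obtain ⟨j, hj⟩ := mem_iUnion.1 hq
  obtain ⟨θ, hθ, h⟩ := hp.ang i j
  have := abs_le.1 hθ
  obtain ⟨w', hw', e⟩ := closure_nbh_subset_image (hp.pow i) h this.1 (by linarith) hl hj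
  rwa [← q_iterate_injOn_closure_nbh (hp.pow i) l (subset_closure hw') hw e]

lemma IsTriple.closure_subset {p : Fin 3 → ℂ} (hp : IsTriple p) {l : ℕ} (hl : 20 ≤ l) (i : Fin 3) :
    closure (⋃ j, nbh (p j) l) ⊆ q^[l] '' nbh (p i) l := by
  rw [closure_iUnion_nbh]
  refine iUnion_subset fun j => ?_
  obtain ⟨θ, hθ, h⟩ := hp.ang i j
  have := abs_le.1 hθ
  exact closure_nbh_subset_image (hp.pow i) h this.1 (by linarith) hl

lemma IsTriple.isNbhdSystem {p : Fin 3 → ℂ} (hp : IsTriple p) :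
    IsNbhdSystem q p fun l i => nbh (p i) l where
  isOpen l i := isOpen_nbh (hp.pow i) l
  connected l i := isConnected_nbh _ l
  mem l i := mem_nbh_self _ l
  image l i := q_image_nbh (hp.pow i) l
  diam := ⟨294, 1 / 7, by norm_num, by norm_num, fun l i => diam_nbh (hp.pow i) l⟩
  expand := by
    refine ⟨1 / 21, 20, by norm_num, by norm_num, fun l hl i => ?_⟩
    have hq : ‖deriv q (p i)‖ = 7 := by
      have := deriv_q_iterate 1 (p i)
      simp only [Function.iterate_one] at this
      rw [this]
      simp [norm_eq_one_of_pow_six (hp.pow i)]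
    rw [hq]
    refine ⟨by linarith [seven_pow_large hl], fun w hw => ?_, hp.closure_subset hl i, fun j => ?_⟩
    · rw [deriv_q_iterate]
      exact le_norm_deriv_q_iterate (hp.pow i) (subset_closure hw)
    · refine ⟨fun w hw => hw.2, (q_iterate_injOn_closure_nbh (hp.pow i) l).mono
        (inter_subset_left.trans subset_closure), fun w hw => ?_⟩
      obtain ⟨w', hw', rfl⟩ := hp.closure_subset hl i (subset_closure (mem_iUnion.2 ⟨j, hw⟩))
      exact ⟨w', ⟨hw', hw⟩, rfl⟩

/-! ### Inverse branches of the iterates of q. -/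

lemma norm_log_sub_log_le {a b : ℂ} (ha : ‖a - 1‖ ≤ 1 / 100) (hb : ‖b - 1‖ ≤ 1 / 100) :
    ‖Complex.log a - Complex.log b‖ ≤ 2 * ‖a - b‖ := by
  have hre : ∀ z ∈ Metric.closedBall (1 : ℂ) (1 / 100), 1 / 2 ≤ z.re := by
    intro z hz
    rw [mem_closedBall_iff_norm] at hz
    have := (abs_le.1 ((Complex.abs_re_le_norm _).trans hz)).1
    simp at this
    linarith
  have hs : ∀ z ∈ Metric.closedBall (1 : ℂ) (1 / 100), z ∈ Complex.slitPlane := fun z hz =>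
    Or.inl (by linarith [hre z hz])
  refine (convex_closedBall (1 : ℂ) (1 / 100)).norm_image_sub_le_of_norm_deriv_le
    (fun x hx => (Complex.differentiableAt_log (hs x hx))) (fun x hx => ?_)
    (mem_closedBall_iff_norm.2 hb) (mem_closedBall_iff_norm.2 ha)
  rw [(Complex.hasDerivAt_log (hs x hx)).deriv, norm_inv]
  have : 1 / 2 ≤ ‖x‖ := (hre x hx).trans (Complex.re_le_norm x)
  calc ‖x‖⁻¹ ≤ (1 / 2 : ℝ)⁻¹ := by gcongr
    _ = 2 := by norm_num

/-- The inverse branch of `q^l` that maps a neighbourhood of `p'` to `nbh p l`. -/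
lemma exists_inverse_branch {p p' : ℂ} (hp : p ^ 6 = 1) {θ : ℝ}
    (h : p' = p * Complex.exp (θ * Complex.I))
    (hθ : |θ| ≤ 21 / 10) {l : ℕ} (hl : 20 ≤ l) :
    ∃ ψ : ℂ → ℂ,
      (∀ u, ‖u - p'‖ ≤ 1 / 100 → q^[l] (ψ u) = u ∧ ‖ψ u - p‖ ≤ 9 / 4 / 7 ^ l) ∧
      ∀ u u', ‖u - p'‖ ≤ 1 / 100 → ‖u' - p'‖ ≤ 1 / 100 → ‖ψ u - ψ u'‖ ≤ 8 / 7 ^ l * ‖u - u'‖ := by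
  have hL := seven_pow_large hl
  have hpn := norm_eq_one_of_pow_six hp
  have hp'n : ‖p'‖ = 1 := by rw [h, norm_mul, hpn, Complex.norm_exp_ofReal_mul_I, one_mul]
  have hp'0 : p' ≠ 0 := by rintro rfl; simp at hp'n
  have hdiv : ∀ u, ‖u / p' - 1‖ = ‖u - p'‖ := fun u => by
    rw [div_sub_one hp'0, norm_div, hp'n, div_one]
  have hlog : ∀ u, ‖u - p'‖ ≤ 1 / 100 → ‖Complex.log (u / p')‖ ≤ 3 / 200 := fun u hu => by
    have := Complex.norm_log_one_add_half_le_self (z := u / p' - 1) (by rw [hdiv]; linarith)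
    rw [add_sub_cancel, hdiv] at this
    linarith
  have hx : ∀ u, ‖u - p'‖ ≤ 1 / 100 →
      ‖(θ * Complex.I + Complex.log (u / p')) / 7 ^ l‖ ≤ 423 / 200 / 7 ^ l := fun u hu => by
    rw [norm_div, norm_seven_pow]
    gcongr
    refine (norm_add_le _ _).trans ?_
    rw [norm_mul, Complex.norm_I, mul_one, Complex.norm_real, Real.norm_eq_abs]
    linarith [hlog u hu]
  have hsmall : (423 / 200 / 7 ^ l : ℝ) ≤ 1 / 1000 := by
    rw [div_le_iff₀ (seven_pow_pos l)]; linarith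
  -- The branch is explicit: its exponent is at most 21/10 + 3/200 = 423/200 before division by 7^l,
  -- and the second-order error of the exponential is absorbed in rounding this up to 9/4.
  refine ⟨fun u => p * Complex.exp ((θ * Complex.I + Complex.log (u / p')) / 7 ^ l), ?_, ?_⟩
  · intro u hu
    have hu0 : u / p' ≠ 0 := by
      intro h0
      have := hdiv u
      rw [h0] at this
      simp at this
      linarith
    constructor
    · rw [q_iterate_exp hp, Complex.exp_add, Complex.exp_log hu0, ← mul_assoc, ← h,
        mul_div_cancel₀ _ hp'0]
    · set x := (θ * Complex.I + Complex.log (u / p')) / 7 ^ l with hxdef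
      have hxu := hx u hu
      rw [← hxdef] at hxu
      have h1 : ‖Complex.exp x - 1 - x‖ ≤ ‖x‖ ^ 2 :=
        Complex.norm_exp_sub_one_sub_id_le (by linarith)
      have h2 : ‖Complex.exp x - 1‖ ≤ ‖x‖ ^ 2 + ‖x‖ := by
        have := norm_add_le (Complex.exp x - 1 - x) x
        rw [sub_add_cancel] at this
        linarith
      rw [← mul_sub_one, norm_mul, hpn, one_mul]
      calc ‖Complex.exp x - 1‖ ≤ ‖x‖ * (1 + ‖x‖) := by linarith
        _ ≤ 423 / 200 / 7 ^ l * (1 + 1 / 1000) := by gcongr; linarith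
        _ = (423 / 200 * (1 + 1 / 1000)) / 7 ^ l := by ring
        _ ≤ 9 / 4 / 7 ^ l := by gcongr; norm_num
  · intro u u' hu hu'
    have hre : ∀ u, ‖u - p'‖ ≤ 1 / 100 →
        ((θ * Complex.I + Complex.log (u / p')) / 7 ^ l : ℂ).re ≤ 1 := fun u hu =>
      (Complex.re_le_norm _).trans ((hx u hu).trans (by linarith))
    calc _ = ‖Complex.exp ((θ * Complex.I + Complex.log (u / p')) / 7 ^ l)
            - Complex.exp ((θ * Complex.I + Complex.log (u' / p')) / 7 ^ l)‖ := by
          rw [← mul_sub, norm_mul, hpn, one_mul]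
      _ ≤ Real.exp 1 * ‖(θ * Complex.I + Complex.log (u / p')) / 7 ^ l
            - (θ * Complex.I + Complex.log (u' / p')) / 7 ^ l‖ :=
          norm_exp_sub_exp_le (hre u hu) (hre u' hu')
      _ = Real.exp 1 * (‖Complex.log (u / p') - Complex.log (u' / p')‖ / 7 ^ l) := by
          rw [← sub_div, add_sub_add_left_eq_sub, norm_div, norm_seven_pow]
      _ ≤ 3 * (2 * ‖u / p' - u' / p'‖ / 7 ^ l) := by
          gcongr
          · exact exp_one_le
          · exact norm_log_sub_log_le (by rwa [hdiv]) (by rwa [hdiv])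
      _ = 6 / 7 ^ l * ‖u - u'‖ := by rw [← sub_div, norm_div, hp'n]; ring
      _ ≤ 8 / 7 ^ l * ‖u - u'‖ := by gcongr; norm_num

/-- The radius 9/4 is chosen to suit both sides: it contains the range of the inverse branches, and
its logarithmic image has size at most 24/10, below the distance 5/2 from 0 to the boundary of the
rectangle. -/
lemma closedBall_subset_nbh {p : ℂ} (hp : p ^ 6 = 1) {l : ℕ} (hl : 20 ≤ l) :
    Metric.closedBall p (9 / 4 / 7 ^ l) ⊆ nbh p l := by
  intro w hw
  rw [mem_closedBall_iff_norm] at hw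
  have hL := seven_pow_large hl
  have hpn := norm_eq_one_of_pow_six hp
  have hp0 : p ≠ 0 := by rintro rfl; simp at hpn
  set t := w / p - 1 with ht
  have htn : ‖t‖ ≤ 9 / 4 / 7 ^ l := by rw [ht, div_sub_one hp0, norm_div, hpn, div_one]; exact hw
  have hsmall : (9 / 4 / 7 ^ l : ℝ) ≤ 1 / 1000 := by
    rw [div_le_iff₀ (seven_pow_pos l)]; linarith
  have hlog : ‖Complex.log (1 + t)‖ ≤ 24 / 10 / 7 ^ l := by
    have h1 := Complex.norm_log_one_add_le (z := t) (by linarith)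
    have h2 : (1 - ‖t‖)⁻¹ ≤ 2 := by
      rw [inv_le_comm₀ (by linarith) (by norm_num)]
      linarith
    have h3 : ‖t‖ ^ 2 * (1 - ‖t‖)⁻¹ / 2 ≤ ‖t‖ ^ 2 := by nlinarith [sq_nonneg ‖t‖]
    calc ‖Complex.log (1 + t)‖ ≤ ‖t‖ * (1 + ‖t‖) := by linarith
      _ ≤ 9 / 4 / 7 ^ l * (1 + 1 / 1000) := by gcongr; linarith
      _ = (9 / 4 * (1 + 1 / 1000)) / 7 ^ l := by ring
      _ ≤ 24 / 10 / 7 ^ l := by gcongr; norm_num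
  have hne : w / p ≠ 0 := by
    intro h0
    rw [ht, h0] at htn
    simp at htn
    linarith
  refine ⟨7 ^ l * Complex.log (1 + t), ?_, ?_⟩
  · have hn : ‖(7 : ℂ) ^ l * Complex.log (1 + t)‖ ≤ 24 / 10 := by
      rw [norm_mul, norm_seven_pow]
      calc (7 : ℝ) ^ l * ‖Complex.log (1 + t)‖ ≤ 7 ^ l * (24 / 10 / 7 ^ l) := by gcongr
        _ = 24 / 10 := by field_simp
    have hre := abs_le.1 ((Complex.abs_re_le_norm _).trans hn)
    have him := abs_le.1 ((Complex.abs_im_le_norm _).trans hn)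
    rw [mem_strip]
    refine ⟨⟨?_, ?_⟩, ?_, ?_⟩ <;> linarith [hre.1, hre.2, him.1, him.2]
  · simp only
    rw [mul_div_cancel_left₀ _ (by simp), ht, add_sub_cancel, Complex.exp_log hne,
      mul_div_cancel₀ _ hp0]

/-! ### The two triples of fixed points -/

lemma rPt_ratio (i j : Fin 3) : ∃ m : ℤ, (m = -1 ∨ m = 0 ∨ m = 1) ∧
    rPt j = rPt i * Complex.exp ((2 * Real.pi / 3 * m : ℝ) * Complex.I) := by
  -- Here m is the representative of j - i modulo 3 in {-1, 0, 1}, and k counts the full turns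
  -- dropped.
  have key : ∀ m k : ℤ, ((j : ℕ) : ℤ) = (i : ℕ) + m + 3 * k →
      rPt j = rPt i * Complex.exp ((2 * Real.pi / 3 * m : ℝ) * Complex.I) := by
    intro m k h
    unfold rPt
    rw [← Complex.exp_add, Complex.exp_eq_exp_iff_exists_int]
    refine ⟨k, ?_⟩
    have : ((j : ℕ) : ℂ) = (i : ℕ) + m + 3 * k := by exact_mod_cast congrArg (Int.cast (R := ℂ)) h
    rw [this]
    push_cast
    ring
  have hi := i.isLt
  have hj := j.isLt
  by_cases h1 : ((j : ℕ) : ℤ) - (i : ℕ) = 2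
  · exact ⟨-1, by simp, key _ 1 (by omega)⟩
  by_cases h2 : ((j : ℕ) : ℤ) - (i : ℕ) = -2
  · exact ⟨1, by simp, key _ (-1) (by omega)⟩
  exact ⟨(j : ℕ) - (i : ℕ), by omega, key _ 0 (by omega)⟩

lemma rPt_pow_three (i : Fin 3) : rPt i ^ 3 = 1 := by
  unfold rPt
  rw [← Complex.exp_nat_mul, Complex.exp_eq_one_iff]
  exact ⟨(i : ℕ), by push_cast; ring⟩

lemma sPt_pow_three (i : Fin 3) : sPt i ^ 3 = -1 := by
  unfold sPt
  rw [Odd.neg_pow (by decide), rPt_pow_three]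

lemma rPt_zero : rPt 0 = 1 := by simp [rPt]

lemma rPt_one : rPt 1 = ⟨-1 / 2, Real.sqrt 3 / 2⟩ := by
  have : rPt 1 = Complex.exp ((2 * Real.pi / 3 : ℝ) * Complex.I) := by
    unfold rPt; congr 1; push_cast; simp; ring
  rw [this, Complex.exp_mul_I, ← Complex.ofReal_cos, ← Complex.ofReal_sin,
    show 2 * Real.pi / 3 = Real.pi - Real.pi / 3 by ring, Real.cos_pi_sub, Real.sin_pi_sub,
    Real.cos_pi_div_three, Real.sin_pi_div_three]
  apply Complex.ext <;> simp
  norm_num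

lemma rPt_two : rPt 2 = ⟨-1 / 2, -(Real.sqrt 3 / 2)⟩ := by
  have : rPt 2 = rPt 1 ^ 2 := by
    unfold rPt; rw [← Complex.exp_nat_mul]; congr 1; push_cast; simp; ring
  have h3 := Real.mul_self_sqrt (show (0 : ℝ) ≤ 3 by norm_num)
  rw [this, rPt_one, sq]
  apply Complex.ext
  · simp only [Complex.mul_re]; linarith
  · simp only [Complex.mul_im]; ring

/-- The three directions are 2π/3 apart, so one of them makes an angle of at least 2π/3 with z; x is
the real scalar product of z with it. -/
lemma rPt_sector (z : ℂ) : ∃ j, ∃ x : ℝ, x ≤ -(‖z‖ / 2) ∧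
    ∀ t : ℝ, ‖z + t * rPt j‖ ^ 2 = ‖z‖ ^ 2 + 2 * t * x + t ^ 2 := by
  have hz : ‖z‖ ^ 2 = z.re ^ 2 + z.im ^ 2 := by rw [← Complex.normSq_eq_norm_sq, Complex.normSq_apply]; ring
  have h3 := Real.mul_self_sqrt (show (0 : ℝ) ≤ 3 by norm_num)
  have hs : (0 : ℝ) ≤ Real.sqrt 3 := Real.sqrt_nonneg 3
  have expand : ∀ (a b t : ℝ), a ^ 2 + b ^ 2 = 1 →
      ‖z + t * (⟨a, b⟩ : ℂ)‖ ^ 2 = ‖z‖ ^ 2 + 2 * t * (z.re * a + z.im * b) + t ^ 2 := by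
    intro a b t hab
    rw [hz, ← Complex.normSq_eq_norm_sq, Complex.normSq_apply]
    simp
    linear_combination t ^ 2 * hab
  by_cases hx : z.re ≤ -(‖z‖ / 2)
  · refine ⟨0, z.re, hx, fun t => ?_⟩
    have := expand 1 0 t (by norm_num)
    rw [rPt_zero, show (1 : ℂ) = ⟨1, 0⟩ from rfl, this]
    ring
  push Not at hx
  have hle : z.re ≤ ‖z‖ := Complex.re_le_norm z
  have h0 := norm_nonneg z
  -- After squaring and cancelling |z| - Re z, this is equivalent to Re z ≥ -|z|/2, the case at
  -- hand. The sign of Im z then decides which of the two non-real roots points away from z.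
  have main : ‖z‖ - z.re ≤ Real.sqrt 3 * |z.im| := by
    refine abs_le_of_sq_le_sq' ?_ (by positivity) |>.2
    rw [mul_pow, sq_abs, sq (Real.sqrt 3), h3]
    nlinarith
  rcases le_total 0 z.im with him | him
  · rw [abs_of_nonneg him] at main
    refine ⟨2, z.re * (-1 / 2) + z.im * (-(Real.sqrt 3 / 2)), by linarith, fun t => ?_⟩
    rw [rPt_two]
    exact expand _ _ t (by nlinarith)
  · rw [abs_of_nonpos him] at main
    refine ⟨1, z.re * (-1 / 2) + z.im * (Real.sqrt 3 / 2), by linarith, fun t => ?_⟩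
    rw [rPt_one]
    exact expand _ _ t (by nlinarith)

lemma rPt_sep (i j : Fin 3) (h : i ≠ j) : 1 ≤ ‖rPt i - rPt j‖ := by
  have h3 := Real.mul_self_sqrt (show (0 : ℝ) ≤ 3 by norm_num)
  have h1 : (1 : ℝ) ≤ Real.sqrt 3 := Real.one_le_sqrt.2 (by norm_num)
  have a : 1 ≤ ‖rPt 0 - rPt 1‖ := by
    refine le_trans ?_ (Complex.abs_re_le_norm _)
    rw [rPt_zero, rPt_one]; norm_num
  have b : 1 ≤ ‖rPt 0 - rPt 2‖ := by
    refine le_trans ?_ (Complex.abs_re_le_norm _)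
    rw [rPt_zero, rPt_two]; norm_num
  have c : 1 ≤ ‖rPt 1 - rPt 2‖ := by
    refine le_trans ?_ (Complex.abs_im_le_norm _)
    rw [rPt_one, rPt_two]
    refine le_trans ?_ (le_abs_self _)
    simp
  fin_cases i <;> fin_cases j <;> simp at h ⊢ <;> first | assumption | (rw [norm_sub_rev]; assumption)

lemma isTriple_rPt : IsTriple rPt where
  pow i := by rw [show 6 = 3 * 2 from rfl, pow_mul, rPt_pow_three, one_pow]
  ang i j := by
    obtain ⟨m, hm, h⟩ := rPt_ratio i j
    refine ⟨_, ?_, h⟩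
    have := Real.pi_lt_d2
    have := Real.pi_pos
    rw [abs_le]
    rcases hm with rfl | rfl | rfl <;> constructor <;> push_cast <;> linarith
  sep := rPt_sep
  sector z t ht := by
    obtain ⟨j, x, hx, h⟩ := rPt_sector z
    refine ⟨j, ?_⟩
    rw [h t]
    nlinarith

lemma isTriple_sPt : IsTriple sPt where
  pow i := by rw [show 6 = 3 * 2 from rfl, pow_mul, sPt_pow_three]; norm_num
  ang i j := by
    obtain ⟨θ, hθ, h⟩ := isTriple_rPt.ang i j
    exact ⟨θ, hθ, by rw [sPt, sPt, h, neg_mul]⟩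
  sep i j h := by
    rw [sPt, sPt, neg_sub_neg]
    exact rPt_sep j i h.symm
  sector z t ht := by
    obtain ⟨j, hj⟩ := isTriple_rPt.sector (-z) t ht
    refine ⟨j, ?_⟩
    rw [norm_neg] at hj
    rwa [sPt, ← norm_neg, show -(z + t * -rPt j) = -z + t * rPt j by ring]

/-- Since s_i = -r_i, the angle is π plus a multiple of 2π/3: it is ±π/3 if i ≠ j, and π if i = j.
Only the first case is within reach of `exists_inverse_branch`. -/
lemma sPt_rPt_ratio (i j : Fin 3) : ∃ θ : ℝ, -(21 / 10) ≤ θ ∧ θ ≤ 16 / 5 ∧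
    (i ≠ j → |θ| ≤ 21 / 10) ∧ rPt j = sPt i * Complex.exp (θ * Complex.I) := by
  obtain ⟨m, hm, h⟩ := rPt_ratio i j
  have h1 := Real.pi_lt_d2
  have h2 := Real.pi_pos
  have e1 : ∀ x : ℝ, Complex.exp ((x + Real.pi : ℝ) * Complex.I) = -Complex.exp (x * Complex.I) := by
    intro x
    rw [Complex.ofReal_add, add_mul, Complex.exp_add, Complex.exp_pi_mul_I, mul_neg_one]
  have e2 : ∀ x : ℝ, Complex.exp ((x - Real.pi : ℝ) * Complex.I) = -Complex.exp (x * Complex.I) := by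
    intro x
    rw [← sub_add_cancel x Real.pi, e1, neg_neg, sub_add_cancel]
  rcases hm with rfl | rfl | rfl
  · refine ⟨2 * Real.pi / 3 * (-1 : ℤ) + Real.pi, ?_, ?_, fun _ => ?_, ?_⟩
    · push_cast; linarith
    · push_cast; linarith
    · rw [abs_le]; push_cast; constructor <;> linarith
    · rw [e1, sPt, neg_mul_neg]; exact h
  · refine ⟨2 * Real.pi / 3 * (0 : ℤ) + Real.pi, ?_, ?_, fun hij => ?_, ?_⟩
    · push_cast; linarith
    · push_cast; linarith
    · have := rPt_sep i j hij
      rw [h] at this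
      norm_num at this
    · rw [e1, sPt, neg_mul_neg]; exact h
  · refine ⟨2 * Real.pi / 3 * (1 : ℤ) - Real.pi, ?_, ?_, fun _ => ?_, ?_⟩
    · push_cast; linarith
    · push_cast; linarith
    · rw [abs_le]; push_cast; constructor <;> linarith
    · rw [e2, sPt, neg_mul_neg]; exact h

lemma closure_iUnion_rPt_subset {l : ℕ} (hl : 20 ≤ l) (j : Fin 3) :
    closure (⋃ i, nbh (rPt i) l) ⊆ q^[l] '' nbh (sPt j) l := by
  rw [closure_iUnion_nbh]
  refine iUnion_subset fun i => ?_
  obtain ⟨θ, h1, h2, -, h⟩ := sPt_rPt_ratio j i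
  exact closure_nbh_subset_image (isTriple_sPt.pow j) h h1 h2 hl

end Blender

namespace Blender

open Set Filter Topology

/-! ### Orbits through sequences of compact sets -/

section Chains

variable {X : Type*}

lemma chain_succ (g : X → X) (D : ℕ → Set X) (n : ℕ) :
    {x | ∀ k ≤ n + 1, g^[k] x ∈ D k} = D 0 ∩ g ⁻¹' {x | ∀ k ≤ n, g^[k] x ∈ D (k + 1)} := by
  ext x
  constructor
  · intro h
    exact ⟨h 0 (Nat.zero_le _), fun k hk => by
      rw [← Function.iterate_succ_apply]; exact h _ (by omega)⟩
  · rintro ⟨h0, h⟩ (_ | k) hk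
    · exact h0
    · rw [Function.iterate_succ_apply]; exact h k (by omega)

/-- Continuity is needed only on the sets D n, so this applies to perturbations that are controlled
only on the domain of a blender. -/
lemma isCompact_chain [TopologicalSpace X] [T2Space X] {g : X → X} {D : ℕ → Set X}
    (hD : ∀ n, IsCompact (D n)) (hg : ∀ n, ContinuousOn g (D n)) (n : ℕ) :
    IsCompact {x | ∀ k ≤ n, g^[k] x ∈ D k} := by
  induction n generalizing D with
  | zero => simpa using hD 0
  | succ n ih =>
    rw [chain_succ]
    have := ih (fun n => hD (n + 1)) (fun n => hg (n + 1))
    exact (hD 0).of_isClosed_subset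
      ((hg 0).preimage_isClosed_of_isClosed (hD 0).isClosed this.isClosed) inter_subset_left

lemma nonempty_chain {g : X → X} {D : ℕ → Set X} (hne : ∀ n, (D n).Nonempty)
    (hD : ∀ n, D (n + 1) ⊆ g '' D n) (n : ℕ) : {x | ∀ k ≤ n, g^[k] x ∈ D k}.Nonempty := by
  induction n generalizing D with
  | zero => simpa using hne 0
  | succ n ih =>
    rw [chain_succ]
    obtain ⟨y, hy⟩ := ih (fun n => hne (n + 1)) (fun n => hD (n + 1))
    obtain ⟨x, hx, rfl⟩ := hD 0 (hy 0 (Nat.zero_le _))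
    exact ⟨x, hx, hy⟩

lemma exists_orbit_of_chain [TopologicalSpace X] [T2Space X] {g : X → X} {D : ℕ → Set X}
    (hc : ∀ n, IsCompact (D n)) (hg : ∀ n, ContinuousOn g (D n)) (hne : ∀ n, (D n).Nonempty)
    (hD : ∀ n, D (n + 1) ⊆ g '' D n) : ∃ x, ∀ k, g^[k] x ∈ D k := by
  obtain ⟨x, hx⟩ := IsCompact.nonempty_iInter_of_sequence_nonempty_isCompact_isClosed
    (fun n => {x | ∀ k ≤ n, g^[k] x ∈ D k}) (fun n x hx k hk => hx k (by omega))
    (nonempty_chain hne hD) (isCompact_chain hc hg 0) (fun n => (isCompact_chain hc hg n).isClosed)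
  exact ⟨x, fun k => mem_iInter.1 hx k k le_rfl⟩

/-- If every member `D` of a family of compact subsets of `Z` is mapped over some member of the
family, then every member contains a point whose orbit stays in `Z`. -/
lemma exists_mem_staySet [TopologicalSpace X] [T2Space X] {g : X → X} {Z : Set X}
    {G : Set (Set X)} (hg : ContinuousOn g Z) (hZ : ∀ D ∈ G, D ⊆ Z) (hc : ∀ D ∈ G, IsCompact D)
    (hne : ∀ D ∈ G, D.Nonempty) (hD : ∀ D ∈ G, ∃ D' ∈ G, D' ⊆ g '' D) {D : Set X} (h : D ∈ G) :
    ∃ x ∈ D, x ∈ staySet g Z := by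
  choose! next hnext hsub using hD
  set E : ℕ → Set X := fun n => next^[n] D with hE
  have hEG : ∀ n, E n ∈ G := by
    intro n
    induction n with
    | zero => exact h
    | succ n ih =>
      have : E (n + 1) = next (E n) := Function.iterate_succ_apply' _ _ _
      rw [this]; exact hnext _ ih
  obtain ⟨x, hx⟩ := exists_orbit_of_chain (fun n => hc _ (hEG n))
    (fun n => hg.mono (hZ _ (hEG n))) (fun n => hne _ (hEG n)) (fun n => by
      have : E (n + 1) = next (E n) := Function.iterate_succ_apply' _ _ _
      rw [this]; exact hsub _ (hEG n))
  exact ⟨x, hx 0, fun k => hZ _ (hEG k) (hx k)⟩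

lemma isCompact_staySet [TopologicalSpace X] [T2Space X] {g : X → X} {K : Set X}
    (hK : IsCompact K) (hg : ContinuousOn g K) : IsCompact (staySet g K) := by
  have h : staySet g K = ⋂ n, {x | ∀ k ≤ n, g^[k] x ∈ K} := by
    ext x
    simp only [staySet, mem_iInter, mem_ofPred_eq]
    exact ⟨fun h n k _ => h k, fun h n => h n n le_rfl⟩
  have hc := fun n => isCompact_chain (fun _ : ℕ => hK) (fun _ => hg) n
  rw [h]
  exact (hc 0).of_isClosed_subset (isClosed_iInter fun n => (hc n).isClosed) (iInter_subset _ 0)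

lemma staySet_subset (g : X → X) (S : Set X) : staySet g S ⊆ S := fun _ h => h 0

lemma image_staySet_subset (g : X → X) (S : Set X) : g '' staySet g S ⊆ staySet g S := by
  rintro _ ⟨x, hx, rfl⟩ n
  rw [← Function.iterate_succ_apply]
  exact hx (n + 1)

lemma staySet_subset_image {g : X → X} {S : Set X} (h : staySet g S ⊆ g '' S) :
    staySet g S ⊆ g '' staySet g S := by
  intro x hx
  obtain ⟨y, hy, rfl⟩ := h hx
  refine ⟨y, ?_, rfl⟩
  rintro (_ | n)
  · exact hy
  · rw [Function.iterate_succ_apply]; exact hx n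

lemma exists_history {f : X → X} {L : Set X} (h : L ⊆ f '' L) {x : X} (hx : x ∈ L) :
    ∃ y ∈ natExt f L, y 0 = x := by
  choose! pre hpre hf using h
  have hmem : ∀ n, pre^[n] x ∈ L := by
    intro n
    induction n with
    | zero => exact hx
    | succ n ih => rw [Function.iterate_succ_apply']; exact hpre ih
  refine ⟨fun n => pre^[n] x, fun k => ⟨hmem k, ?_⟩, rfl⟩
  simp only [Function.iterate_succ_apply']
  exact hf (hmem k)

lemma iterate_hatMap (f : X → X) (n : ℕ) (x : ℕ → X) (k : ℕ) : (hatMap f)^[n] x k = f^[n] (x k) := by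
  induction n generalizing x with
  | zero => rfl
  | succ n ih => rw [Function.iterate_succ_apply, ih]; rfl

/-- Surjectivity on L supplies a past inside L, and forward invariance supplies the future. -/
lemma subset_maxInvSet {f : X → X} {L S : Set X} (h : L ⊆ f '' L) (hf : f '' L ⊆ L) (hS : L ⊆ S) :
    L ⊆ maxInvSet f S := by
  intro x hx
  obtain ⟨y, hy, rfl⟩ := exists_history h hx
  have hfor : ∀ n, ∀ z ∈ L, f^[n] z ∈ L := by
    intro n
    induction n with
    | zero => exact fun z hz => hz
    | succ n ih => intro z hz; rw [Function.iterate_succ_apply]; exact ih _ (hf ⟨z, hz, rfl⟩)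
  refine ⟨y, ⟨fun k => ⟨mem_univ _, (hy k).2⟩, fun n => ⟨?_, ?_⟩⟩, rfl⟩
  · change (hatMap f)^[n] y 0 ∈ S
    rw [iterate_hatMap]
    exact hS (hfor n _ (hy 0).1)
  · exact hS (hy _).1

lemma hatMap_mem_natExt {f : X → X} {L : Set X} (hL : f '' L ⊆ L) {x : ℕ → X}
    (hx : x ∈ natExt f L) : hatMap f x ∈ natExt f L := fun k =>
  ⟨hL ⟨_, (hx k).1, rfl⟩, by simp only [hatMap]; rw [(hx k).2]⟩

lemma hatShift_mem_natExt {f : X → X} {L : Set X} (n : ℕ) {x : ℕ → X}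
    (hx : x ∈ natExt f L) : hatShift n x ∈ natExt f L := fun k =>
  ⟨(hx _).1, by simpa [hatShift, add_right_comm] using (hx (k + n)).2⟩

lemma hatMap_hatShift {f : X → X} {L : Set X} {x : ℕ → X}
    (hx : x ∈ natExt f L) : hatMap f (hatShift 1 x) = x := funext fun k => (hx k).2

lemma hatShift_hatMap {f : X → X} {L : Set X} {x : ℕ → X}
    (hx : x ∈ natExt f L) : hatShift 1 (hatMap f x) = x := funext fun k => (hx k).2

end Chains

/-! ### Contractions -/

lemma exists_fixed_point {X : Type*} [MetricSpace X] {s : Set X} (hs : IsComplete s)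
    (hne : s.Nonempty) {T : X → X} (hT : MapsTo T s s) {c : ℝ} (hc0 : 0 ≤ c) (hc : c < 1)
    (h : ∀ x ∈ s, ∀ y ∈ s, dist (T x) (T y) ≤ c * dist x y) : ∃ x ∈ s, T x = x := by
  obtain ⟨x, hx⟩ := hne
  have hcon : ContractingWith ⟨c, hc0⟩ (hT.restrict T s s) :=
    ⟨by exact_mod_cast hc, LipschitzWith.of_dist_le_mul fun a b => h _ a.2 _ b.2⟩
  obtain ⟨y, hy, hfix, -⟩ := ContractingWith.exists_fixedPoint' hs hT hcon hx (edist_ne_top _ _)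
  exact ⟨y, hy, hfix⟩

/-- The recursion controls each term by the next one, so it is unrolled to infinity and boundedness
kills the remainder. With `e = 0` it gives uniqueness of bounded orbits; with `e > 0` it gives
Lipschitz dependence on the base. -/
lemma le_div_of_bounded_recursion {d : ℕ → ℝ} {c e M : ℝ} (hc0 : 0 ≤ c) (hc : c < 1)
    (hM : ∀ n, d n ≤ M) (h : ∀ n, d n ≤ c * d (n + 1) + e) : d 0 ≤ e / (1 - c) := by
  have h1c : 0 < 1 - c := by linarith
  set K := e / (1 - c) with hK
  have hKe : K = c * K + e := by rw [hK]; field_simp; ring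
  have step : ∀ n, d 0 - K ≤ c ^ n * (d n - K) := by
    intro n
    induction n with
    | zero => simp
    | succ n ih =>
      refine ih.trans ?_
      rw [pow_succ, mul_assoc]
      exact mul_le_mul_of_nonneg_left (by linarith [h n]) (pow_nonneg hc0 n)
  have hlim : Tendsto (fun n => c ^ n * (M - K)) atTop (𝓝 (0 * (M - K))) :=
    (tendsto_pow_atTop_nhds_zero_of_lt_one hc0 hc).mul_const _
  have := ge_of_tendsto' hlim fun n => (step n).trans
    (mul_le_mul_of_nonneg_left (by linarith [hM n] : d n - K ≤ M - K) (pow_nonneg hc0 n))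
  linarith

open BoundedContinuousFunction in
/-- A continuous solution of `m y = φ y (m (τ y))`, where the maps `φ y` are uniform contractions
of a disc. -/
lemma exists_invariant_section {Y : Type*} [TopologicalSpace Y] {τ : Y → Y} (φ : Y → ℂ → ℂ)
    {r c : ℝ} (hr : 0 ≤ r) (hc0 : 0 ≤ c) (hc : c < 1)
    (hcont : ∀ m : Y → ℂ, Continuous m → (∀ y, ‖m y‖ ≤ r) → Continuous fun y => φ y (m (τ y)))
    (hmaps : ∀ y x, ‖x‖ ≤ r → ‖φ y x‖ ≤ r)
    (hlip : ∀ y x x', ‖x‖ ≤ r → ‖x'‖ ≤ r → ‖φ y x - φ y x'‖ ≤ c * ‖x - x'‖) :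
    ∃ m : Y → ℂ, Continuous m ∧ (∀ y, ‖m y‖ ≤ r) ∧ ∀ y, m y = φ y (m (τ y)) := by
  classical
  have hle : ∀ m : Y →ᵇ ℂ, m ∈ Metric.closedBall (0 : Y →ᵇ ℂ) r → ∀ y, ‖m y‖ ≤ r := fun m hm y =>
    (m.norm_coe_le_norm y).trans (by simpa using hm)
  -- The operator is continuous-valued only on the ball of radius r, so it is given the irrelevant
  -- value 0 elsewhere.
  let T : (Y →ᵇ ℂ) → (Y →ᵇ ℂ) := fun m =>
    if h : m ∈ Metric.closedBall (0 : Y →ᵇ ℂ) r then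
      BoundedContinuousFunction.ofNormedAddCommGroup (fun y => φ y (m (τ y)))
        (hcont m m.continuous (hle m h)) r fun y => hmaps y _ (hle m h _)
    else 0
  have hT : ∀ m ∈ Metric.closedBall (0 : Y →ᵇ ℂ) r, ∀ y, T m y = φ y (m (τ y)) := by
    intro m hm y
    simp only [T, dif_pos hm]
    rfl
  obtain ⟨m, hm, hfix⟩ := exists_fixed_point
    (s := Metric.closedBall (0 : Y →ᵇ ℂ) r) (T := T) Metric.isClosed_closedBall.isComplete
    ⟨0, Metric.mem_closedBall_self hr⟩
    (fun m hm => by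
      rw [mem_closedBall_zero_iff, BoundedContinuousFunction.norm_le hr]
      intro y
      rw [hT m hm]
      exact hmaps y _ (hle m hm _)) hc0 hc
    (fun m hm m' hm' => by
      rw [BoundedContinuousFunction.dist_le (by positivity)]
      intro y
      rw [hT m hm, hT m' hm', dist_eq_norm]
      refine (hlip y _ _ (hle m hm _) (hle m' hm' _)).trans ?_
      rw [← dist_eq_norm]
      exact mul_le_mul_of_nonneg_left (BoundedContinuousFunction.dist_coe_le_dist _) hc0)
  refine ⟨m, m.continuous, hle m hm, fun y => ?_⟩
  rw [← hT m hm, hfix]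

/-- Bounded solutions of the cohomological equation `Z y = A y * Z (τ y) + B y`. -/
lemma exists_affine_section {Y : Type*} [TopologicalSpace Y] {τ : Y → Y} (hτ : Continuous τ)
    {A B : Y → ℂ} (hA : Continuous A) (hB : Continuous B) {c b : ℝ} (hb0 : 0 ≤ b) (hc0 : 0 ≤ c)
    (hc : c < 1) (hAc : ∀ y, ‖A y‖ ≤ c) (hBb : ∀ y, ‖B y‖ ≤ b) :
    ∃ Z : Y → ℂ, Continuous Z ∧ (∀ y, ‖Z y‖ ≤ b / (1 - c)) ∧ ∀ y, Z y = A y * Z (τ y) + B y := by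
  have h1c : 0 < 1 - c := by linarith
  refine exists_invariant_section (fun y x => A y * x + B y) (by positivity) hc0 hc
    (fun m hm _ => (hA.mul (hm.comp hτ)).add hB) (fun y x hx => ?_) (fun y x x' _ _ => ?_)
  · calc ‖A y * x + B y‖ ≤ ‖A y‖ * ‖x‖ + ‖B y‖ := (norm_add_le _ _).trans (by rw [norm_mul])
      _ ≤ c * (b / (1 - c)) + b := by gcongr; exacts [hAc y, hBb y]
      _ = b / (1 - c) := by field_simp; ring
  · rw [add_sub_add_right_eq_sub, ← mul_sub, norm_mul]
    gcongr
    exact hAc y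

/-- Invariant slope fields of dominated cocycles. -/
lemma exists_slope_section {Y : Type*} [TopologicalSpace Y] {τ : Y → Y} (hτ : Continuous τ)
    {A B C D : Y → ℂ} (hA : Continuous A) (hB : Continuous B) (hC : Continuous C)
    (hD : Continuous D) {M : ℝ} (hM : 0 < M) (hAM : ∀ y, ‖A y‖ ≤ M) (hBM : ∀ y, ‖B y‖ ≤ M)
    (hCM : ∀ y, ‖C y‖ ≤ M) (hDM : ∀ y, 8 * M ≤ ‖D y‖) :
    ∃ m : Y → ℂ, Continuous m ∧ (∀ y, ‖m y‖ ≤ 1) ∧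
      ∀ y, m y * (C y * m (τ y) + D y) = A y * m (τ y) + B y := by
  have hlow : ∀ y x, ‖x‖ ≤ 1 → ‖D y‖ - M ≤ ‖C y * x + D y‖ := by
    intro y x hx
    have h1 : ‖C y * x‖ ≤ M * 1 := by rw [norm_mul]; gcongr; exact hCM y
    have h2 := norm_sub_le (C y * x + D y) (C y * x)
    rw [add_sub_cancel_left] at h2
    linarith
  have hne : ∀ y x, ‖x‖ ≤ 1 → C y * x + D y ≠ 0 := fun y x hx h0 => by
    have := hlow y x hx
    rw [h0, norm_zero] at this
    linarith [hDM y]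
  have hmaps : ∀ y x, ‖x‖ ≤ 1 → ‖(A y * x + B y) / (C y * x + D y)‖ ≤ 1 := by
    intro y x hx
    have h1 := hlow y x hx
    have h8 := hDM y
    rw [norm_div, div_le_one (by linarith)]
    have : ‖A y * x + B y‖ ≤ M * 1 + M :=
      (norm_add_le _ _).trans (by rw [norm_mul]; gcongr; exacts [hAM y, hBM y])
    linarith
  have hlip : ∀ y x x', ‖x‖ ≤ 1 → ‖x'‖ ≤ 1 →
      ‖(A y * x + B y) / (C y * x + D y) - (A y * x' + B y) / (C y * x' + D y)‖
        ≤ 1 / 2 * ‖x - x'‖ := by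
    intro y x x' hx hx'
    have h1 := hlow y x hx
    have h2 := hlow y x' hx'
    have h8 := hDM y
    -- The difference of two values of a Möbius map is its determinant times x - x', over the
    -- product of the denominators; domination of the other entries by D makes this a contraction.
    have e : (A y * x + B y) / (C y * x + D y) - (A y * x' + B y) / (C y * x' + D y)
        = (A y * D y - B y * C y) * (x - x') / ((C y * x + D y) * (C y * x' + D y)) := by
      rw [div_sub_div _ _ (hne y x hx) (hne y x' hx')]
      ring
    have hnum : ‖A y * D y - B y * C y‖ ≤ M * ‖D y‖ + M * M :=
      (norm_sub_le _ _).trans (by rw [norm_mul, norm_mul]; gcongr; exacts [hAM y, hBM y, hCM y])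
    have hden : (‖D y‖ - M) * (‖D y‖ - M) ≤ ‖C y * x + D y‖ * ‖C y * x' + D y‖ := by
      gcongr <;> linarith
    have hpos : 0 < (‖D y‖ - M) * (‖D y‖ - M) := mul_pos (by linarith) (by linarith)
    rw [e, norm_div, norm_mul, norm_mul, div_le_iff₀ (hpos.trans_le hden)]
    calc ‖A y * D y - B y * C y‖ * ‖x - x'‖ ≤ (M * ‖D y‖ + M * M) * ‖x - x'‖ := by gcongr
      _ ≤ (1 / 2 * ((‖D y‖ - M) * (‖D y‖ - M))) * ‖x - x'‖ := by
          gcongr; nlinarith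
      _ ≤ (1 / 2 * (‖C y * x + D y‖ * ‖C y * x' + D y‖)) * ‖x - x'‖ := by gcongr
      _ = 1 / 2 * ‖x - x'‖ * (‖C y * x + D y‖ * ‖C y * x' + D y‖) := by ring
  obtain ⟨m, hm, hm1, h⟩ := exists_invariant_section (τ := τ)
    (fun y x => (A y * x + B y) / (C y * x + D y))
    zero_le_one (c := 1 / 2) (by norm_num) (by norm_num)
    (fun m hm hm1 => ((hA.mul (hm.comp hτ)).add hB).div ((hC.mul (hm.comp hτ)).add hD)
      fun y => hne y _ (hm1 _)) hmaps hlip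
  refine ⟨m, hm, hm1, fun y => ?_⟩
  conv_lhs => rw [h y]
  exact div_mul_cancel₀ _ (hne y _ (hm1 _))

end Blender

namespace Blender

open Set Filter Topology

/-! ### Derivatives of holomorphic maps of two variables -/

/-- One-variable Cauchy estimate on the complex line through x in each unit direction. -/
lemma norm_fderiv_le_of_forall_norm_le {h : ℂ × ℂ → ℂ × ℂ} {x : ℂ × ℂ} {r R M : ℝ} (hr : 0 < r)
    (hrR : r < R) (hd : DifferentiableOn ℂ h (Metric.ball x R))
    (hM : ∀ y ∈ Metric.ball x R, ‖h y‖ ≤ M) : ‖fderiv ℂ h x‖ ≤ M / r := by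
  have hR : 0 < R := hr.trans hrR
  have hx : DifferentiableAt ℂ h x := hd.differentiableAt (Metric.ball_mem_nhds x hR)
  have hM0 : 0 ≤ M := (norm_nonneg _).trans (hM x (Metric.mem_ball_self hR))
  have unit : ∀ u : ℂ × ℂ, ‖u‖ = 1 → ‖fderiv ℂ h x u‖ ≤ M / r := by
    intro u hu
    have hmem : ∀ t ∈ Metric.closedBall (0 : ℂ) r, x + t • u ∈ Metric.ball x R := by
      intro t ht
      rw [mem_closedBall_zero_iff] at ht
      rw [mem_ball_iff_norm, add_sub_cancel_left, norm_smul, hu, mul_one]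
      linarith
    have hline : Differentiable ℂ fun t : ℂ => x + t • u := by fun_prop
    have hφ : DifferentiableOn ℂ (fun t : ℂ => h (x + t • u)) (Metric.closedBall 0 r) :=
      hd.comp hline.differentiableOn hmem
    have hder : deriv (fun t : ℂ => h (x + t • u)) 0 = fderiv ℂ h x u := by
      have h1 : HasDerivAt (fun t : ℂ => x + t • u) u 0 := by
        simpa using ((hasDerivAt_id (0 : ℂ)).smul_const u).const_add x
      have h2 : HasFDerivAt h (fderiv ℂ h x) (x + (0 : ℂ) • u) := by simpa using hx.hasFDerivAt
      exact (h2.comp_hasDerivAt 0 h1).deriv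
    rw [← hder]
    refine Complex.norm_deriv_le_of_forall_mem_sphere_norm_le hr ?_ fun t ht =>
      hM _ (hmem t (Metric.sphere_subset_closedBall ht))
    refine DifferentiableOn.diffContOnCl ?_
    rwa [closure_ball _ hr.ne']
  refine ContinuousLinearMap.opNorm_le_bound _ (by positivity) fun v => ?_
  rcases eq_or_ne v 0 with rfl | hv
  · simp
  have hv0 : ‖v‖ ≠ 0 := norm_ne_zero_iff.2 hv
  have hu : ‖((‖v‖ : ℂ)⁻¹) • v‖ = 1 := by
    rw [norm_smul, norm_inv, Complex.norm_real, norm_norm, inv_mul_cancel₀ hv0]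
  have := unit _ hu
  rw [map_smul, norm_smul, norm_inv, Complex.norm_real, norm_norm] at this
  calc ‖fderiv ℂ h x v‖ = ‖v‖⁻¹ * ‖fderiv ℂ h x v‖ * ‖v‖ := by field_simp
    _ ≤ M / r * ‖v‖ := by gcongr

/-- The Cauchy estimate is applied to g(· + h) - g, which is uniformly small for small h by uniform
continuity; its derivative at x is the difference of the derivatives at x + h and at x. -/
lemma continuousOn_fderiv {g : ℂ × ℂ → ℂ × ℂ} {N : Set (ℂ × ℂ)} (hN : IsOpen N)
    (hg : DifferentiableOn ℂ g N) : ContinuousOn (fderiv ℂ g) N := by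
  intro x hx
  obtain ⟨ρ, hρ, hball⟩ := Metric.isOpen_iff.1 hN x hx
  set r := ρ / 4 with hr
  have hr0 : 0 < r := by positivity
  have hsub : Metric.closedBall x (3 * r) ⊆ N := (Metric.closedBall_subset_ball (by linarith)).trans hball
  have hunif : UniformContinuousOn g (Metric.closedBall x (3 * r)) :=
    (isCompact_closedBall x (3 * r)).uniformContinuousOn_of_continuous (hg.continuousOn.mono hsub)
  refine ContinuousAt.continuousWithinAt (Metric.continuousAt_iff.2 fun ε hε => ?_)
  obtain ⟨δ, hδ, h⟩ := Metric.uniformContinuousOn_iff.1 hunif (ε / 2 * r) (by positivity)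
  refine ⟨min δ r, by positivity, fun {y} hy => ?_⟩
  have hyδ : dist y x < δ := hy.trans_le (min_le_left _ _)
  have hyr : dist y x < r := hy.trans_le (min_le_right _ _)
  have hm1 : ∀ p ∈ Metric.ball x (2 * r), p ∈ Metric.closedBall x (3 * r) := fun p hp =>
    Metric.ball_subset_closedBall (Metric.ball_subset_ball (by linarith) hp)
  have hm2 : ∀ p ∈ Metric.ball x (2 * r), p + (y - x) ∈ Metric.closedBall x (3 * r) := by
    intro p hp
    rw [mem_ball_iff_norm] at hp
    rw [dist_eq_norm] at hyr
    rw [mem_closedBall_iff_norm, add_sub_right_comm]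
    exact (norm_add_le _ _).trans (by linarith)
  have hd1 : ∀ p ∈ Metric.closedBall x (3 * r), DifferentiableAt ℂ g p := fun p hp =>
    hg.differentiableAt (hN.mem_nhds (hsub hp))
  have hshift : ∀ p : ℂ × ℂ, DifferentiableAt ℂ (fun p => p + (y - x)) p := fun p => by fun_prop
  have key := norm_fderiv_le_of_forall_norm_le (h := fun p => g (p + (y - x)) - g p) (x := x)
    (M := ε / 2 * r) hr0 (by linarith : r < 2 * r)
    (fun p hp => (((hd1 _ (hm2 p hp)).comp p (hshift p)).sub
      (hd1 _ (hm1 p hp))).differentiableWithinAt)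
    (fun p hp => by
      rw [← dist_eq_norm]
      refine (h _ (hm2 p hp) _ (hm1 p hp) ?_).le
      rwa [dist_eq_norm, add_sub_cancel_left, ← dist_eq_norm])
  have hx2 : x ∈ Metric.ball x (2 * r) := Metric.mem_ball_self (by positivity)
  have e : fderiv ℂ (fun p => g (p + (y - x)) - g p) x = fderiv ℂ g y - fderiv ℂ g x := by
    have h2 := ((hd1 _ (hm2 x hx2)).hasFDerivAt.comp x
      ((hasFDerivAt_id (𝕜 := ℂ) x).add_const (y - x))).sub (hd1 _ (hm1 x hx2)).hasFDerivAt
    rw [ContinuousLinearMap.comp_id, add_sub_cancel] at h2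
    exact h2.fderiv
  rw [e, mul_div_assoc, div_self hr0.ne', mul_one] at key
  rw [dist_eq_norm]
  linarith

/-! ### Hyperbolicity from one-step estimates -/

section Hyperbolic

variable {g : ℂ × ℂ → ℂ × ℂ} {L : Set (ℂ × ℂ)}

lemma differentiableAt_iterate (hL : g '' L ⊆ L) (hd : ∀ x ∈ L, DifferentiableAt ℂ g x) (n : ℕ)
    {x : ℂ × ℂ} (hx : x ∈ L) : DifferentiableAt ℂ g^[n] x := by
  induction n generalizing x with
  | zero => exact differentiableAt_id
  | succ n ih =>
    rw [Function.iterate_succ]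
    exact (ih (hL ⟨x, hx, rfl⟩)).comp x (hd x hx)

lemma fderiv_iterate_succ (hL : g '' L ⊆ L) (hd : ∀ x ∈ L, DifferentiableAt ℂ g x) (n : ℕ)
    {x : ℂ × ℂ} (hx : x ∈ L) (v : ℂ × ℂ) :
    fderiv ℂ g^[n + 1] x v = fderiv ℂ g^[n] (g x) (fderiv ℂ g x v) := by
  rw [Function.iterate_succ, fderiv_comp x (differentiableAt_iterate hL hd n (hL ⟨x, hx, rfl⟩))
    (hd x hx)]
  rfl

/-- The intertwining relation carries the kernel and the range of P along the orbit, so one-step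
estimates in the adapted norm ν multiply. Comparing ν with the ambient norm costs the constant 2. -/
lemma isHyperbolicSet_of_step {u : ℕ} (hc : IsCompact L) (hL : g '' L = L)
    (hd : ∀ x ∈ L, ∀ᶠ y in 𝓝 x, DifferentiableAt ℂ g y)
    (P : (ℕ → ℂ × ℂ) → (ℂ × ℂ →L[ℂ] ℂ × ℂ)) (hP : ContinuousOn P (natExt g L))
    (hP2 : ∀ x ∈ natExt g L, (P x).comp (P x) = P x)
    (hrank : ∀ x ∈ natExt g L,
      Module.finrank ℂ (LinearMap.range (P x : ℂ × ℂ →ₗ[ℂ] ℂ × ℂ)) = u)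
    (hinv : ∀ x ∈ natExt g L, ∀ v,
      fderiv ℂ g (x 0) (P x v) = P (hatMap g x) (fderiv ℂ g (x 0) v))
    (ν : ℂ × ℂ → ℝ) (hν1 : ∀ v, ‖v‖ ≤ ν v) (hν2 : ∀ v, ν v ≤ 2 * ‖v‖)
    {lam : ℝ} (h0 : 0 < lam) (h1 : lam < 1)
    (hs : ∀ x ∈ natExt g L, ∀ v, P x v = 0 → ν (fderiv ℂ g (x 0) v) ≤ lam * ν v)
    (hu : ∀ x ∈ natExt g L, ∀ v, P x v = v → ν v ≤ lam * ν (fderiv ℂ g (x 0) v)) :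
    IsHyperbolicSet g L u := by
  refine ⟨hc, hL, hd, P, hP, fun x hx => ⟨hP2 x hx, hrank x hx,
    ContinuousLinearMap.ext (hinv x hx)⟩, 2, lam, two_pos, h0, h1, ?_⟩
  have hd' : ∀ x ∈ L, DifferentiableAt ℂ g x := fun x hx => (hd x hx).self_of_nhds
  have key : ∀ n : ℕ, ∀ x ∈ natExt g L, ∀ v,
      (P x v = 0 → ν (fderiv ℂ g^[n] (x 0) v) ≤ lam ^ n * ν v) ∧
      (P x v = v → ν v ≤ lam ^ n * ν (fderiv ℂ g^[n] (x 0) v)) := by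
    intro n
    induction n with
    | zero => intro x hx v; simp
    | succ n ih =>
      intro x hx v
      have hx' := hatMap_mem_natExt hL.subset hx
      have hcomm := hinv x hx v
      rw [fderiv_iterate_succ hL.subset hd' n (hx 0).1]
      obtain ⟨i1, i2⟩ := ih _ hx' (fderiv ℂ g (x 0) v)
      constructor
      · intro hv
        rw [hv, map_zero] at hcomm
        refine (i1 hcomm.symm).trans ?_
        rw [pow_succ, mul_assoc]
        exact mul_le_mul_of_nonneg_left (hs x hx v hv) (by positivity)
      · intro hv
        rw [hv] at hcomm
        refine (hu x hx v hv).trans ?_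
        rw [pow_succ', mul_assoc]
        exact mul_le_mul_of_nonneg_left (i2 hcomm.symm) h0.le
  intro x hx n v
  obtain ⟨k1, k2⟩ := key n x hx v
  have hpow : 0 < lam ^ n := by positivity
  constructor
  · intro hv
    calc ‖fderiv ℂ g^[n] (x 0) v‖ ≤ lam ^ n * ν v := (hν1 _).trans (k1 hv)
      _ ≤ lam ^ n * (2 * ‖v‖) := by gcongr; exact hν2 v
      _ = 2 * lam ^ n * ‖v‖ := by ring
  · intro hv
    calc ‖v‖ ≤ lam ^ n * ν (fderiv ℂ g^[n] (x 0) v) := (hν1 _).trans (k2 hv)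
      _ ≤ lam ^ n * (2 * ‖fderiv ℂ g^[n] (x 0) v‖) := by gcongr; exact hν2 _
      _ = 2 * lam ^ n * ‖fderiv ℂ g^[n] (x 0) v‖ := by ring

/-- Repelling sets of skew products with derivatives `(a, b; 0, d)`. -/
lemma isHyperbolicSet_two (hc : IsCompact L) (hL : g '' L = L)
    (hd : ∀ x ∈ L, ∀ᶠ y in 𝓝 x, DifferentiableAt ℂ g y)
    (hD : ∀ x ∈ L, ∃ a b d : ℂ, 201 / 200 ≤ ‖a‖ ∧ ‖b‖ ≤ 2 ∧ 10 ≤ ‖d‖ ∧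
      ∀ v, fderiv ℂ g x v = (a * v.1 + b * v.2, d * v.2)) : IsHyperbolicSet g L 2 := by
  refine isHyperbolicSet_of_step hc hL hd (fun _ => ContinuousLinearMap.id ℂ _)
    continuousOn_const (fun _ _ => rfl) (fun _ _ => ?_) (fun _ _ _ => rfl)
    -- In the sum norm the shear term, of size at most 2|v₂|, is paid for by the expansion 10|v₂| of
    -- the second coordinate; the maximum norm would not give expansion in one step.
    (fun v => ‖v.1‖ + ‖v.2‖) (fun v => ?_) (fun v => ?_) (lam := 200 / 201) (by norm_num)
    (by norm_num) (fun x hx v hv => ?_) (fun x hx v _ => ?_)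
  · rw [show ((ContinuousLinearMap.id ℂ (ℂ × ℂ) : ℂ × ℂ →L[ℂ] ℂ × ℂ) : ℂ × ℂ →ₗ[ℂ] ℂ × ℂ)
      = LinearMap.id from rfl, LinearMap.range_id, finrank_top]
    simp
  · rw [Prod.norm_def]
    exact max_le (by linarith [norm_nonneg v.2]) (by linarith [norm_nonneg v.1])
  · linarith [norm_fst_le v, norm_snd_le v]
  · rw [ContinuousLinearMap.id_apply] at hv
    simp [hv]
  · obtain ⟨a, b, d, ha, hb, hdn, h⟩ := hD _ (hx 0).1
    have e1 : ‖a * v.1‖ ≤ ‖a * v.1 + b * v.2‖ + ‖b * v.2‖ := by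
      have := norm_sub_le (a * v.1 + b * v.2) (b * v.2)
      rwa [add_sub_cancel_right] at this
    rw [h]
    simp only [norm_mul] at e1 ⊢
    have e2 := mul_le_mul_of_nonneg_right ha (norm_nonneg v.1)
    have e3 := mul_le_mul_of_nonneg_right hb (norm_nonneg v.2)
    have e4 := mul_le_mul_of_nonneg_right hdn (norm_nonneg v.2)
    have := norm_nonneg v.2
    linarith

/-- Saddle sets of maps whose derivatives contract the first direction and strongly expand the
second one. -/
lemma isHyperbolicSet_one (hc : IsCompact L) (hL : g '' L = L)
    (hd : ∀ x ∈ L, ∀ᶠ y in 𝓝 x, DifferentiableAt ℂ g y) (hcont : ContinuousOn (fderiv ℂ g) L)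
    (hD : ∀ x ∈ L, ‖(fderiv ℂ g x (1, 0)).1‖ ≤ 199 / 200 ∧ ‖(fderiv ℂ g x (1, 0)).2‖ ≤ 2 ∧
      ‖(fderiv ℂ g x (0, 1)).1‖ ≤ 2 ∧ 10 ^ 6 ≤ ‖(fderiv ℂ g x (0, 1)).2‖) :
    IsHyperbolicSet g L 1 := by
  classical
  set Y := natExt g L with hY
  have hgL : ContinuousOn g L := fun x hx =>
    ((hd x hx).self_of_nhds.continuousAt).continuousWithinAt
  let τ : Y → Y := fun y => ⟨hatMap g y.1, hatMap_mem_natExt hL.subset y.2⟩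
  let κ : Y → Y := fun y => ⟨hatShift 1 y.1, hatShift_mem_natExt 1 y.2⟩
  have hcoord : ∀ k, Continuous fun y : Y => y.1 k := fun k =>
    (continuous_apply k).comp continuous_subtype_val
  have hτ : Continuous τ := by
    refine Continuous.subtype_mk (continuous_pi fun k => ?_) _
    exact hgL.comp_continuous (hcoord k) fun y => (y.2 k).1
  have hκ : Continuous κ :=
    Continuous.subtype_mk (continuous_pi fun k => hcoord (k + 1)) _
  have hτκ : ∀ y, τ (κ y) = y := fun y => Subtype.ext (hatMap_hatShift y.2)
  have hκτ : ∀ y, κ (τ y) = y := fun y => Subtype.ext (hatShift_hatMap y.2)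
  have hfd : Continuous fun y : Y => fderiv ℂ g (y.1 0) :=
    hcont.comp_continuous (hcoord 0) fun y => (y.2 0).1
  let a : Y → ℂ := fun y => (fderiv ℂ g (y.1 0) (1, 0)).1
  let c : Y → ℂ := fun y => (fderiv ℂ g (y.1 0) (1, 0)).2
  let b : Y → ℂ := fun y => (fderiv ℂ g (y.1 0) (0, 1)).1
  let d : Y → ℂ := fun y => (fderiv ℂ g (y.1 0) (0, 1)).2
  have ha : Continuous a := (hfd.clm_apply continuous_const).fst
  have hc' : Continuous c := (hfd.clm_apply continuous_const).snd
  have hb : Continuous b := (hfd.clm_apply continuous_const).fst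
  have hd' : Continuous d := (hfd.clm_apply continuous_const).snd
  have hder : ∀ (y : Y) (v : ℂ × ℂ), fderiv ℂ g (y.1 0) v
      = (a y * v.1 + b y * v.2, c y * v.1 + d y * v.2) := by
    intro y v
    have e : v = v.1 • ((1, 0) : ℂ × ℂ) + v.2 • ((0, 1) : ℂ × ℂ) := by
      ext <;> simp
    conv_lhs => rw [e, map_add, map_smul, map_smul]
    ext <;> simp [a, b, c, d, mul_comm]
  have hba : ∀ y, ‖a y‖ ≤ 199 / 200 := fun y => (hD _ (y.2 0).1).1
  have hbc : ∀ y, ‖c y‖ ≤ 2 := fun y => (hD _ (y.2 0).1).2.1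
  have hbb : ∀ y, ‖b y‖ ≤ 2 := fun y => (hD _ (y.2 0).1).2.2.1
  have hbd : ∀ y, 10 ^ 6 ≤ ‖d y‖ := fun y => (hD _ (y.2 0).1).2.2.2
  -- The unstable line is spanned by (m, 1). It is pushed forward from the past, so the slope
  -- equation is solved along the backward shift.
  obtain ⟨m, hm, hm1, hmeq⟩ := exists_slope_section hκ (ha.comp hκ) (hb.comp hκ) (hc'.comp hκ)
    (hd'.comp hκ) (M := 2) two_pos (fun y => (hba _).trans (by norm_num)) (fun y => hbb _)
    (fun y => hbc _) (fun y => le_trans (by norm_num) (hbd _))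
  -- The stable line is spanned by (1, n). It is pulled back from the future, so the equation runs
  -- along the forward shift, with the off-diagonal entries exchanged and negated.
  obtain ⟨n, hn, hn1, hneq⟩ := exists_slope_section hτ ha hc'.neg hb.neg hd' (M := 2) two_pos
    (fun y => (hba _).trans (by norm_num)) (fun y => by rw [Pi.neg_apply, norm_neg]; exact hbc y)
    (fun y => by rw [Pi.neg_apply, norm_neg]; exact hbb y)
    (fun y => le_trans (by norm_num) (hbd _))
  simp only [Pi.neg_apply] at hneq
  have hmτ : ∀ y, m (τ y) * (c y * m y + d y) = a y * m y + b y := by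
    intro y
    have := hmeq (τ y)
    simpa only [Function.comp_apply, hκτ] using this
  -- The a priori bound 1 on n is bootstrapped through its equation, where |d| ≥ 10^6. The gain
  -- makes the two lines transverse and keeps the contraction below 999/1000.
  have hnsmall : ∀ y, ‖n y‖ ≤ 1 / 10 ^ 5 := by
    intro y
    have h1 : ‖a y * n (τ y) + -c y‖ ≤ 1 * 1 + 2 := by
      refine (norm_add_le _ _).trans ?_
      rw [norm_mul, norm_neg]
      gcongr
      · exact (hba y).trans (by norm_num)
      · exact hn1 _
      · exact hbc y
    have h2 : ‖d y‖ - 2 ≤ ‖-b y * n (τ y) + d y‖ := by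
      have e1 : ‖-b y * n (τ y)‖ ≤ 2 * 1 := by
        rw [norm_mul, norm_neg]; gcongr; exacts [hbb y, hn1 _]
      have e2 := norm_sub_le (-b y * n (τ y) + d y) (-b y * n (τ y))
      rw [add_sub_cancel_left] at e2
      linarith
    rw [← hneq y, norm_mul] at h1
    have h3 := hbd y
    have h4 := norm_nonneg (n y)
    nlinarith
  have hw : ∀ y, 1 - n y * m y ≠ 0 := by
    intro y h0
    have h1 : n y * m y = 1 := (sub_eq_zero.1 h0).symm
    have h2 : ‖n y * m y‖ ≤ 1 / 10 ^ 5 * 1 := by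
      rw [norm_mul]; gcongr; exacts [hnsmall y, hm1 y]
    rw [h1] at h2
    norm_num at h2
  let t : Y → ℂ × ℂ → ℂ := fun y v => (1 - n y * m y)⁻¹ * (v.2 - n y * v.1)
  -- Projection onto the line of (m, 1) along the line of (1, n).
  let P' : Y → (ℂ × ℂ →L[ℂ] ℂ × ℂ) := fun y =>
    (((1 - n y * m y)⁻¹ • (ContinuousLinearMap.snd ℂ ℂ ℂ - n y • ContinuousLinearMap.fst ℂ ℂ ℂ) :
      ℂ × ℂ →L[ℂ] ℂ)).smulRight ((m y, 1) : ℂ × ℂ)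
  have hP' : ∀ y v, P' y v = (t y v * m y, t y v) := by
    intro y v
    ext <;> simp [P', t]
  have ht : ∀ y s, t y (s * m y, s) = s := by
    intro y s
    have := hw y
    simp only [t]
    field_simp
  have hstable : ∀ y v, P' y v = 0 → v.2 = n y * v.1 := by
    intro y v hv
    rw [hP'] at hv
    have h2 : t y v = 0 := congrArg Prod.snd hv
    rcases mul_eq_zero.1 h2 with h | h
    · exact absurd (inv_eq_zero.1 h) (hw y)
    · exact sub_eq_zero.1 h
  have hunstable : ∀ y v, P' y v = v → v.1 = m y * v.2 := by
    intro y v hv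
    rw [hP'] at hv
    have h2 : t y v = v.2 := congrArg Prod.snd hv
    have h1 : t y v * m y = v.1 := congrArg Prod.fst hv
    rw [← h1, h2, mul_comm]
  let P : (ℕ → ℂ × ℂ) → (ℂ × ℂ →L[ℂ] ℂ × ℂ) := fun x => if h : x ∈ Y then P' ⟨x, h⟩ else 0
  have hP : ∀ y : Y, P y.1 = P' y := fun y => dif_pos y.2
  refine isHyperbolicSet_of_step hc hL hd P ?_ (fun x hx => ?_) (fun x hx => ?_)
    (fun x hx v => ?_) (fun v => ‖v‖) (fun v => le_rfl) (fun v => by linarith [norm_nonneg v])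
    (lam := 999 / 1000) (by norm_num) (by norm_num) (fun x hx v hv => ?_) (fun x hx v hv => ?_)
  · rw [continuousOn_iff_continuous_domRestrict]
    have e : Y.domRestrict P = P' := funext hP
    rw [← hY, e, continuous_clm_apply]
    intro v
    simp only [hP', t]
    have : Continuous fun y => (1 - n y * m y)⁻¹ :=
      (continuous_const.sub (hn.mul hm)).inv₀ hw
    fun_prop
  · have := hP ⟨x, hx⟩
    simp only at this
    rw [this]
    refine ContinuousLinearMap.ext fun v => ?_
    rw [ContinuousLinearMap.comp_apply, hP', hP', ht]
  · have := hP ⟨x, hx⟩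
    simp only at this
    rw [this]
    have hr : LinearMap.range (P' ⟨x, hx⟩ : ℂ × ℂ →ₗ[ℂ] ℂ × ℂ)
        = Submodule.span ℂ {((m ⟨x, hx⟩, 1) : ℂ × ℂ)} := by
      ext w
      rw [LinearMap.mem_range, Submodule.mem_span_singleton]
      constructor
      · rintro ⟨v, rfl⟩
        refine ⟨t ⟨x, hx⟩ v, ?_⟩
        rw [ContinuousLinearMap.coe_coe, hP']
        simp
      · rintro ⟨s, rfl⟩
        refine ⟨(s * m ⟨x, hx⟩, s), ?_⟩
        rw [ContinuousLinearMap.coe_coe, hP', ht]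
        simp
    rw [hr]
    exact finrank_span_singleton (by simp)
  · have e1 := hP ⟨x, hx⟩
    have e2 : P (hatMap g x) = P' (τ ⟨x, hx⟩) := hP (τ ⟨x, hx⟩)
    rw [show P x = _ from e1, e2, hP', hP']
    set y : Y := ⟨x, hx⟩
    change fderiv ℂ g (y.1 0) _ = (t (τ y) _ * m (τ y), t (τ y) _)
    have hmy := hmτ y
    have hny := hneq y
    have w1 := hw y
    have w2 := hw (τ y)
    have key : t (τ y) (fderiv ℂ g (y.1 0) v) = t y v * (c y * m y + d y) := by
      rw [hder]
      simp only [t]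
      field_simp
      linear_combination (n (τ y) * (v.2 - n y * v.1)) * hmy + (v.1 - m y * v.2) * hny
    rw [key, hder]
    ext
    · linear_combination (-t y v) * hmy
    · simp only; ring
  · have e1 : P x = _ := hP ⟨x, hx⟩
    rw [e1] at hv
    set y : Y := ⟨x, hx⟩
    have hv2 := hstable y v hv
    have hw2 : c y * v.1 + d y * v.2 = n (τ y) * (a y * v.1 + b y * v.2) := by
      rw [hv2]
      linear_combination v.1 * hneq y
    have hle : ‖fderiv ℂ g (x 0) v‖ ≤ ‖a y * v.1 + b y * v.2‖ := by
      rw [show fderiv ℂ g (x 0) v = _ from hder y v, hw2, Prod.norm_def, norm_mul]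
      exact max_le le_rfl (mul_le_of_le_one_left (norm_nonneg _) (hn1 _))
    have h1 : ‖a y * v.1 + b y * v.2‖ ≤ 199 / 200 * ‖v.1‖ + 2 * (1 / 10 ^ 5 * ‖v.1‖) := by
      refine (norm_add_le _ _).trans ?_
      rw [hv2, norm_mul, norm_mul, norm_mul]
      gcongr
      exacts [hba y, hbb y, hnsmall y]
    have h2 := norm_fst_le v
    have h3 := norm_nonneg v.1
    linarith
  · have e1 : P x = _ := hP ⟨x, hx⟩
    rw [e1] at hv
    set y : Y := ⟨x, hx⟩
    have hv1 := hunstable y v hv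
    have h1 : ‖v.1‖ ≤ ‖v.2‖ := by
      rw [hv1, norm_mul]
      exact mul_le_of_le_one_left (norm_nonneg _) (hm1 _)
    have h2 : ‖v‖ ≤ ‖v.2‖ := max_le h1 le_rfl
    have h3 : ‖d y * v.2‖ ≤ ‖c y * v.1 + d y * v.2‖ + ‖c y * v.1‖ := by
      have := norm_sub_le (c y * v.1 + d y * v.2) (c y * v.1)
      rwa [add_sub_cancel_left] at this
    have h4 : ‖c y * v.1 + d y * v.2‖ ≤ ‖fderiv ℂ g (x 0) v‖ := by
      rw [show fderiv ℂ g (x 0) v = _ from hder y v]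
      exact norm_snd_le (a y * v.1 + b y * v.2, c y * v.1 + d y * v.2)
    rw [norm_mul, norm_mul] at h3
    have h5 := mul_le_mul_of_nonneg_right (hbd y) (norm_nonneg v.2)
    have h6 := mul_le_mul_of_nonneg_right (hbc y) (norm_nonneg v.1)
    have h7 := norm_nonneg v.2
    linarith

end Hyperbolic

end Blender

namespace Blender

open Set Filter Topology Uniformity

/-! ### The full shift on three symbols -/

/-- Bi-infinite sequences of three symbols. -/
abbrev Code : Type := ℤ → Fin 3

/-- The shift by `n` places. -/
def shiftBy (n : ℤ) (s : Code) : Code := fun k => s (k + n)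

lemma shiftBy_apply (n : ℤ) (s : Code) (k : ℤ) : shiftBy n s k = s (k + n) := rfl

lemma continuous_shiftBy (n : ℤ) : Continuous (shiftBy n) :=
  continuous_pi fun _ => continuous_apply _

lemma shiftBy_add (m n : ℤ) (s : Code) : shiftBy m (shiftBy n s) = shiftBy (m + n) s :=
  funext fun k => by simp only [shiftBy_apply, add_assoc]

lemma shiftBy_zero (s : Code) : shiftBy 0 s = s := funext fun k => by rw [shiftBy_apply, add_zero]

lemma shiftBy_iterate (n : ℕ) (s : Code) : (shiftBy 1)^[n] s = shiftBy n s := by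
  induction n with
  | zero => exact (shiftBy_zero s).symm
  | succ n ih => rw [Function.iterate_succ_apply', ih, shiftBy_add]; congr 1; push_cast; ring

/-- Open sets constrain finitely many symbols, so the left part of u can be joined to a translate of
v. A delay of 2N + 1 keeps the two windows of radius N disjoint. -/
lemma exists_shift_mem {U V : Set Code} (hU : IsOpen U) (hV : IsOpen V) (hU' : U.Nonempty)
    (hV' : V.Nonempty) : ∃ n₀ : ℕ, ∀ n ≥ n₀, ∃ s ∈ U, (shiftBy 1)^[n] s ∈ V := by
  obtain ⟨u, hu⟩ := hU'
  obtain ⟨v, hv⟩ := hV'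
  obtain ⟨I, A, hA, hI⟩ := isOpen_pi_iff.1 hU u hu
  obtain ⟨J, B, hB, hJ⟩ := isOpen_pi_iff.1 hV v hv
  obtain ⟨N, hN⟩ : ∃ N : ℕ, ∀ i ∈ I ∪ J, i.natAbs ≤ N :=
    ⟨(I ∪ J).sup Int.natAbs, fun i hi => Finset.le_sup (f := Int.natAbs) hi⟩
  refine ⟨2 * N + 1, fun n hn => ⟨fun k => if k ≤ N then u k else v (k - n), hI fun i hi => ?_, ?_⟩⟩
  · have := hN i (Finset.mem_union_left _ hi)
    rw [if_pos (by omega)]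
    exact (hA i hi).2
  · rw [shiftBy_iterate]
    refine hJ fun j hj => ?_
    have := hN j (Finset.mem_union_right _ hj)
    rw [shiftBy_apply, if_neg (by omega), add_sub_cancel_right]
    exact (hB j hj).2

lemma log_three : ENNReal.log 3 = ((Real.log 3 : ℝ) : EReal) := by
  have := ENNReal.log_ofReal 3
  rw [if_neg (by norm_num)] at this
  rw [← this]
  congr 1
  norm_num

/-- Extend a word to a bi-infinite sequence. -/
def extendWord (m N : ℕ) (c : Fin N → Fin 3) : Code := fun k =>
  if h : (k + m).toNat < N then c ⟨(k + m).toNat, h⟩ else 0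

lemma extendWord_apply {m N : ℕ} (c : Fin N → Fin 3) {k : ℤ} (i : Fin N) (h : k + m = i) :
    extendWord m N c k = c i := by
  have e : (k + m).toNat = i := by omega
  unfold extendWord
  rw [dif_pos (by omega)]
  congr 1
  exact Fin.ext e

/-- Through a window of radius m, the first n iterates only show coordinates from -m to n + m - 1,
so finite words provide a dynamical cover. The factor 3^(2m+1) does not affect the growth rate. -/
lemma coverMincard_shift_le (U : Set (Code × Code)) (m : ℕ)
    (hU : ∀ s t : Code, (∀ k : ℤ, k.natAbs ≤ m → s k = t k) → (s, t) ∈ U) (n : ℕ) :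
    Dynamics.coverMincard (shiftBy 1) univ U n ≤ ((3 ^ (n + 2 * m + 1) : ℕ) : ℕ∞) := by
  classical
  set N := n + 2 * m + 1 with hN
  have hcov : Dynamics.IsDynCoverOf (shiftBy 1) univ U n
      ((Finset.univ.image (extendWord m N) : Finset Code) : Set Code) := by
    intro s _
    refine ⟨extendWord m N fun i => s ((i : ℕ) - m), by simp, ?_⟩
    rw [Dynamics.mem_dynEntourage]
    intro j hj
    rw [shiftBy_iterate, shiftBy_iterate]
    refine hU _ _ fun k hk => ?_
    rw [shiftBy_apply, shiftBy_apply,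
      extendWord_apply _ ⟨(k + j + m).toNat, by omega⟩ (by simp only; omega)]
    congr 1
    simp only
    omega
  refine hcov.coverMincard_le_card.trans ?_
  have : (Finset.univ.image (extendWord m N)).card ≤ 3 ^ N :=
    Finset.card_image_le.trans (by simp)
  exact_mod_cast this

/-- Two different words of length n disagree at the zeroth coordinate at some time before n.
Agreement at a coordinate is transitive, so the dynamical balls are disjoint. -/
lemma le_netMaxcard_shift (n : ℕ) : ((3 ^ n : ℕ) : ℕ∞) ≤
    Dynamics.netMaxcard (shiftBy 1) univ {p : Code × Code | p.1 0 = p.2 0} n := by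
  classical
  have hinj : Function.Injective (extendWord 0 n) := by
    intro c c' h
    funext i
    have := congrFun h (i : ℕ)
    rwa [extendWord_apply c i (by simp), extendWord_apply c' i (by simp)] at this
  have hnet : Dynamics.IsDynNetIn (shiftBy 1) univ {p : Code × Code | p.1 0 = p.2 0} n
      ((Finset.univ.image (extendWord 0 n) : Finset Code) : Set Code) := by
    refine ⟨subset_univ _, ?_⟩
    intro s hs t ht hst
    rw [Function.onFun, Set.disjoint_left]
    intro y hy hy'
    rw [Dynamics.mem_ball_dynEntourage] at hy hy'
    obtain ⟨c, -, rfl⟩ := Finset.mem_image.1 hs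
    obtain ⟨c', -, rfl⟩ := Finset.mem_image.1 ht
    refine hst (congrArg _ (funext fun i => ?_))
    have h1 : ((shiftBy 1)^[(i : ℕ)] (extendWord 0 n c)) 0 = ((shiftBy 1)^[(i : ℕ)] y) 0 := hy i i.2
    have h2 : ((shiftBy 1)^[(i : ℕ)] (extendWord 0 n c')) 0 = ((shiftBy 1)^[(i : ℕ)] y) 0 :=
      hy' i i.2
    have h3 := h1.trans h2.symm
    rwa [shiftBy_iterate, shiftBy_iterate, shiftBy_apply, shiftBy_apply,
      extendWord_apply c i (by simp), extendWord_apply c' i (by simp)] at h3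
  have := hnet.card_le_netMaxcard
  rw [Finset.card_image_of_injective _ hinj] at this
  simpa using this

/-- The full shift has entropy `log 3` for any uniform structure inducing its topology. -/
lemma coverEntropy_shift (u : UniformSpace Code)
    (hu : u.toTopologicalSpace = (inferInstance : TopologicalSpace Code)) :
    @Dynamics.coverEntropy Code u (shiftBy 1) univ = ((Real.log 3 : ℝ) : EReal) := by
  let v : UniformSpace (Fin 3) := ⊥
  -- A compact Hausdorff space has only one compatible uniformity, so the product uniformity may be
  -- used. The freedom in u matters because the one needed later is pulled back along the coding.
  obtain rfl : u = Pi.uniformSpace fun _ : ℤ => Fin 3 :=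
    unique_uniformity_of_compact (t := (inferInstance : TopologicalSpace Code)) hu rfl
  have hbasis : (𝓤 Code).HasBasis (fun t : Set ℤ => t.Finite)
      fun t => ⋂ k ∈ t, {p : Code × Code | p.1 k = p.2 k} := by
    have h : 𝓤 Code = ⨅ k : ℤ, 𝓟 {p : Code × Code | p.1 k = p.2 k} := by
      rw [Pi.uniformity]
      refine iInf_congr fun k => ?_
      change comap _ (𝓟 SetRel.id) = _
      rw [comap_principal]
      rfl
    rw [h]
    exact hasBasis_iInf_principal_finite _
  refine le_antisymm ?_ ?_
  · rw [Dynamics.coverEntropy_eq_iSup_basis hbasis]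
    refine iSup₂_le fun t ht => ?_
    obtain ⟨m, hm⟩ : ∃ m : ℕ, ∀ k ∈ t, k.natAbs ≤ m :=
      ⟨ht.toFinset.sup Int.natAbs, fun k hk =>
        Finset.le_sup (f := Int.natAbs) (ht.mem_toFinset.2 hk)⟩
    rw [← log_three, ← ExpGrowth.expGrowthSup_pow]
    refine ExpGrowth.expGrowthSup_le_of_eventually_le (b := (3 ^ (2 * m + 1) : ℕ)) (by simp)
      (Eventually.of_forall fun n => ?_)
    have h := coverMincard_shift_le (⋂ k ∈ t, {p : Code × Code | p.1 k = p.2 k}) m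
      (fun a b hab => mem_iInter₂.2 fun k hk => hab k (hm k hk)) n
    refine (ENat.toENNReal_mono h).trans (le_of_eq ?_)
    push_cast
    ring
  · have hmem : {p : Code × Code | p.1 0 = p.2 0} ∈ 𝓤 Code := by
      have := hbasis.mem_of_mem (finite_singleton (0 : ℤ))
      simpa using this
    refine le_trans ?_ (Dynamics.netEntropyEntourage_le_coverEntropy (shiftBy 1) univ hmem)
    rw [← log_three, ← ExpGrowth.expGrowthSup_pow]
    refine ExpGrowth.expGrowthSup_monotone fun n => ?_
    refine le_trans (le_of_eq ?_) (ENat.toENNReal_mono (le_netMaxcard_shift n))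
    push_cast
    rfl

/-! ### Sets coded by the full shift -/

/-- The pieces `S i` code the complete orbits of `f` in `⋃ i, S i` by the full shift: `Φ s` is the
position at time `0` of the unique orbit with itinerary `s`. -/
structure IsCoding {X : Type*} [TopologicalSpace X] (f : X → X) (S : Fin 3 → Set X)
    (Φ : Code → X) : Prop where
  disj : ∀ i j x, x ∈ S i → x ∈ S j → i = j
  cont : Continuous Φ
  semi : ∀ s, f (Φ s) = Φ (shiftBy 1 s)
  mem : ∀ s, Φ s ∈ S (s 0)
  uniq : ∀ (o : ℤ → X) (s : Code), (∀ n, f (o n) = o (n + 1)) → (∀ n, o n ∈ S (s n)) → o 0 = Φ s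

/-- This is local maximality: histories inside the maximal invariant set are exactly the complete
orbits in S, so the condition on the zeroth entry alone isolates them. -/
lemma natExt_maxInvSet {X : Type*} (f : X → X) (S : Set X) :
    natExt f (maxInvSet f S) = hatInter f {x | x 0 ∈ S} := by
  have key : ∀ z ∈ maxInvSet f S, ∀ n, f^[n] z ∈ S := by
    rintro _ ⟨x, hx, rfl⟩ n
    rw [← iterate_hatMap]
    exact (hx.2 n).1
  ext x
  constructor
  · intro hx
    refine ⟨fun k => ⟨mem_univ _, (hx k).2⟩, fun n => ⟨?_, key _ (hx (0 + n)).1 0⟩⟩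
    change (hatMap f)^[n] x 0 ∈ S
    rw [iterate_hatMap]
    exact key _ (hx 0).1 n
  · intro hx k
    refine ⟨⟨hatShift k x, ⟨fun j => ⟨mem_univ _, ?_⟩, fun n => ⟨?_, ?_⟩⟩, ?_⟩, (hx.1 k).2⟩
    · have := (hx.1 (j + k)).2
      simpa only [hatShift, add_right_comm] using this
    · change (hatMap f)^[n] (hatShift k x) 0 ∈ S
      rw [iterate_hatMap]
      have hit : ∀ j, f^[j] (x j) = x 0 := by
        intro j
        induction j with
        | zero => rfl
        | succ j ih => rw [Function.iterate_succ_apply, (hx.1 j).2, ih]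
      have hit2 : ∀ j k, f^[j] (x (k + j)) = x k := by
        intro j
        induction j with
        | zero => intro k; rfl
        | succ j ih =>
          intro k
          rw [Function.iterate_succ_apply, ← add_assoc, (hx.1 (k + j)).2, ih]
      change f^[n] (x (0 + k)) ∈ S
      rw [zero_add]
      rcases le_total n k with h | h
      · have := hit2 n (k - n)
        rw [Nat.sub_add_cancel h] at this
        rw [this]
        have h2 := (hx.2 (k - n)).2
        change x (0 + (k - n)) ∈ S at h2
        rwa [zero_add] at h2
      · have h2 := (hx.2 (n - k)).1
        change (hatMap f)^[n - k] x 0 ∈ S at h2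
        rw [iterate_hatMap] at h2
        rw [← Nat.sub_add_cancel h, Function.iterate_add_apply, hit]
        exact h2
    · have := (hx.2 (n + k)).2
      change x (0 + (n + k)) ∈ S at this
      change x (0 + n + k) ∈ S
      rwa [add_assoc]
    · change x (0 + k) = x k
      rw [zero_add]

namespace IsCoding

variable {X : Type*} {f : X → X} {S : Fin 3 → Set X} {Φ : Code → X}

/-- The history coded by a bi-infinite sequence. -/
def hist (Φ : Code → X) (s : Code) : ℕ → X := fun k => Φ (shiftBy (-k) s)

section

variable [TopologicalSpace X] (h : IsCoding f S Φ)

include h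

lemma iterate_apply (n : ℕ) (s : Code) : f^[n] (Φ s) = Φ (shiftBy n s) := by
  induction n generalizing s with
  | zero => rw [Nat.cast_zero, shiftBy_zero]; rfl
  | succ n ih =>
    rw [Function.iterate_succ_apply, h.semi, ih, shiftBy_add]
    congr 2

lemma hatInter_eq : hatInter f {x | x 0 ∈ ⋃ i, S i} = range (hist Φ) := by
  ext x
  constructor
  · intro hx
    -- The history is glued to the forward orbit of its last point; `Int.negSucc k` is -(k + 1),
    -- hence the entry `k + 1`.
    let o : ℤ → X := fun n => Int.rec (fun k => f^[k] (x 0)) (fun k => x (k + 1)) n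
    have ho : ∀ n, f (o n) = o (n + 1) := by
      rintro (n | n)
      · exact (Function.iterate_succ_apply' f n (x 0)).symm
      · cases n with
        | zero => exact (hx.1 0).2
        | succ n =>
          have : Int.negSucc (n + 1) + 1 = Int.negSucc n := by omega
          rw [this]
          exact (hx.1 (n + 1)).2
    have hoS : ∀ n, o n ∈ ⋃ i, S i := by
      rintro (n | n)
      · have := (hx.2 n).1
        change (hatMap f)^[n] x 0 ∈ ⋃ i, S i at this
        rwa [iterate_hatMap] at this
      · have := (hx.2 (n + 1)).2
        change x (0 + (n + 1)) ∈ ⋃ i, S i at this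
        rwa [zero_add] at this
    choose s hs using fun n => mem_iUnion.1 (hoS n)
    refine ⟨s, funext fun k => ?_⟩
    have := h.uniq (fun n => o (n + (-k))) (shiftBy (-k) s)
      (fun n => by rw [ho]; congr 1; ring) (fun n => hs _)
    rw [hist, ← this]
    cases k with
    | zero => rfl
    | succ k =>
      have : (0 : ℤ) + -((k + 1 : ℕ) : ℤ) = Int.negSucc k := by omega
      simp only [this]
      rfl
  · rintro ⟨s, rfl⟩
    refine ⟨fun k => ⟨mem_univ _, ?_⟩, fun n => ⟨?_, ?_⟩⟩
    · simp only [hist]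
      rw [h.semi, shiftBy_add]
      congr 2
      push_cast
      ring
    · change (hatMap f)^[n] (hist Φ s) 0 ∈ ⋃ i, S i
      rw [iterate_hatMap, hist, h.iterate_apply]
      exact mem_iUnion.2 ⟨_, h.mem _⟩
    · exact mem_iUnion.2 ⟨_, h.mem _⟩

lemma maxInvSet_eq : maxInvSet f (⋃ i, S i) = range Φ := by
  rw [maxInvSet, h.hatInter_eq, ← range_comp]
  congr 1
  funext s
  exact congrArg Φ (by rw [Nat.cast_zero, neg_zero, shiftBy_zero])

lemma natExt_eq : natExt f (maxInvSet f (⋃ i, S i)) = range (hist Φ) := by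
  rw [natExt_maxInvSet, h.hatInter_eq]

lemma isCompact : IsCompact (maxInvSet f (⋃ i, S i)) := by
  rw [h.maxInvSet_eq]
  exact isCompact_range h.cont

lemma image_eq : f '' maxInvSet f (⋃ i, S i) = maxInvSet f (⋃ i, S i) := by
  rw [h.maxInvSet_eq]
  ext x
  constructor
  · rintro ⟨_, ⟨s, rfl⟩, rfl⟩
    exact ⟨_, (h.semi s).symm⟩
  · rintro ⟨s, rfl⟩
    refine ⟨_, ⟨shiftBy (-1) s, rfl⟩, ?_⟩
    rw [h.semi, shiftBy_add]
    exact congrArg Φ (shiftBy_zero s)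

lemma subset_iUnion : maxInvSet f (⋃ i, S i) ⊆ ⋃ i, S i := by
  rw [h.maxInvSet_eq]
  rintro _ ⟨s, rfl⟩
  exact mem_iUnion.2 ⟨_, h.mem s⟩

lemma continuous_hist : Continuous (hist Φ) :=
  continuous_pi fun _ => h.cont.comp (continuous_shiftBy _)

/-- Past positions are read off the history and future ones follow by iteration; disjointness of the
pieces recovers each symbol from the position. -/
lemma injective_hist : Function.Injective (hist Φ) := by
  intro s t hst
  have key : ∀ k : ℤ, Φ (shiftBy k s) = Φ (shiftBy k t) := by
    intro k
    rcases le_total k 0 with hk | hk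
    · have := congrFun hst k.natAbs
      simp only [hist] at this
      rwa [show -(k.natAbs : ℤ) = k by omega] at this
    · have := congrFun hst 0
      simp only [hist, Nat.cast_zero, neg_zero, shiftBy_zero] at this
      have e : ((k.natAbs : ℕ) : ℤ) = k := by omega
      rw [← e, ← h.iterate_apply, ← h.iterate_apply, this]
  funext k
  refine h.disj _ _ (Φ (shiftBy k s)) ?_ ?_
  · simpa [shiftBy_apply] using h.mem (shiftBy k s)
  · rw [key]
    simpa [shiftBy_apply] using h.mem (shiftBy k t)

lemma semiconj_hist : Function.Semiconj (hist Φ) (shiftBy 1) (hatMap f) := by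
  intro s
  funext k
  simp only [hist, hatMap]
  rw [h.semi, shiftBy_add, shiftBy_add, add_comm]

end

lemma mixing_of_semiconj {Y : Type*} [TopologicalSpace Y] {T : Y → Y} {π : Code → Y}
    (hπ : Continuous π) (hs : Function.Semiconj π (shiftBy 1) T) : IsMixingOn T (range π) := by
  rintro U V hU hV ⟨_, ⟨u, rfl⟩, hu⟩ ⟨_, ⟨v, rfl⟩, hv⟩
  obtain ⟨n₀, h⟩ := exists_shift_mem (hU.preimage hπ) (hV.preimage hπ) ⟨u, hu⟩ ⟨v, hv⟩
  refine ⟨n₀, fun n hn => ?_⟩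
  obtain ⟨s, hs1, hs2⟩ := h n hn
  refine ⟨π s, ⟨mem_range_self s, hs1⟩, ?_⟩
  rw [← (hs.iterate_right n).eq]
  exact hs2

lemma isMixingOn [TopologicalSpace X] (h : IsCoding f S Φ) :
    IsMixingOn (hatMap f) (natExt f (maxInvSet f (⋃ i, S i))) := by
  rw [h.natExt_eq]
  exact mixing_of_semiconj h.continuous_hist h.semiconj_hist

lemma isTransitiveOn [TopologicalSpace X] (h : IsCoding f S Φ) :
    IsTransitiveOn f (maxInvSet f (⋃ i, S i)) := by
  rw [h.maxInvSet_eq]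
  intro U V hU hV hU' hV'
  obtain ⟨n₀, hn⟩ := mixing_of_semiconj h.cont (fun s => (h.semi s).symm) U V hU hV hU' hV'
  exact ⟨n₀, hn n₀ le_rfl⟩

/-- The history map is an injective continuous map from a compact space, hence an embedding, and
entropy on its range is that of the shift for the pulled-back uniformity. -/
lemma coverEntropy_eq [u : UniformSpace X] [T2Space X] (h : IsCoding f S Φ) :
    Dynamics.coverEntropy (hatMap f) (natExt f (maxInvSet f (⋃ i, S i)))
      = ((Real.log 3 : ℝ) : EReal) := by
  rw [h.natExt_eq, ← image_univ,
    Dynamics.coverEntropy_image_of_comap (inferInstance : UniformSpace (ℕ → X)) h.semiconj_hist]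
  refine coverEntropy_shift _ ?_
  exact ((h.continuous_hist.isClosedEmbedding h.injective_hist).isInducing.eq_induced).symm

lemma isBasicSet {f : ℂ × ℂ → ℂ × ℂ} {S : Fin 3 → Set (ℂ × ℂ)} {Φ : Code → ℂ × ℂ}
    (h : IsCoding f S Φ) (hS : ∀ i, IsOpen (S i)) {u : ℕ}
    (hyp : IsHyperbolicSet f (maxInvSet f (⋃ i, S i)) u) :
    IsBasicSet f (maxInvSet f (⋃ i, S i)) u := by
  refine ⟨hyp, h.isTransitiveOn, {x | x 0 ∈ ⋃ i, S i},
    (isOpen_iUnion hS).preimage (continuous_apply 0), fun x hx => ?_, (natExt_maxInvSet _ _).symm⟩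
  exact h.subset_iUnion (hx 0).1

end IsCoding

end Blender

namespace Blender

open Set Filter Topology

/-! ### The maps for a fixed choice of parameters -/

/-- The map `F` for the parameters `α₁ = 1/50`, `α₂ = 1/100`, `ε₁ = 3/25`, `ε₂ = 1/50`. -/
noncomputable def G (l : ℕ) : ℂ × ℂ → ℂ × ℂ := F (1 / 50) (1 / 100) (3 / 25) (1 / 50) l

/-- The linear part of the fibre maps of `G`. -/
noncomputable def cA (w : ℂ) : ℂ := 1 + w ^ 3 / 100

/-- The translation part of the fibre maps of `G`. -/
noncomputable def cB (w : ℂ) : ℂ := w * (3 * w ^ 3 + 2) / 50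

lemma G_apply (l : ℕ) (x : ℂ × ℂ) : G l x = (cA x.2 * x.1 + cB x.2, q^[l] x.2) := by
  unfold G F cA cB
  ext
  · push_cast; ring
  · rfl

lemma continuous_cA : Continuous cA := by unfold cA; fun_prop

lemma continuous_cB : Continuous cB := by unfold cB; fun_prop

lemma norm_cA_sub_le {w w' : ℂ} (hw : ‖w‖ ≤ 2) (hw' : ‖w'‖ ≤ 2) :
    ‖cA w - cA w'‖ ≤ ‖w - w'‖ := by
  have e : cA w - cA w' = (w ^ 2 + w * w' + w' ^ 2) / 100 * (w - w') := by unfold cA; ring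
  have h : ‖w ^ 2 + w * w' + w' ^ 2‖ ≤ 2 ^ 2 + 2 * 2 + 2 ^ 2 := by
    refine (norm_add₃_le).trans ?_
    rw [norm_mul, norm_pow, norm_pow]
    gcongr
  rw [e, norm_mul, norm_div]
  refine mul_le_of_le_one_left (norm_nonneg _) ?_
  rw [show ‖(100 : ℂ)‖ = 100 by simp, div_le_one (by norm_num)]
  linarith

lemma norm_cB_sub_le {w w' : ℂ} (hw : ‖w‖ ≤ 2) (hw' : ‖w'‖ ≤ 2) :
    ‖cB w - cB w'‖ ≤ 3 * ‖w - w'‖ := by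
  have e : cB w - cB w'
      = (3 * (w ^ 3 + w ^ 2 * w' + w * w' ^ 2 + w' ^ 3) + 2) / 50 * (w - w') := by unfold cB; ring
  have h : ‖3 * (w ^ 3 + w ^ 2 * w' + w * w' ^ 2 + w' ^ 3) + 2‖
      ≤ 3 * (2 ^ 3 + 2 ^ 2 * 2 + 2 * 2 ^ 2 + 2 ^ 3) + 2 := by
    refine (norm_add_le _ _).trans ?_
    rw [norm_mul, show ‖(3 : ℂ)‖ = 3 by simp, show ‖(2 : ℂ)‖ = 2 by simp]
    gcongr
    refine (norm_add₄_le).trans ?_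
    rw [norm_mul, norm_mul, norm_pow, norm_pow, norm_pow, norm_pow]
    gcongr
  rw [e, norm_mul, norm_div, show ‖(50 : ℂ)‖ = 50 by simp]
  refine mul_le_mul_of_nonneg_right ?_ (norm_nonneg _)
  rw [div_le_iff₀ (by norm_num)]
  linarith

lemma norm_cA_le {w : ℂ} (hw : ‖w‖ ≤ 2) : ‖cA w‖ ≤ 2 := by
  unfold cA
  refine (norm_add_le _ _).trans ?_
  rw [norm_div, norm_pow, norm_one, show ‖(100 : ℂ)‖ = 100 by simp]
  have : ‖w‖ ^ 3 ≤ 2 ^ 3 := by gcongr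
  linarith

/-- The first coordinate of `G` is Lipschitz. -/
lemma norm_G_fst_sub_le (l : ℕ) {x y : ℂ × ℂ} (hx2 : ‖x.2‖ ≤ 2) (hy1 : ‖y.1‖ ≤ 1)
    (hy2 : ‖y.2‖ ≤ 2) : ‖(G l x).1 - (G l y).1‖ ≤ 2 * ‖x.1 - y.1‖ + 4 * ‖x.2 - y.2‖ := by
  rw [G_apply, G_apply]
  have e : cA x.2 * x.1 + cB x.2 - (cA y.2 * y.1 + cB y.2)
      = cA x.2 * (x.1 - y.1) + ((cA x.2 - cA y.2) * y.1 + (cB x.2 - cB y.2)) := by ring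
  simp only
  rw [e]
  refine (norm_add_le _ _).trans (add_le_add ?_ ((norm_add_le _ _).trans ?_))
  · rw [norm_mul]; gcongr; exact norm_cA_le hx2
  · rw [norm_mul]
    have h1 := norm_cA_sub_le hx2 hy2
    have h2 := norm_cB_sub_le hx2 hy2
    have h3 : ‖cA x.2 - cA y.2‖ * ‖y.1‖ ≤ ‖x.2 - y.2‖ * 1 := by gcongr
    linarith

lemma hasFDerivAt_G (l : ℕ) (x : ℂ × ℂ) : ∃ D : ℂ × ℂ →L[ℂ] ℂ × ℂ, HasFDerivAt (G l) D x ∧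
    ∀ v, D v = (cA x.2 * v.1 + (3 * x.2 ^ 2 / 100 * x.1 + (12 * x.2 ^ 3 + 2) / 50) * v.2,
      7 ^ l * x.2 ^ (7 ^ l - 1) * v.2) := by
  have h1 : HasFDerivAt (Prod.fst : ℂ × ℂ → ℂ) (ContinuousLinearMap.fst ℂ ℂ ℂ) x := hasFDerivAt_fst
  have h2 : HasFDerivAt (Prod.snd : ℂ × ℂ → ℂ) (ContinuousLinearMap.snd ℂ ℂ ℂ) x := hasFDerivAt_snd
  have hA : HasDerivAt cA (3 * x.2 ^ 2 / 100) x.2 := by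
    unfold cA
    simpa using ((hasDerivAt_pow 3 x.2).div_const 100).const_add 1
  have hB : HasDerivAt cB ((12 * x.2 ^ 3 + 2) / 50) x.2 := by
    unfold cB
    have := ((hasDerivAt_id x.2).mul (((hasDerivAt_pow 3 x.2).const_mul 3).add_const 2)).div_const 50
    refine this.congr_deriv ?_
    simp only [id_eq, Nat.cast_ofNat]
    ring
  have hQ : HasDerivAt q^[l] (7 ^ l * x.2 ^ (7 ^ l - 1)) x.2 := by
    rw [show q^[l] = fun w => w ^ 7 ^ l from funext (q_iterate l)]
    simpa using hasDerivAt_pow (7 ^ l) x.2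
  have hG : G l = fun x => (cA x.2 * x.1 + cB x.2, q^[l] x.2) := funext (G_apply l)
  rw [hG]
  refine ⟨_, (((hA.comp_hasFDerivAt x h2).mul h1).add (hB.comp_hasFDerivAt x h2)).prodMk
    (hQ.comp_hasFDerivAt x h2), fun v => ?_⟩
  ext <;> simp
  ring

lemma differentiable_G (l : ℕ) : Differentiable ℂ (G l) := fun x =>
  let ⟨_, h, _⟩ := hasFDerivAt_G l x
  h.differentiableAt

lemma fderiv_G (l : ℕ) (x v : ℂ × ℂ) : fderiv ℂ (G l) x v =
    (cA x.2 * v.1 + (3 * x.2 ^ 2 / 100 * x.1 + (12 * x.2 ^ 3 + 2) / 50) * v.2,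
      7 ^ l * x.2 ^ (7 ^ l - 1) * v.2) := by
  obtain ⟨D, h, hD⟩ := hasFDerivAt_G l x
  rw [h.fderiv, hD]

/-- The bound 20 on z is the radius R of the basic sets. Stopping short of 2 leaves room for the
derivative of a perturbation. -/
lemma norm_offDiagonal_le {z w : ℂ} (hz : ‖z‖ ≤ 20) (hw : ‖w‖ ≤ 11 / 10) :
    ‖3 * w ^ 2 / 100 * z + (12 * w ^ 3 + 2) / 50‖ ≤ 199 / 100 := by
  have h1 : ‖3 * w ^ 2 / 100 * z‖ ≤ 3 * (11 / 10) ^ 2 / 100 * 20 := by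
    rw [norm_mul, norm_div, norm_mul, norm_pow, show ‖(3 : ℂ)‖ = 3 by simp,
      show ‖(100 : ℂ)‖ = 100 by simp]
    gcongr
  have h2 : ‖(12 * w ^ 3 + 2) / 50‖ ≤ (12 * (11 / 10) ^ 3 + 2) / 50 := by
    rw [norm_div, show ‖(50 : ℂ)‖ = 50 by simp]
    gcongr
    refine (norm_add_le _ _).trans ?_
    rw [norm_mul, norm_pow, show ‖(12 : ℂ)‖ = 12 by simp, show ‖(2 : ℂ)‖ = 2 by simp]
    gcongr
  refine (norm_add_le _ _).trans ((add_le_add h1 h2).trans ?_)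
  norm_num

/-! ### Estimates near the fixed points -/

lemma norm_sub_le_of_mem_closure {p w : ℂ} (hp : p ^ 6 = 1) {l : ℕ} (hl : 20 ≤ l)
    (hw : w ∈ closure (nbh p l)) : ‖w - p‖ ≤ 1 / 10 ^ 14 := by
  refine (norm_sub_le_of_mem_closure_nbh hp hl hw).trans ?_
  rw [div_le_iff₀ (seven_pow_pos l)]
  linarith [seven_pow_large hl]

lemma norm_le_of_near {p w : ℂ} (hp : p ^ 6 = 1) (hw : ‖w - p‖ ≤ 1 / 10 ^ 4) :
    ‖w‖ ≤ 11 / 10 := by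
  have := norm_add_le (w - p) p
  rw [sub_add_cancel, norm_eq_one_of_pow_six hp] at this
  linarith

lemma cA_cB_of_near {p w : ℂ} (hp : p ^ 6 = 1) {e : ℝ} (he : e ≤ 1 / 10 ^ 4) (hw : ‖w - p‖ ≤ e) :
    ‖cA w - cA p‖ ≤ e ∧ ‖cB w - cB p‖ ≤ 3 * e := by
  have h1 := norm_le_of_near hp (hw.trans he)
  have h2 := norm_eq_one_of_pow_six hp
  have h3 := norm_cA_sub_le (w := w) (w' := p) (by linarith) (by linarith)
  have h4 := norm_cB_sub_le (w := w) (w' := p) (by linarith) (by linarith)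
  exact ⟨by linarith, by linarith⟩

lemma cA_of_cube {p : ℂ} (hp : p ^ 3 = 1) : cA p = 101 / 100 ∧ cB p = p / 10 := by
  unfold cA cB
  rw [hp]
  constructor <;> ring

lemma cA_of_neg_cube {p : ℂ} (hp : p ^ 3 = -1) : cA p = 99 / 100 ∧ cB p = -p / 50 := by
  unfold cA cB
  rw [hp]
  constructor <;> ring

lemma near_rPt {l : ℕ} (hl : 20 ≤ l) {i : Fin 3} {w : ℂ} (hw : w ∈ closure (nbh (rPt i) l)) :
    ‖w‖ ≤ 11 / 10 ∧ 1009 / 1000 ≤ ‖cA w‖ ∧ ‖cA w - 101 / 100‖ ≤ 1 / 10 ^ 10 ∧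
      ‖cB w - rPt i / 10‖ ≤ 1 / 10 ^ 10 ∧ ‖cB w‖ ≤ 1009 / 10000 := by
  have hp := isTriple_rPt.pow i
  have hn := norm_sub_le_of_mem_closure hp hl hw
  obtain ⟨h1, h2⟩ := cA_cB_of_near hp (by norm_num) hn
  obtain ⟨e1, e2⟩ := cA_of_cube (rPt_pow_three i)
  rw [e1] at h1
  rw [e2] at h2
  refine ⟨norm_le_of_near hp (by linarith), ?_, by linarith, by linarith, ?_⟩
  · have := norm_sub_norm_le (101 / 100 : ℂ) (101 / 100 - cA w)
    rw [sub_sub_cancel, norm_sub_rev, show ‖(101 / 100 : ℂ)‖ = 101 / 100 by norm_num] at this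
    linarith
  · have := norm_add_le (cB w - rPt i / 10) (rPt i / 10)
    rw [sub_add_cancel, norm_div, norm_eq_one_of_pow_six hp, show ‖(10 : ℂ)‖ = 10 by simp] at this
    linarith

lemma near_sPt {l : ℕ} (hl : 20 ≤ l) {i : Fin 3} {w : ℂ} (hw : w ∈ closure (nbh (sPt i) l)) :
    ‖w‖ ≤ 11 / 10 ∧ 989 / 1000 ≤ ‖cA w‖ ∧ ‖cA w‖ ≤ 991 / 1000 ∧
      ‖cB w + sPt i / 50‖ ≤ 1 / 10 ^ 10 ∧ ‖cB w‖ ≤ 21 / 1000 := by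
  have hp := isTriple_sPt.pow i
  have hn := norm_sub_le_of_mem_closure hp hl hw
  obtain ⟨h1, h2⟩ := cA_cB_of_near hp (by norm_num) hn
  obtain ⟨e1, e2⟩ := cA_of_neg_cube (sPt_pow_three i)
  rw [e1] at h1
  rw [e2, neg_div, sub_neg_eq_add] at h2
  refine ⟨norm_le_of_near hp (by linarith), ?_, ?_, by linarith, ?_⟩
  · have := norm_sub_norm_le (99 / 100 : ℂ) (99 / 100 - cA w)
    rw [sub_sub_cancel, norm_sub_rev, show ‖(99 / 100 : ℂ)‖ = 99 / 100 by norm_num] at this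
    linarith
  · have := norm_add_le (cA w - 99 / 100) (99 / 100)
    rw [sub_add_cancel, show ‖(99 / 100 : ℂ)‖ = 99 / 100 by norm_num] at this
    linarith
  · have := norm_sub_le (cB w + sPt i / 50) (sPt i / 50)
    rw [add_sub_cancel_right, norm_div, norm_eq_one_of_pow_six hp, show ‖(50 : ℂ)‖ = 50 by simp]
      at this
    linarith

lemma IsTriple.disjoint {p : Fin 3 → ℂ} (hp : IsTriple p) {l : ℕ} (hl : 20 ≤ l) {i j : Fin 3}
    {w : ℂ} (hi : w ∈ nbh (p i) l) (hj : w ∈ nbh (p j) l) : i = j := by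
  by_contra hij
  have h1 := norm_sub_le_of_mem_closure (hp.pow i) hl (subset_closure hi)
  have h2 := norm_sub_le_of_mem_closure (hp.pow j) hl (subset_closure hj)
  have h3 := norm_sub_le (w - p j) (w - p i)
  rw [sub_sub_sub_cancel_left] at h3
  linarith [hp.sep i j hij]

/-! ### Coding of the invariant sets -/

/-- The orbits of `q^l` in the neighbourhoods of a triple of fixed points are coded by the full
shift. -/
lemma IsTriple.exists_base_coding {p : Fin 3 → ℂ} (hp : IsTriple p) {l : ℕ} (hl : 20 ≤ l) :
    ∃ W : Code → ℂ, Continuous W ∧ (∀ s, W s ∈ nbh (p (s 0)) l) ∧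
      (∀ s, q^[l] (W s) = W (shiftBy 1 s)) ∧
      ∀ (o : ℤ → ℂ) (s : Code), (∀ n, q^[l] (o n) = o (n + 1)) →
        (∀ n, o n ∈ nbh (p (s n)) l) → o 0 = W s := by
  choose θ hθ hpθ using hp.ang
  have hL := seven_pow_large hl
  have hinv : ‖((7 : ℂ) ^ l)⁻¹‖ ≤ 1 / 100 := by
    rw [norm_inv, norm_seven_pow, ← one_div]
    exact one_div_le_one_div_of_le (by norm_num) (by linarith)
  have hsym : ∀ k : ℤ, Continuous fun s : Code => s k := fun k => continuous_apply k
  have hcθ : Continuous fun s : Code => ((θ (s 0) (s 1) : ℝ) : ℂ) * Complex.I := by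
    have : Continuous fun a : Fin 3 × Fin 3 => ((θ a.1 a.2 : ℝ) : ℂ) * Complex.I :=
      continuous_of_discreteTopology
    exact this.comp ((hsym 0).prodMk (hsym 1))
  -- In logarithmic coordinates an orbit with itinerary s satisfies ζ(s) = 7^(-l) ζ(shift s) +
  -- iθ(s₀, s₁), an affine contraction driven by the future.
  obtain ⟨ζ, hζ, hζb, hζe⟩ := exists_affine_section (continuous_shiftBy 1)
    (A := fun _ => ((7 : ℂ) ^ l)⁻¹) continuous_const hcθ (b := 21 / 10) (c := 1 / 100)
    (by norm_num) (by norm_num) (by norm_num) (fun _ => hinv) (fun s => by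
      rw [norm_mul, Complex.norm_I, mul_one, Complex.norm_real]
      exact hθ _ _)
  have hstrip : ∀ s, ζ s ∈ strip := by
    intro s
    have hn : ‖ζ s‖ ≤ 22 / 10 := (hζb s).trans (by norm_num)
    have h1 := abs_le.1 ((Complex.abs_re_le_norm _).trans hn)
    have h2 := abs_le.1 ((Complex.abs_im_le_norm _).trans hn)
    rw [mem_strip]
    refine ⟨⟨?_, ?_⟩, ?_, ?_⟩ <;> linarith [h1.1, h1.2, h2.1, h2.2]
  refine ⟨fun s => p (s 0) * Complex.exp (ζ s / 7 ^ l), ?_, fun s => ⟨_, hstrip s, rfl⟩,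
    fun s => ?_, fun o s ho hos => ?_⟩
  · have : Continuous fun s : Code => p (s 0) :=
      (continuous_of_discreteTopology (f := p)).comp (hsym 0)
    fun_prop
  · rw [q_iterate_exp (hp.pow _), hζe s, add_comm, Complex.exp_add, ← mul_assoc, ← hpθ,
      ← div_eq_inv_mul]
    rfl
  · choose ξ hξ hoξ using hos
    have hstep : ∀ n, ξ n = ((7 : ℂ) ^ l)⁻¹ * ξ (n + 1) + θ (s n) (s (n + 1)) * Complex.I := by
      intro n
      have h0 : p (s n) ≠ 0 := by
        intro h
        have := hp.pow (s n)
        rw [h] at this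
        norm_num at this
      have hθn := abs_le.1 (hθ (s n) (s (n + 1)))
      obtain ⟨hm, he⟩ := exists_log_of_angle (hpθ (s n) (s (n + 1))) hθn.1 (by linarith)
        (norm_div_seven_pow_le hl (strip_subset_cstrip (hξ (n + 1))))
      have hq := ho n
      rw [← hoξ n, ← hoξ (n + 1)] at hq
      simp only [q_iterate_exp (hp.pow _)] at hq
      rw [← he] at hq
      rw [exp_injOn_cstrip (strip_subset_cstrip (hξ n)) (strip_subset_cstrip hm)
        (mul_left_cancel₀ h0 hq), div_eq_inv_mul, add_comm]
    have hd := le_div_of_bounded_recursion (d := fun n : ℕ => ‖ξ n - ζ (shiftBy n s)‖)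
      (c := 1 / 100) (e := 0) (M := 7 + 7) (by norm_num) (by norm_num)
      (fun n => (norm_sub_le _ _).trans (add_le_add
        (norm_le_of_mem_cstrip (strip_subset_cstrip (hξ n)))
        (norm_le_of_mem_cstrip (strip_subset_cstrip (hstrip _)))))
      (fun n => by
        rw [hstep, hζe (shiftBy n s), shiftBy_add]
        simp only [shiftBy_apply, zero_add]
        rw [add_comm (1 : ℤ) n, add_sub_add_right_eq_sub, ← mul_sub, norm_mul, add_zero]
        push_cast
        gcongr)
    have h0 : ξ 0 = ζ s := by
      rw [zero_div, Nat.cast_zero, shiftBy_zero] at hd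
      exact sub_eq_zero.1 (norm_le_zero_iff.1 hd)
    rw [← hoξ 0, h0]

/-- The pieces coding the orbits of `G`. -/
def pieces (p : Fin 3 → ℂ) (l : ℕ) (i : Fin 3) : Set (ℂ × ℂ) := Metric.ball 0 20 ×ˢ nbh (p i) l

lemma iUnion_pieces (p : Fin 3 → ℂ) (l : ℕ) :
    ⋃ i, pieces p l i = Metric.ball 0 20 ×ˢ ⋃ i, nbh (p i) l := by
  unfold pieces
  rw [prod_iUnion]

lemma IsTriple.isOpen_pieces {p : Fin 3 → ℂ} (hp : IsTriple p) (l : ℕ) (i : Fin 3) :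
    IsOpen (pieces p l i) := Metric.isOpen_ball.prod (isOpen_nbh (hp.pow i) l)

lemma exists_isCoding_rPt {l : ℕ} (hl : 20 ≤ l) : ∃ Φ, IsCoding (G l) (pieces rPt l) Φ := by
  obtain ⟨W, hW, hWm, hWs, hWu⟩ := isTriple_rPt.exists_base_coding hl
  have hnear := fun s => near_rPt hl (subset_closure (hWm s))
  have hne : ∀ s, cA (W s) ≠ 0 := fun s h => by
    have := (hnear s).2.1
    rw [h, norm_zero] at this
    linarith
  have hAinv : ∀ s, ‖(cA (W s))⁻¹‖ ≤ 1000 / 1009 := fun s => by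
    rw [norm_inv, inv_le_comm₀ (by linarith [(hnear s).2.1]) (by norm_num)]
    exact le_trans (by norm_num) (hnear s).2.1
  -- The fibres expand, so the bounded solution is obtained by inverting the fibre maps along the
  -- future. Its bound is (1/10) / (1 - 1000/1009), about 11.2, which fits in the radius 20.
  obtain ⟨Z, hZ, hZb, hZe⟩ := exists_affine_section (continuous_shiftBy 1)
    (A := fun s => (cA (W s))⁻¹) (B := fun s => -((cA (W s))⁻¹ * cB (W s)))
    ((continuous_cA.comp hW).inv₀ hne)
    (((continuous_cA.comp hW).inv₀ hne).mul (continuous_cB.comp hW)).neg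
    (b := 1 / 10) (c := 1000 / 1009) (by norm_num) (by norm_num) (by norm_num) hAinv
    (fun s => by
      rw [norm_neg, norm_mul]
      calc ‖(cA (W s))⁻¹‖ * ‖cB (W s)‖ ≤ 1000 / 1009 * (1009 / 10000) := by
            gcongr; exacts [hAinv s, (hnear s).2.2.2.2]
        _ = 1 / 10 := by norm_num)
  have hZ' : ∀ s, cA (W s) * Z s + cB (W s) = Z (shiftBy 1 s) := by
    intro s
    rw [hZe s]
    field_simp [hne s]
    ring
  refine ⟨fun s => (Z s, W s), ⟨fun i j x hi hj => isTriple_rPt.disjoint hl hi.2 hj.2,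
    hZ.prodMk hW, fun s => ?_, fun s => ⟨?_, hWm s⟩, fun o s ho hos => ?_⟩⟩
  · rw [G_apply, hZ', hWs]
  · rw [mem_ball_zero_iff]
    exact (hZb s).trans_lt (by norm_num)
  · simp only [G_apply] at ho
    have hw : ∀ n, (o n).2 = W (shiftBy n s) := by
      intro n
      have := hWu (fun k => (o (k + n)).2) (shiftBy n s)
        (fun k => by
          have := congrArg Prod.snd (ho (k + n))
          simp only at this
          rw [this, add_right_comm])
        (fun k => (hos (k + n)).2)
      simpa using this
    have hd := le_div_of_bounded_recursion (d := fun n : ℕ => ‖(o n).1 - Z (shiftBy n s)‖)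
      (c := 1000 / 1009) (e := 0) (M := 20 + 20) (by norm_num) (by norm_num)
      (fun n => (norm_sub_le _ _).trans (add_le_add
        (mem_ball_zero_iff.1 (hos n).1).le ((hZb _).trans (by norm_num))))
      (fun n => by
        have h1 := congrArg Prod.fst (ho n)
        have h2 := hZ' (shiftBy n s)
        rw [shiftBy_add, add_comm] at h2
        simp only [hw n] at h1
        have e : (o n).1 - Z (shiftBy n s)
            = (cA (W (shiftBy n s)))⁻¹ * ((o (n + 1)).1 - Z (shiftBy (n + 1) s)) := by
          rw [← h1, ← add_comm (1 : ℤ) n, ← shiftBy_add, ← hZ']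
          field_simp [hne (shiftBy n s)]
          ring
        rw [e, norm_mul, add_zero]
        push_cast
        gcongr
        exact hAinv _)
    have h0 := hw 0
    rw [zero_div, Nat.cast_zero, shiftBy_zero] at hd
    rw [shiftBy_zero] at h0
    exact Prod.ext (sub_eq_zero.1 (norm_le_zero_iff.1 hd)) h0

lemma exists_isCoding_sPt {l : ℕ} (hl : 20 ≤ l) : ∃ Φ, IsCoding (G l) (pieces sPt l) Φ := by
  obtain ⟨W, hW, hWm, hWs, hWu⟩ := isTriple_sPt.exists_base_coding hl
  have hnear := fun s => near_sPt hl (subset_closure (hWm s))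
  have hW' : Continuous fun s => W (shiftBy (-1) s) := hW.comp (continuous_shiftBy _)
  -- The fibres contract here, so z is the sum of the contributions of the past and the shift is
  -- inverted. Uniqueness below likewise runs backward in time.
  obtain ⟨Z, hZ, hZb, hZe⟩ := exists_affine_section (continuous_shiftBy (-1))
    (continuous_cA.comp hW') (continuous_cB.comp hW')
    (b := 21 / 1000) (c := 991 / 1000) (by norm_num) (by norm_num) (by norm_num)
    (fun s => (hnear _).2.2.1) (fun s => (hnear _).2.2.2.2)
  have hZ' : ∀ s, cA (W s) * Z s + cB (W s) = Z (shiftBy 1 s) := by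
    intro s
    rw [hZe (shiftBy 1 s)]
    simp only [Function.comp_apply, shiftBy_add, neg_add_cancel, shiftBy_zero]
  refine ⟨fun s => (Z s, W s), ⟨fun i j x hi hj => isTriple_sPt.disjoint hl hi.2 hj.2,
    hZ.prodMk hW, fun s => ?_, fun s => ⟨?_, hWm s⟩, fun o s ho hos => ?_⟩⟩
  · rw [G_apply, hZ', hWs]
  · rw [mem_ball_zero_iff]
    exact (hZb s).trans_lt (by norm_num)
  · simp only [G_apply] at ho
    have hw : ∀ n, (o n).2 = W (shiftBy n s) := by
      intro n
      have := hWu (fun k => (o (k + n)).2) (shiftBy n s)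
        (fun k => by
          have := congrArg Prod.snd (ho (k + n))
          simp only at this
          rw [this, add_right_comm])
        (fun k => (hos (k + n)).2)
      simpa using this
    have hd := le_div_of_bounded_recursion
      (d := fun n : ℕ => ‖(o (-n)).1 - Z (shiftBy (-n) s)‖)
      (c := 991 / 1000) (e := 0) (M := 20 + 20) (by norm_num) (by norm_num)
      (fun n => (norm_sub_le _ _).trans (add_le_add
        (mem_ball_zero_iff.1 (hos _).1).le ((hZb _).trans (by norm_num))))
      (fun n => by
        have hk : -((n : ℕ) : ℤ) = -((n + 1 : ℕ) : ℤ) + 1 := by push_cast; ring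
        have h1 := congrArg Prod.fst (ho (-((n + 1 : ℕ) : ℤ)))
        have h2 := hZ' (shiftBy (-((n + 1 : ℕ) : ℤ)) s)
        rw [shiftBy_add, add_comm (1 : ℤ), ← hk] at h2
        rw [← hk] at h1
        simp only [hw] at h1
        rw [← h1, ← h2, add_sub_add_right_eq_sub, ← mul_sub, norm_mul, add_zero]
        gcongr
        exact (hnear _).2.2.1)
    have h0 := hw 0
    rw [zero_div, Nat.cast_zero, neg_zero, shiftBy_zero] at hd
    rw [shiftBy_zero] at h0
    exact Prod.ext (sub_eq_zero.1 (norm_le_zero_iff.1 hd)) h0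

end Blender

namespace Blender

open Set Filter Topology

/-! ### The basic sets -/

lemma norm_deriv_large {p w : ℂ} (hp : p ^ 6 = 1) {l : ℕ} (hl : 20 ≤ l)
    (hw : w ∈ closure (nbh p l)) : 10 ^ 14 ≤ ‖(7 : ℂ) ^ l * w ^ (7 ^ l - 1)‖ := by
  have := le_norm_deriv_q_iterate hp hw
  linarith [seven_pow_large hl]

lemma eight_div_le {l : ℕ} (hl : 20 ≤ l) : (8 / 7 ^ l : ℝ) ≤ 1 / 10 ^ 14 := by
  rw [div_le_iff₀ (seven_pow_pos l)]
  linarith [seven_pow_large hl]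

lemma radius_le {l : ℕ} (hl : 20 ≤ l) : (9 / 4 / 7 ^ l : ℝ) ≤ 1 / 10 ^ 14 := by
  rw [div_le_iff₀ (seven_pow_pos l)]
  linarith [seven_pow_large hl]

lemma isBasicSet_rPt {l : ℕ} (hl : 20 ≤ l) :
    IsBasicSet (G l) (maxInvSet (G l) (⋃ i, pieces rPt l i)) 2 := by
  obtain ⟨Φ, h⟩ := exists_isCoding_rPt hl
  refine h.isBasicSet (isTriple_rPt.isOpen_pieces l) (isHyperbolicSet_two h.isCompact h.image_eq
    (fun x _ => Eventually.of_forall (differentiable_G l)) fun x hx => ?_)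
  obtain ⟨i, hi⟩ := mem_iUnion.1 (h.subset_iUnion hx)
  have hw := subset_closure hi.2
  obtain ⟨h1, h2, -⟩ := near_rPt hl hw
  exact ⟨_, _, _, by linarith, by linarith [norm_offDiagonal_le (mem_ball_zero_iff.1 hi.1).le h1],
    by linarith [norm_deriv_large (isTriple_rPt.pow i) hl hw], fderiv_G l x⟩

lemma isBasicSet_sPt {l : ℕ} (hl : 20 ≤ l) :
    IsBasicSet (G l) (maxInvSet (G l) (⋃ i, pieces sPt l i)) 1 := by
  obtain ⟨Φ, h⟩ := exists_isCoding_sPt hl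
  refine h.isBasicSet (isTriple_sPt.isOpen_pieces l) (isHyperbolicSet_one h.isCompact h.image_eq
    (fun x _ => Eventually.of_forall (differentiable_G l)) ?_ fun x hx => ?_)
  · exact (continuousOn_fderiv isOpen_univ (differentiable_G l).differentiableOn).mono
      (subset_univ _)
  obtain ⟨i, hi⟩ := mem_iUnion.1 (h.subset_iUnion hx)
  have hw := subset_closure hi.2
  obtain ⟨h1, -, h2, -⟩ := near_sPt hl hw
  have h3 := norm_offDiagonal_le (mem_ball_zero_iff.1 hi.1).le h1
  have h4 := norm_deriv_large (isTriple_sPt.pow i) hl hw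
  rw [fderiv_G, fderiv_G]
  simp only [mul_one, mul_zero, add_zero, zero_add, norm_zero]
  exact ⟨by linarith, by norm_num, by linarith, by linarith⟩

/-! ### The saddle blender -/

lemma IsTriple.exists_branch {p : Fin 3 → ℂ} (hp : IsTriple p) {l : ℕ} (hl : 20 ≤ l) (i j : Fin 3) :
    ∃ ψ : ℂ → ℂ,
      (∀ u, ‖u - p j‖ ≤ 1 / 100 → q^[l] (ψ u) = u ∧ ‖ψ u - p i‖ ≤ 9 / 4 / 7 ^ l) ∧
      ∀ u u', ‖u - p j‖ ≤ 1 / 100 → ‖u' - p j‖ ≤ 1 / 100 → ‖ψ u - ψ u'‖ ≤ 8 / 7 ^ l * ‖u - u'‖ :=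
  let ⟨_, hθ, h⟩ := hp.ang i j
  exists_inverse_branch (hp.pow i) h hθ hl

/-- `g` is `C^1`-close to `G` on `K`, in terms of difference quotients. -/
def IsClose (l : ℕ) (g : ℂ × ℂ → ℂ × ℂ) (K : Set (ℂ × ℂ)) : Prop :=
  (∀ x ∈ K, ‖g x - G l x‖ ≤ 1 / 10 ^ 4) ∧
    ∀ x ∈ K, ∀ y ∈ K, ‖(g x - G l x) - (g y - G l y)‖ ≤ 1 / 10 ^ 4 * ‖x - y‖

lemma isClose_self (l : ℕ) (K : Set (ℂ × ℂ)) : IsClose l (G l) K := by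
  refine ⟨fun x _ => ?_, fun x _ y _ => ?_⟩
  · rw [sub_self, norm_zero]; norm_num
  · rw [sub_self, sub_self, sub_zero, norm_zero]; positivity

lemma isClose_of_fderiv {l : ℕ} {g : ℂ × ℂ → ℂ × ℂ} {K : Set (ℂ × ℂ)} (hK : Convex ℝ K)
    (hd : ∀ x ∈ K, DifferentiableAt ℂ g x) (h0 : ∀ x ∈ K, ‖g x - G l x‖ ≤ 1 / 10 ^ 4)
    (h1 : ∀ x ∈ K, ‖fderiv ℂ g x - fderiv ℂ (G l) x‖ ≤ 1 / 10 ^ 4) : IsClose l g K := by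
  refine ⟨h0, fun x hx y hy => ?_⟩
  exact hK.norm_image_sub_le_of_norm_hasFDerivWithin_le (𝕜 := ℂ)
    (f := fun x => g x - G l x) (f' := fun x => fderiv ℂ g x - fderiv ℂ (G l) x)
    (fun x hx => ((hd x hx).hasFDerivAt.sub (differentiable_G l x).hasFDerivAt).hasFDerivWithinAt)
    h1 hy hx

/-- Maps close to `G` map the product of `1/4 𝔻` and the neighbourhoods of the points `s_i` over
its closure. -/
lemma exists_preimage_saddle {l : ℕ} (hl : 20 ≤ l) {g : ℂ × ℂ → ℂ × ℂ}
    (hg : IsClose l g (Metric.closedBall 0 1 ×ˢ Metric.closedBall 0 2)) {z u : ℂ}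
    (hz : ‖z‖ ≤ 1 / 4) (hu : u ∈ closure (⋃ i, nbh (sPt i) l)) :
    ∃ x ∈ Metric.ball (0 : ℂ) (1 / 4) ×ˢ ⋃ i, nbh (sPt i) l, g x = (z, u) := by
  rw [closure_iUnion_nbh] at hu
  obtain ⟨j, hj⟩ := mem_iUnion.1 hu
  have huj := norm_sub_le_of_mem_closure (isTriple_sPt.pow j) hl hj
  -- The inverse of the fibre map over s_i is (z + s_i/50) / (99/100). The sector property yields an
  -- i for which the numerator drops below 241/1000, so that dividing still lands inside radius 1/4.
  obtain ⟨i, hi⟩ := isTriple_sPt.sector z (1 / 50) (by norm_num)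
  have hzi : ‖z + sPt i / 50‖ ≤ 241 / 1000 := by
    have e : z + ((1 / 50 : ℝ) : ℂ) * sPt i = z + sPt i / 50 := by push_cast; ring
    rw [e] at hi
    have := norm_nonneg z
    exact abs_le_of_sq_le_sq' (by nlinarith) (by norm_num) |>.2
  obtain ⟨ψ, hψ, hψL⟩ := isTriple_sPt.exists_branch hl i j
  set E : ℂ × ℂ → ℂ × ℂ := fun x => g x - G l x with hE
  set K : Set (ℂ × ℂ) :=
    Metric.closedBall (0 : ℂ) (1 / 4) ×ˢ Metric.closedBall (sPt i) (9 / 4 / 7 ^ l) with hK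
  have hr := radius_le hl
  have h8 := eight_div_le hl
  have hKsub : K ⊆ Metric.closedBall 0 1 ×ˢ Metric.closedBall 0 2 := by
    refine prod_mono (Metric.closedBall_subset_closedBall (by norm_num)) fun w hw => ?_
    rw [mem_closedBall_iff_norm] at hw
    rw [mem_closedBall_zero_iff]
    linarith [norm_le_of_near (isTriple_sPt.pow i) (w := w) (by linarith)]
  have hE0 : ∀ x ∈ K, ‖(E x).1‖ ≤ 1 / 10 ^ 4 ∧ ‖(E x).2‖ ≤ 1 / 10 ^ 4 := fun x hx =>
    ⟨(norm_fst_le _).trans (hg.1 x (hKsub hx)), (norm_snd_le _).trans (hg.1 x (hKsub hx))⟩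
  have hE1 : ∀ x ∈ K, ∀ y ∈ K, ‖(E x).1 - (E y).1‖ ≤ 1 / 10 ^ 4 * ‖x - y‖ ∧
      ‖(E x).2 - (E y).2‖ ≤ 1 / 10 ^ 4 * ‖x - y‖ := fun x hx y hy =>
    ⟨(norm_fst_le (E x - E y)).trans (hg.2 x (hKsub hx) y (hKsub hy)),
      (norm_snd_le (E x - E y)).trans (hg.2 x (hKsub hx) y (hKsub hy))⟩
  have hdom : ∀ x ∈ K, ‖u - (E x).2 - sPt j‖ ≤ 1 / 100 := fun x hx => by
    rw [sub_right_comm]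
    have := norm_sub_le (u - sPt j) (E x).2
    linarith [(hE0 x hx).2]
  -- The equation G x + E x = (z, u) is rewritten as a fixed-point problem: the base coordinate is
  -- solved by the inverse branch ψ and the fibre coordinate by the inverse affine map, with E
  -- evaluated at the unknown.
  set ω : ℂ × ℂ → ℂ := fun x => ψ (u - (E x).2) with hω
  have hωball : ∀ x ∈ K, ω x ∈ Metric.closedBall (sPt i) (9 / 4 / 7 ^ l) := fun x hx =>
    mem_closedBall_iff_norm.2 (hψ _ (hdom x hx)).2
  have hωn : ∀ x ∈ K, ω x ∈ nbh (sPt i) l := fun x hx =>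
    closedBall_subset_nbh (isTriple_sPt.pow i) hl (hωball x hx)
  have hnear := fun x hx => near_sPt hl (subset_closure (hωn x hx))
  have hne : ∀ x ∈ K, cA (ω x) ≠ 0 := fun x hx h => by
    have := (hnear x hx).2.1
    rw [h, norm_zero] at this
    linarith
  set Z : ℂ × ℂ → ℂ := fun x => (z - cB (ω x) - (E x).1) / cA (ω x) with hZ
  have hZeq : ∀ x ∈ K, cA (ω x) * Z x = z - cB (ω x) - (E x).1 := fun x hx =>
    mul_div_cancel₀ _ (hne x hx)
  have hZlt : ∀ x ∈ K, ‖Z x‖ < 1 / 4 := by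
    intro x hx
    obtain ⟨-, h1, -, h2, -⟩ := hnear x hx
    have h3 : ‖z - cB (ω x) - (E x).1‖ ≤ 2412 / 10000 := by
      have e : z - cB (ω x) - (E x).1 = (z + sPt i / 50) - (cB (ω x) + sPt i / 50) - (E x).1 := by
        ring
      rw [e]
      have := (norm_sub_le ((z + sPt i / 50) - (cB (ω x) + sPt i / 50)) (E x).1).trans
        (add_le_add_left (norm_sub_le _ _) _)
      linarith [(hE0 x hx).1]
    rw [hZ]
    simp only
    rw [norm_div, div_lt_iff₀ (by linarith)]
    linarith
  obtain ⟨x, hx, hfix⟩ := exists_fixed_point (s := K) (T := fun x => (Z x, ω x))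
    (Metric.isClosed_closedBall.prod Metric.isClosed_closedBall).isComplete
    ⟨(0, sPt i), Metric.mem_closedBall_self (by norm_num), Metric.mem_closedBall_self
      (by positivity)⟩
    (fun x hx => ⟨mem_closedBall_zero_iff.2 (hZlt x hx).le, hωball x hx⟩)
    (c := 1 / 2) (by norm_num) (by norm_num) (fun x hx y hy => by
      have hd := norm_nonneg (x - y)
      have h1 : ‖ω x - ω y‖ ≤ 1 / 100 * ‖x - y‖ := by
        have a1 := hψL _ _ (hdom x hx) (hdom y hy)
        rw [sub_sub_sub_cancel_left] at a1
        have a2 := (hE1 y hy x hx).2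
        rw [norm_sub_rev y x] at a2
        calc ‖ω x - ω y‖ ≤ 8 / 7 ^ l * ‖(E y).2 - (E x).2‖ := a1
          _ ≤ 1 / 10 ^ 14 * (1 / 10 ^ 4 * ‖x - y‖) := by gcongr
          _ ≤ 1 / 100 * ‖x - y‖ := by linarith
      obtain ⟨b1, b2, -⟩ := hnear x hx
      obtain ⟨b3, -⟩ := hnear y hy
      have h2 := norm_cA_sub_le (w := ω x) (w' := ω y) (by linarith) (by linarith)
      have h3 := norm_cB_sub_le (w := ω x) (w' := ω y) (by linarith) (by linarith)
      have h4 : ‖Z x - Z y‖ ≤ 1 / 2 * ‖x - y‖ := by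
        have e : cA (ω x) * (Z x - Z y)
            = -(cB (ω x) - cB (ω y)) - ((E x).1 - (E y).1) - (cA (ω x) - cA (ω y)) * Z y := by
          have e1 := hZeq x hx
          have e2 := hZeq y hy
          linear_combination e1 - e2
        have h5 := congrArg norm e
        rw [norm_mul] at h5
        have h6 := (norm_sub_le (-(cB (ω x) - cB (ω y)) - ((E x).1 - (E y).1))
          ((cA (ω x) - cA (ω y)) * Z y)).trans (add_le_add_left (norm_sub_le _ _) _)
        rw [← h5, norm_neg, norm_mul] at h6
        have h7 := (hE1 x hx y hy).1
        have h8' : ‖cA (ω x) - cA (ω y)‖ * ‖Z y‖ ≤ ‖ω x - ω y‖ * (1 / 4) := by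
          gcongr; exact (hZlt y hy).le
        have h9 := mul_le_mul_of_nonneg_right b2 (norm_nonneg (Z x - Z y))
        linarith
      rw [dist_eq_norm, dist_eq_norm, Prod.norm_def]
      exact max_le h4 (by simp only [Prod.snd_sub]; linarith))
  have f1 : Z x = x.1 := congrArg Prod.fst hfix
  have f2 : ω x = x.2 := congrArg Prod.snd hfix
  refine ⟨x, ⟨mem_ball_zero_iff.2 (f1 ▸ hZlt x hx), mem_iUnion.2 ⟨i, f2 ▸ hωn x hx⟩⟩, ?_⟩
  have hgx : g x = G l x + E x := by rw [hE]; simp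
  rw [hgx, G_apply, ← f2, ← f1, hZeq x hx]
  ext
  · simp only [Prod.fst_add]
    ring
  · simp only [Prod.snd_add]
    rw [(hψ _ (hdom x hx)).1, sub_add_cancel]

/-- The domain of the saddle blender. -/
def saddleBox (l : ℕ) : Set (ℂ × ℂ) := Metric.ball (0 : ℂ) (1 / 4) ×ˢ ⋃ i, nbh (sPt i) l

lemma closure_saddleBox (l : ℕ) : closure (saddleBox l)
    = Metric.closedBall (0 : ℂ) (1 / 4) ×ˢ closure (⋃ i, nbh (sPt i) l) := by
  rw [saddleBox, closure_prod_eq, closure_ball _ (by norm_num)]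

lemma closure_saddleBox_subset_image {l : ℕ} (hl : 20 ≤ l) {g : ℂ × ℂ → ℂ × ℂ}
    (hg : IsClose l g (Metric.closedBall 0 1 ×ˢ Metric.closedBall 0 2)) :
    closure (saddleBox l) ⊆ g '' saddleBox l := by
  rw [closure_saddleBox]
  rintro ⟨z, u⟩ ⟨hz, hu⟩
  exact exists_preimage_saddle hl hg (mem_closedBall_zero_iff.1 hz) hu

lemma closure_saddleBox_subset {l : ℕ} (hl : 20 ≤ l) :
    closure (saddleBox l) ⊆ Metric.closedBall 0 1 ×ˢ Metric.closedBall 0 2 := by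
  rw [closure_saddleBox, closure_iUnion_nbh]
  refine prod_mono (Metric.closedBall_subset_closedBall (by norm_num)) (iUnion_subset fun i w hw => ?_)
  rw [mem_closedBall_zero_iff]
  linarith [(near_sPt hl hw).1]

lemma isBounded_saddleBox {l : ℕ} (hl : 20 ≤ l) : Bornology.IsBounded (saddleBox l) :=
  (Metric.isBounded_closedBall.prod Metric.isBounded_closedBall).subset
    (subset_closure.trans (closure_saddleBox_subset hl))

lemma isOpen_saddleBox (l : ℕ) : IsOpen (saddleBox l) :=
  Metric.isOpen_ball.prod (isOpen_iUnion fun i => isOpen_nbh (isTriple_sPt.pow i) l)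

lemma image_staySet_saddleBox {l : ℕ} (hl : 20 ≤ l) {g : ℂ × ℂ → ℂ × ℂ}
    (hg : IsClose l g (Metric.closedBall 0 1 ×ˢ Metric.closedBall 0 2)) :
    g '' staySet g (closure (saddleBox l)) = staySet g (closure (saddleBox l)) := by
  refine (image_staySet_subset _ _).antisymm (staySet_subset_image ?_)
  exact (staySet_subset _ _).trans
    ((closure_saddleBox_subset_image hl hg).trans (image_mono subset_closure))

lemma isSaddleBlender {l : ℕ} (hl : 20 ≤ l) :
    IsSaddleBlender (G l) (saddleBox l) (staySet (G l) (closure (saddleBox l))) where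
  isOpen := isOpen_saddleBox l
  bounded := isBounded_saddleBox hl
  covers := closure_saddleBox_subset_image hl (isClose_self l _)
  eq := rfl
  robust := by
    set N : Set (ℂ × ℂ) := Metric.ball 0 2 ×ˢ Metric.ball 0 4 with hN
    set K : Set (ℂ × ℂ) := Metric.closedBall 0 1 ×ˢ Metric.closedBall 0 2 with hK
    have hNo : IsOpen N := Metric.isOpen_ball.prod Metric.isOpen_ball
    have hball : ∀ x ∈ K, Metric.ball x 1 ⊆ N := by
      rintro ⟨z, w⟩ ⟨hz, hw⟩ ⟨z', w'⟩ h
      rw [← ball_prod_same] at h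
      have h1 := mem_ball_iff_norm.1 h.1
      have h2 := mem_ball_iff_norm.1 h.2
      have h3 := mem_closedBall_zero_iff.1 hz
      have h4 := mem_closedBall_zero_iff.1 hw
      have h5 := norm_add_le (z' - z) z
      have h6 := norm_add_le (w' - w) w
      rw [sub_add_cancel] at h5 h6
      exact ⟨mem_ball_zero_iff.2 (by linarith), mem_ball_zero_iff.2 (by linarith)⟩
    have hKN : K ⊆ N := fun x hx => hball x hx (Metric.mem_ball_self one_pos)
    have hZK := closure_saddleBox_subset hl
    refine ⟨N, hNo, hZK.trans hKN, (differentiable_G l).differentiableOn, 1 / 10 ^ 5, by norm_num,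
      fun g hg hclose => ?_⟩
    have hd : ∀ x ∈ N, DifferentiableAt ℂ g x := fun x hx =>
      hg.differentiableAt (hNo.mem_nhds hx)
    -- Every point of K has a unit ball inside N, so the Cauchy estimate on radius 1/2 turns uniform
    -- closeness into closeness of derivatives.
    have hfd : ∀ x ∈ K, ‖fderiv ℂ g x - fderiv ℂ (G l) x‖ ≤ 1 / 10 ^ 4 := by
      intro x hx
      have := norm_fderiv_le_of_forall_norm_le (h := g - G l) (x := x) (r := 1 / 2)
        (R := 1) (M := 1 / 10 ^ 5) (by norm_num) (by norm_num)
        ((hg.mono (hball x hx)).sub (differentiable_G l).differentiableOn)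
        (fun y hy => hclose y (hball x hx hy))
      rw [((hd x (hKN hx)).hasFDerivAt.sub (differentiable_G l x).hasFDerivAt).fderiv] at this
      exact this.trans (by norm_num)
    have hKc : IsClose l g K := isClose_of_fderiv
      ((convex_closedBall _ _).prod (convex_closedBall _ _)) (fun x hx => hd x (hKN hx))
      (fun x hx => (hclose x (hKN hx)).trans (by norm_num)) hfd
    set L := staySet g (closure (saddleBox l)) with hL
    have hLZ : L ⊆ closure (saddleBox l) := staySet_subset _ _
    refine isHyperbolicSet_one
      (isCompact_staySet (isBounded_saddleBox hl).isCompact_closure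
        (hg.continuousOn.mono (hZK.trans hKN)))
      (image_staySet_saddleBox hl hKc)
      (fun x hx => eventually_of_mem (hNo.mem_nhds (hKN (hZK (hLZ hx)))) hd)
      ((continuousOn_fderiv hNo hg).mono (hLZ.trans (hZK.trans hKN))) fun x hx => ?_
    have hxK := hZK (hLZ hx)
    have hx2 := hLZ hx
    rw [closure_saddleBox, closure_iUnion_nbh] at hx2
    obtain ⟨i, hi⟩ := mem_iUnion.1 hx2.2
    obtain ⟨h1, -, h2, -⟩ := near_sPt hl hi
    have h3 := norm_offDiagonal_le (z := x.1) (w := x.2)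
      ((mem_closedBall_zero_iff.1 hx2.1).trans (by norm_num)) h1
    have h4 := norm_deriv_large (isTriple_sPt.pow i) hl hi
    have hv : ∀ v : ℂ × ℂ, ‖v‖ = 1 → ‖(fderiv ℂ g x v).1 - (fderiv ℂ (G l) x v).1‖ ≤ 1 / 10 ^ 4 ∧
        ‖(fderiv ℂ g x v).2 - (fderiv ℂ (G l) x v).2‖ ≤ 1 / 10 ^ 4 := by
      intro v hv
      have := (fderiv ℂ g x - fderiv ℂ (G l) x).le_opNorm v
      rw [hv, mul_one, sub_apply] at this
      have := this.trans (hfd x hxK)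
      exact ⟨(norm_fst_le _).trans this, (norm_snd_le _).trans this⟩
    have e1 := hv (1, 0) (by simp)
    have e2 := hv (0, 1) (by simp)
    rw [fderiv_G] at e1 e2
    simp only [mul_one, mul_zero, add_zero, zero_add, sub_zero] at e1 e2
    have t1 := norm_sub_norm_le (fderiv ℂ g x (1, 0)).1 (cA x.2)
    have t2 := norm_sub_norm_le (fderiv ℂ g x (0, 1)).1
      (3 * x.2 ^ 2 / 100 * x.1 + (12 * x.2 ^ 3 + 2) / 50)
    have t3 := norm_sub_norm_le (7 ^ l * x.2 ^ (7 ^ l - 1)) (fderiv ℂ g x (0, 1)).2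
    rw [norm_sub_rev] at t3
    exact ⟨by linarith [e1.1], by linarith [e1.2], by linarith [e2.1], by linarith [e2.2]⟩

/-- One forward iterate suffices: a boundary point of a base neighbourhood is not mapped back into
the closure of their union. -/
lemma staySet_saddleBox_subset {l : ℕ} (hl : 20 ≤ l) :
    staySet (G l) (closure (saddleBox l))
      ⊆ Metric.closedBall 0 (1 / 4) ×ˢ ⋃ i, nbh (sPt i) l := by
  intro x hx
  have h0 := hx 0
  have h1 := hx 1
  rw [closure_saddleBox] at h0 h1
  rw [Function.iterate_one, G_apply] at h1
  refine ⟨h0.1, ?_⟩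
  have h2 := h0.2
  rw [closure_iUnion_nbh] at h2
  obtain ⟨i, hi⟩ := mem_iUnion.1 h2
  exact mem_iUnion.2 ⟨i, isTriple_sPt.mem_nbh hl hi h1.2⟩

lemma staySet_saddleBox_subset_maxInvSet {l : ℕ} (hl : 20 ≤ l) :
    staySet (G l) (closure (saddleBox l)) ⊆ maxInvSet (G l) (⋃ i, pieces sPt l i) := by
  have h := image_staySet_saddleBox hl (isClose_self l _)
  refine subset_maxInvSet h.symm.subset h.subset ((staySet_saddleBox_subset hl).trans ?_)
  rw [iUnion_pieces]
  exact prod_mono (Metric.closedBall_subset_ball (by norm_num)) le_rfl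

end Blender

namespace Blender

open Set Filter Topology

/-! ### The repelling blender -/

/-- The horizontal discs of the repelling blender. -/
def HSet (i : Fin 3) : Set ℂ := {z | ‖z‖ < 1 ∧ ‖101 / 100 * z + rPt i / 10‖ < 97 / 100}

lemma HSet_eq (i : Fin 3) : HSet i = Metric.ball 0 1 ∩
    LinearMap.mulLeft ℝ (101 / 100 : ℂ) ⁻¹' Metric.ball (-(rPt i / 10)) (97 / 100) := by
  ext z
  rw [mem_inter_iff, mem_ball_zero_iff, mem_preimage, mem_ball_iff_norm, sub_neg_eq_add]
  rfl

lemma isOpen_HSet (i : Fin 3) : IsOpen (HSet i) := by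
  rw [HSet_eq]
  exact Metric.isOpen_ball.inter
    (Metric.isOpen_ball.preimage (continuous_const.mul continuous_id))

lemma convex_HSet (i : Fin 3) : Convex ℝ (HSet i) := by
  rw [HSet_eq]
  exact (convex_ball _ _).inter ((convex_ball _ _).linear_preimage _)

lemma ball_half_subset_HSet (i : Fin 3) : Metric.ball 0 (1 / 2) ⊆ HSet i := by
  intro z hz
  rw [mem_ball_zero_iff] at hz
  refine ⟨by linarith, ?_⟩
  have := norm_add_le (101 / 100 * z) (rPt i / 10)
  rw [norm_mul, norm_div (rPt i), norm_eq_one_of_pow_six (isTriple_rPt.pow i),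
    show ‖(101 / 100 : ℂ)‖ = 101 / 100 by norm_num, show ‖(10 : ℂ)‖ = 10 by simp] at this
  linarith

lemma exists_sector_rPt {y : ℂ} {c d : ℝ} (hy : ‖y‖ ≤ c) (hc : 1 / 10 ≤ c) (hd0 : 0 ≤ d)
    (hd : c ^ 2 - c / 10 + 1 / 100 ≤ d ^ 2) : ∃ j, ‖y + rPt j / 10‖ ≤ d := by
  obtain ⟨j, hj⟩ := isTriple_rPt.sector y (1 / 10) (by norm_num)
  refine ⟨j, abs_le_of_sq_le_sq' ?_ hd0 |>.2⟩
  have e : y + ((1 / 10 : ℝ) : ℂ) * rPt j = y + rPt j / 10 := by push_cast; ring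
  rw [e] at hj
  nlinarith [norm_nonneg y]

/-- For |z| < 1 the sector property bounds some |(101/100) z + r_j/10| by 965/1000, and `HSet` only
asks for less than 97/100. -/
lemma iUnion_HSet : ⋃ i, HSet i = Metric.ball 0 1 := by
  refine (iUnion_subset fun i z hz => mem_ball_zero_iff.2 hz.1).antisymm fun z hz => ?_
  rw [mem_ball_zero_iff] at hz
  obtain ⟨j, hj⟩ := exists_sector_rPt (y := 101 / 100 * z) (c := 101 / 100) (d := 965 / 1000)
    (by
      rw [norm_mul, show ‖(101 / 100 : ℂ)‖ = 101 / 100 by norm_num]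
      linarith) (by norm_num) (by norm_num) (by norm_num)
  exact mem_iUnion.2 ⟨j, hz, by linarith⟩

/-- The domain of the repelling blender. -/
abbrev repBox (l : ℕ) : Set (ℂ × ℂ) := boxes HSet fun i => nbh (rPt i) l

lemma isOpen_repBox (l : ℕ) : IsOpen (repBox l) :=
  isOpen_iUnion fun i => (isOpen_HSet i).prod (isOpen_nbh (isTriple_rPt.pow i) l)

/-- The image under a map near `G` of the point of `HSet i × nbh (rPt i) l` is controlled. -/
lemma norm_G_fst_sub_of_mem {l : ℕ} (hl : 20 ≤ l) {i : Fin 3} {x : ℂ × ℂ} (hx1 : ‖x.1‖ ≤ 1)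
    (hx2 : x.2 ∈ nbh (rPt i) l) :
    ‖(G l x).1 - (101 / 100 * x.1 + rPt i / 10)‖ ≤ 1 / 10 ^ 9 := by
  obtain ⟨-, -, h1, h2, -⟩ := near_rPt hl (subset_closure hx2)
  have e : (G l x).1 - (101 / 100 * x.1 + rPt i / 10)
      = (cA x.2 - 101 / 100) * x.1 + (cB x.2 - rPt i / 10) := by rw [G_apply]; ring
  rw [e]
  refine (norm_add_le _ _).trans ?_
  rw [norm_mul]
  have : ‖cA x.2 - 101 / 100‖ * ‖x.1‖ ≤ 1 / 10 ^ 10 * 1 := by gcongr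
  linarith

/-- The part of a neighbourhood over which vertical graphs are followed. -/
noncomputable def core (l : ℕ) (i : Fin 3) : Set ℂ := Metric.closedBall (rPt i) (9 / 4 / 7 ^ l)

lemma core_subset_nbh {l : ℕ} (hl : 20 ≤ l) (i : Fin 3) : core l i ⊆ nbh (rPt i) l :=
  closedBall_subset_nbh (isTriple_rPt.pow i) hl

lemma rPt_mem_core (l : ℕ) (i : Fin 3) : rPt i ∈ core l i :=
  Metric.mem_closedBall_self (by positivity)

lemma norm_sub_le_of_mem_core {l : ℕ} (hl : 20 ≤ l) {i : Fin 3} {w : ℂ} (hw : w ∈ core l i) :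
    ‖w - rPt i‖ ≤ 1 / 10 ^ 14 := (mem_closedBall_iff_norm.1 hw).trans (radius_le hl)

/-- Lipschitz vertical graphs over `core l i` in `HSet i`. -/
def IsGoodGraph (l : ℕ) (i : Fin 3) (σ : ℂ → ℂ) : Prop :=
  MapsTo σ (core l i) (HSet i) ∧ ∀ w ∈ core l i, ∀ w' ∈ core l i, ‖σ w - σ w'‖ ≤ ‖w - w'‖

/-- The graph of `σ` over `core l i`. -/
def graphOver (l : ℕ) (i : Fin 3) (σ : ℂ → ℂ) : Set (ℂ × ℂ) := (fun w => (σ w, w)) '' core l i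

lemma IsGoodGraph.isCompact {l : ℕ} {i : Fin 3} {σ : ℂ → ℂ} (h : IsGoodGraph l i σ) :
    IsCompact (graphOver l i σ) := by
  refine (isCompact_closedBall _ _).image_of_continuousOn (ContinuousOn.prodMk ?_ continuousOn_id)
  have : LipschitzOnWith 1 σ (core l i) := LipschitzOnWith.of_dist_le_mul fun w hw w' hw' => by
    rw [dist_eq_norm, dist_eq_norm, NNReal.coe_one, one_mul]
    exact h.2 w hw w' hw'
  exact this.continuousOn

lemma IsGoodGraph.subset {l : ℕ} {i : Fin 3} {σ : ℂ → ℂ} (h : IsGoodGraph l i σ) :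
    graphOver l i σ ⊆ HSet i ×ˢ core l i := by
  rintro _ ⟨w, hw, rfl⟩
  exact ⟨h.1 hw, hw⟩

lemma prod_core_subset_repBox {l : ℕ} (hl : 20 ≤ l) (i : Fin 3) :
    HSet i ×ˢ core l i ⊆ repBox l := fun _ hx =>
  mem_iUnion.2 ⟨i, hx.1, core_subset_nbh hl i hx.2⟩

/-- Maps close to `G` map a good graph over a good graph. -/
lemma IsGoodGraph.exists_image {l : ℕ} (hl : 20 ≤ l) {g : ℂ × ℂ → ℂ × ℂ} {i : Fin 3} {σ : ℂ → ℂ}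
    (h : IsGoodGraph l i σ) (hg : IsClose l g (HSet i ×ˢ core l i)) :
    ∃ j σ', IsGoodGraph l j σ' ∧ graphOver l j σ' ⊆ g '' graphOver l i σ := by
  have hr := radius_le hl
  have h8 := eight_div_le hl
  set E : ℂ × ℂ → ℂ × ℂ := fun x => g x - G l x with hE
  have hmem : ∀ w ∈ core l i, (σ w, w) ∈ HSet i ×ˢ core l i := fun w hw => ⟨h.1 hw, hw⟩
  have hE0 : ∀ w ∈ core l i, ‖(E (σ w, w)).1‖ ≤ 1 / 10 ^ 4 ∧ ‖(E (σ w, w)).2‖ ≤ 1 / 10 ^ 4 :=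
    fun w hw => ⟨(norm_fst_le _).trans (hg.1 _ (hmem w hw)),
      (norm_snd_le _).trans (hg.1 _ (hmem w hw))⟩
  have hgr : ∀ w ∈ core l i, ∀ w' ∈ core l i,
      ‖((σ w, w) : ℂ × ℂ) - (σ w', w')‖ ≤ ‖w - w'‖ := fun w hw w' hw' => by
    rw [Prod.norm_def]
    exact max_le (h.2 w hw w' hw') le_rfl
  have hE1 : ∀ w ∈ core l i, ∀ w' ∈ core l i,
      ‖(E (σ w, w)).1 - (E (σ w', w')).1‖ ≤ 1 / 10 ^ 4 * ‖w - w'‖ ∧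
      ‖(E (σ w, w)).2 - (E (σ w', w')).2‖ ≤ 1 / 10 ^ 4 * ‖w - w'‖ := by
    intro w hw w' hw'
    have h1 := (hg.2 _ (hmem w hw) _ (hmem w' hw')).trans
      (mul_le_mul_of_nonneg_left (hgr w hw w' hw') (by norm_num))
    exact ⟨(norm_fst_le (E (σ w, w) - E (σ w', w'))).trans h1,
      (norm_snd_le (E (σ w, w) - E (σ w', w'))).trans h1⟩
  have hp := h.1 (rPt_mem_core l i)
  set z := 101 / 100 * σ (rPt i) + rPt i / 10 with hz
  -- The number z is the model image of the centre of the graph, with |z| < 97/100. The next symbol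
  -- j is chosen with bound 935/1000 instead of 97/100; this slack absorbs the oscillation of the
  -- graph and the perturbation.
  obtain ⟨j, hj⟩ := exists_sector_rPt (y := 101 / 100 * z) (c := 98 / 100) (d := 935 / 1000)
    (by
      rw [norm_mul, show ‖(101 / 100 : ℂ)‖ = 101 / 100 by norm_num]
      linarith [hp.2]) (by norm_num) (by norm_num) (by norm_num)
  obtain ⟨ψ, hψ, hψL⟩ := isTriple_rPt.exists_branch hl i j
  have hdom : ∀ u ∈ core l j, ∀ w ∈ core l i, ‖u - (E (σ w, w)).2 - rPt j‖ ≤ 1 / 100 := by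
    intro u hu w hw
    rw [sub_right_comm]
    have := norm_sub_le (u - rPt j) (E (σ w, w)).2
    linarith [(hE0 w hw).2, norm_sub_le_of_mem_core hl hu]
  -- For each target u, a contraction locates the point of the old graph whose image has base
  -- coordinate u.
  have hex : ∀ u ∈ core l j, ∃ w ∈ core l i, ψ (u - (E (σ w, w)).2) = w := by
    intro u hu
    refine exists_fixed_point (s := core l i) (T := fun w => ψ (u - (E (σ w, w)).2))
      Metric.isClosed_closedBall.isComplete ⟨_, rPt_mem_core l i⟩
      (fun w hw => mem_closedBall_iff_norm.2 (hψ _ (hdom u hu w hw)).2) (c := 1 / 2) (by norm_num)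
      (by norm_num) (fun w hw w' hw' => ?_)
    have h1 := hψL _ _ (hdom u hu w hw) (hdom u hu w' hw')
    rw [sub_sub_sub_cancel_left] at h1
    have h2 := (hE1 w' hw' w hw).2
    rw [norm_sub_rev w'] at h2
    rw [dist_eq_norm, dist_eq_norm]
    have hn := norm_nonneg (w - w')
    calc _ ≤ 8 / 7 ^ l * ‖(E (σ w', w')).2 - (E (σ w, w)).2‖ := h1
      _ ≤ 1 / 10 ^ 14 * (1 / 10 ^ 4 * ‖w - w'‖) := by gcongr
      _ ≤ 1 / 2 * ‖w - w'‖ := by linarith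
  choose! ω hω hωψ using hex
  -- Base expansion makes this reparametrisation 1/100-Lipschitz, so the new graph has slope of
  -- about 6/100, again below 1.
  have hωL : ∀ u ∈ core l j, ∀ u' ∈ core l j, ‖ω u - ω u'‖ ≤ 1 / 100 * ‖u - u'‖ := by
    intro u hu u' hu'
    have h1 := hψL _ _ (hdom u hu _ (hω u hu)) (hdom u' hu' _ (hω u' hu'))
    rw [hωψ u hu, hωψ u' hu', sub_sub_sub_comm] at h1
    have h2 := (norm_sub_le (u - u') ((E (σ (ω u), ω u)).2 - (E (σ (ω u'), ω u')).2)).trans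
      (add_le_add_right (hE1 _ (hω u hu) _ (hω u' hu')).2 _)
    have h3 := norm_nonneg (u - u')
    have h4 := norm_nonneg (ω u - ω u')
    have h5 : ‖ω u - ω u'‖ ≤ 1 / 10 ^ 14 * (‖u - u'‖ + 1 / 10 ^ 4 * ‖ω u - ω u'‖) := by
      refine h1.trans ?_
      gcongr
    linarith
  have hgE : ∀ x, g x = G l x + E x := fun x => by rw [hE]; simp
  refine ⟨j, fun u => (g (σ (ω u), ω u)).1, ⟨fun u hu => ?_, fun u hu u' hu' => ?_⟩, ?_⟩
  · have hω' := hω u hu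
    have h1 := norm_G_fst_sub_of_mem hl (x := (σ (ω u), ω u)) (h.1 hω').1.le
      (core_subset_nbh hl i hω')
    have h2 := h.2 _ hω' _ (rPt_mem_core l i)
    have h3 := norm_sub_le_of_mem_core hl hω'
    have h4 := (hE0 _ hω').1
    have e : (g (σ (ω u), ω u)).1 - z
        = ((G l (σ (ω u), ω u)).1 - (101 / 100 * σ (ω u) + rPt i / 10))
          + 101 / 100 * (σ (ω u) - σ (rPt i)) + (E (σ (ω u), ω u)).1 := by
      rw [hgE, Prod.fst_add, hz]; ring
    have h5 : ‖(g (σ (ω u), ω u)).1 - z‖ ≤ 2 / 10 ^ 4 := by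
      rw [e]
      refine norm_add₃_le.trans ?_
      rw [norm_mul, show ‖(101 / 100 : ℂ)‖ = 101 / 100 by norm_num]
      simp only at h1
      linarith
    have h6 := norm_add_le ((g (σ (ω u), ω u)).1 - z) z
    rw [sub_add_cancel] at h6
    have hz97 : ‖z‖ < 97 / 100 := hp.2
    refine ⟨by linarith, ?_⟩
    have e2 : 101 / 100 * (g (σ (ω u), ω u)).1 + rPt j / 10
        = 101 / 100 * ((g (σ (ω u), ω u)).1 - z) + (101 / 100 * z + rPt j / 10) := by ring
    rw [e2]
    refine (norm_add_le _ _).trans_lt ?_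
    rw [norm_mul, show ‖(101 / 100 : ℂ)‖ = 101 / 100 by norm_num]
    linarith
  · have hω1 := hω u hu
    have hω2 := hω u' hu'
    have b : ∀ w ∈ core l i, ‖w‖ ≤ 2 := fun w hw => by
      linarith [(near_rPt hl (subset_closure (core_subset_nbh hl i hw))).1]
    have h1 := norm_G_fst_sub_le l (x := (σ (ω u), ω u)) (y := (σ (ω u'), ω u')) (b _ hω1)
      (h.1 hω2).1.le (b _ hω2)
    have h2 := h.2 _ hω1 _ hω2
    have h3 := (hE1 _ hω1 _ hω2).1
    have h4 := hωL u hu u' hu'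
    have h5 := norm_nonneg (u - u')
    simp only at h1 ⊢
    rw [hgE, hgE, Prod.fst_add, Prod.fst_add, add_sub_add_comm]
    refine (norm_add_le _ _).trans ?_
    linarith
  · rintro _ ⟨u, hu, rfl⟩
    refine ⟨_, ⟨ω u, hω u hu, rfl⟩, Prod.ext rfl ?_⟩
    simp only
    rw [hgE, Prod.snd_add, G_apply]
    have := (hψ _ (hdom u hu _ (hω u hu))).1
    rw [hωψ u hu] at this
    simp only
    rw [this, sub_add_cancel]

/-- Good graphs contain points whose orbit never leaves the domain of the blender. -/
lemma IsGoodGraph.exists_mem_staySet {l : ℕ} (hl : 20 ≤ l) {g : ℂ × ℂ → ℂ × ℂ}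
    (hcont : ContinuousOn g (repBox l)) (hg : ∀ i, IsClose l g (HSet i ×ˢ core l i)) {i : Fin 3}
    {σ : ℂ → ℂ} (h : IsGoodGraph l i σ) : ∃ w ∈ core l i, (σ w, w) ∈ staySet g (repBox l) := by
  obtain ⟨_, ⟨w, hw, rfl⟩, hx⟩ := Blender.exists_mem_staySet
    (G := {D | ∃ i σ, IsGoodGraph l i σ ∧ D = graphOver l i σ}) hcont
    (by rintro _ ⟨i, σ, h, rfl⟩; exact h.subset.trans (prod_core_subset_repBox hl i))
    (by rintro _ ⟨i, σ, h, rfl⟩; exact h.isCompact)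
    (by rintro _ ⟨i, σ, h, rfl⟩; exact ⟨_, _, rPt_mem_core l i, rfl⟩)
    (by
      rintro _ ⟨i, σ, h, rfl⟩
      obtain ⟨j, σ', h', hs⟩ := h.exists_image hl (hg i)
      exact ⟨_, ⟨j, σ', h', rfl⟩, hs⟩) ⟨i, σ, h, rfl⟩
  exact ⟨w, hw, hx⟩

lemma closure_repBox_subset (l : ℕ) : closure (repBox l)
    ⊆ Metric.closedBall 0 1 ×ˢ closure (⋃ i, nbh (rPt i) l) := by
  refine closure_minimal (iUnion_subset fun i => prod_mono (fun z hz => ?_)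
    ((subset_iUnion (fun i => nbh (rPt i) l) i).trans subset_closure))
    (Metric.isClosed_closedBall.prod isClosed_closure)
  exact mem_closedBall_zero_iff.2 hz.1.le

lemma staySet_repBox_subset {l : ℕ} (hl : 20 ≤ l) : staySet (G l) (closure (repBox l))
    ⊆ Metric.closedBall 0 1 ×ˢ ⋃ i, nbh (rPt i) l := by
  intro x hx
  have h0 := closure_repBox_subset l (hx 0)
  have h1 := closure_repBox_subset l (hx 1)
  rw [Function.iterate_one, G_apply] at h1
  refine ⟨h0.1, ?_⟩
  have h2 := h0.2
  rw [closure_iUnion_nbh] at h2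
  obtain ⟨i, hi⟩ := mem_iUnion.1 h2
  exact mem_iUnion.2 ⟨i, isTriple_rPt.mem_nbh hl hi h1.2⟩

/-- Inverse fibre maps preserve the disc of radius 20, since 20 + 1009/10000 is less than 20 times
1009/1000, and the base neighbourhood of r_0 alone already covers. -/
lemma pieces_rPt_subset_image {l : ℕ} (hl : 20 ≤ l) :
    ⋃ i, pieces rPt l i ⊆ G l '' ⋃ i, pieces rPt l i := by
  rw [iUnion_pieces]
  rintro ⟨z, u⟩ ⟨hz, hu⟩
  obtain ⟨w, hw, rfl⟩ := isTriple_rPt.closure_subset hl 0 (subset_closure hu)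
  obtain ⟨-, h1, -, -, h2⟩ := near_rPt hl (subset_closure hw)
  have hne : cA w ≠ 0 := fun h => by
    rw [h, norm_zero] at h1
    linarith
  rw [mem_ball_zero_iff] at hz
  refine ⟨((z - cB w) / cA w, w), ⟨?_, mem_iUnion.2 ⟨0, hw⟩⟩, ?_⟩
  · rw [mem_ball_zero_iff, norm_div, div_lt_iff₀ (by linarith)]
    linarith [norm_sub_le z (cB w)]
  · rw [G_apply]
    simp only
    rw [mul_div_cancel₀ _ hne, sub_add_cancel]

/-- The blender set is defined by forward orbits only. The missing pasts are found in the larger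
pieces, whose forward-staying set is mapped onto itself. -/
lemma staySet_repBox_subset_maxInvSet {l : ℕ} (hl : 20 ≤ l) :
    staySet (G l) (closure (repBox l)) ⊆ maxInvSet (G l) (⋃ i, pieces rPt l i) := by
  have h : staySet (G l) (closure (repBox l)) ⊆ staySet (G l) (⋃ i, pieces rPt l i) := by
    intro x hx n
    rw [iUnion_pieces]
    have : (G l)^[n] x ∈ staySet (G l) (closure (repBox l)) := fun k => by
      rw [← Function.iterate_add_apply]; exact hx _
    exact prod_mono (Metric.closedBall_subset_ball (by norm_num)) le_rfl
      (staySet_repBox_subset hl this)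
  refine h.trans (subset_maxInvSet (staySet_subset_image ?_) (image_staySet_subset _ _)
    (staySet_subset _ _))
  exact (staySet_subset _ _).trans (pieces_rPt_subset_image hl)

lemma isRepellingBlender {l : ℕ} (hl : 20 ≤ l) :
    IsRepellingBlender (G l) HSet (fun i => nbh (rPt i) l) 1
      (staySet (G l) (closure (repBox l))) where
  isOpen_left := isOpen_HSet
  isOpen_right i := isOpen_nbh (isTriple_rPt.pow i) l
  pos := one_pos
  holo := (differentiable_G l).differentiableOn
  skew := ⟨fun x => (G l x).1, q^[l], fun x _ => Prod.ext rfl (by rw [G_apply])⟩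
  maps := by
    -- Each `HSet i` is sent within 97/100 by the model map, and the actual map differs from it by
    -- at most 10^(-9).
    refine ⟨Metric.closedBall 0 (98 / 100), isCompact_closedBall _ _, ?_, fun x hx => ?_⟩
    · rw [iUnion_HSet]
      exact Metric.closedBall_subset_ball (by norm_num)
    · obtain ⟨i, hi⟩ := mem_iUnion.1 hx
      have h1 := norm_G_fst_sub_of_mem hl hi.1.1.le hi.2
      have h2 := hi.1.2
      have h3 := norm_add_le ((G l x).1 - (101 / 100 * x.1 + rPt i / 10))
        (101 / 100 * x.1 + rPt i / 10)
      rw [sub_add_cancel] at h3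
      rw [mem_closedBall_zero_iff]
      linarith
  cone := by
    refine ⟨1 / 2, by norm_num, by norm_num, fun x hx v hv => ?_⟩
    obtain ⟨i, hi⟩ := mem_iUnion.1 hx
    have hcl := subset_closure hi.2
    obtain ⟨h1, -⟩ := near_rPt hl hcl
    have h2 := norm_cA_le (w := x.2) (by linarith)
    have h3 := norm_offDiagonal_le (z := x.1) (w := x.2) (by linarith [hi.1.1]) h1
    have h4 := norm_deriv_large (isTriple_rPt.pow i) hl hcl
    rw [one_mul] at hv
    have hpos := (norm_nonneg v.1).trans_lt hv
    rw [fderiv_G]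
    simp only
    rw [norm_mul (_ * _ : ℂ) v.2]
    calc _ ≤ 2 * ‖v.1‖ + 199 / 100 * ‖v.2‖ := by
          refine (norm_add_le _ _).trans ?_
          rw [norm_mul, norm_mul]
          gcongr
      _ < 1 / 2 * (10 ^ 14 * ‖v.2‖) := by linarith
      _ ≤ _ := by gcongr
  eq := rfl
  robust := by
    refine ⟨1 / 10 ^ 4, by norm_num, fun g hg hclose i σ hσ hmaps hder => ?_⟩
    have hsub := fun i => prod_core_subset_repBox hl i
    have hgc : ∀ i, IsClose l g (HSet i ×ˢ core l i) := fun i =>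
      isClose_of_fderiv ((convex_HSet i).prod (convex_closedBall _ _))
        (fun x hx => hg.differentiableAt ((isOpen_repBox l).mem_nhds (hsub i hx)))
        (fun x hx => (hclose x (hsub i hx)).1) (fun x hx => (hclose x (hsub i hx)).2)
    have hcore := core_subset_nbh hl i
    have hgood : IsGoodGraph l i σ := by
      refine ⟨fun w hw => hmaps (hcore hw), fun w hw w' hw' => ?_⟩
      have := (convex_closedBall (rPt i) (9 / 4 / 7 ^ l)).norm_image_sub_le_of_norm_deriv_le
        (f := σ) (C := 1) (fun w hw => hσ.differentiableAt
          ((isOpen_nbh (isTriple_rPt.pow i) l).mem_nhds (hcore hw)))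
        (fun w hw => (hder w (hcore hw)).le) hw' hw
      rwa [one_mul] at this
    obtain ⟨w, hw, h⟩ := hgood.exists_mem_staySet hl hg.continuousOn hgc
    exact ⟨w, hcore hw, h⟩
  repelling := ⟨_, (isBasicSet_rPt hl).1, staySet_repBox_subset_maxInvSet hl⟩

end Blender

namespace Blender

open Set Filter Topology

/-! ### Unstable manifolds of the saddle blender -/

/-- Each backward step adds an error of at most 3e from `cA` and 3e from `cB`, and the contraction
991/1000 sums these to 6e / (9/1000). -/
lemma norm_sub_le_of_affine {w w' Z Z' : ℕ → ℂ} {e : ℝ}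
    (hA : ∀ k, ‖cA (w k)‖ ≤ 991 / 1000) (hw : ∀ k, ‖w k‖ ≤ 2) (hw' : ∀ k, ‖w' k‖ ≤ 2)
    (hZ : ∀ k, ‖Z k‖ ≤ 3) (hZ' : ∀ k, ‖Z' k‖ ≤ 3) (he : ∀ k, ‖w k - w' k‖ ≤ e)
    (h : ∀ k, Z k = cA (w k) * Z (k + 1) + cB (w k))
    (h' : ∀ k, Z' k = cA (w' k) * Z' (k + 1) + cB (w' k)) : ‖Z 0 - Z' 0‖ ≤ 1000 * e := by
  have he0 : 0 ≤ e := (norm_nonneg _).trans (he 0)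
  refine (le_div_of_bounded_recursion (d := fun k => ‖Z k - Z' k‖) (c := 991 / 1000)
    (e := 6 * e) (M := 6) (by norm_num) (by norm_num)
    (fun k => (norm_sub_le _ _).trans (by linarith [hZ k, hZ' k])) fun k => ?_).trans ?_
  · have e1 : Z k - Z' k = cA (w k) * (Z (k + 1) - Z' (k + 1))
        + (cA (w k) - cA (w' k)) * Z' (k + 1) + (cB (w k) - cB (w' k)) := by
      rw [h k, h' k]; ring
    have h1 : ‖cA (w k) - cA (w' k)‖ ≤ e := (norm_cA_sub_le (hw k) (hw' k)).trans (he k)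
    have h2 : ‖cB (w k) - cB (w' k)‖ ≤ 3 * e :=
      (norm_cB_sub_le (hw k) (hw' k)).trans (by linarith [he k])
    have h3 : ‖cA (w k) - cA (w' k)‖ * ‖Z' (k + 1)‖ ≤ e * 3 := by gcongr; exact hZ' _
    have h4 : ‖cA (w k)‖ * ‖Z (k + 1) - Z' (k + 1)‖ ≤ 991 / 1000 * ‖Z (k + 1) - Z' (k + 1)‖ := by
      gcongr; exact hA k
    rw [e1]
    refine norm_add₃_le.trans ?_
    rw [norm_mul, norm_mul]
    linarith
  · rw [div_le_iff₀ (by norm_num)]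
    linarith

/-- The unstable manifold of a history near the points `sPt i` projects onto a neighbourhood of
some point `rPt j`: the histories of points of `core l j` that follow a given history. -/
lemma exists_base_histories {l : ℕ} (hl : 20 ≤ l) {b : ℕ → ℂ} {i : ℕ → Fin 3}
    (hb : ∀ k, b k ∈ nbh (sPt (i k)) l) (hq : ∀ k, q^[l] (b (k + 1)) = b k) :
    ∃ (j : Fin 3) (w : ℕ → ℂ → ℂ), ∀ u ∈ core l j, w 0 u = u ∧
      (∀ k, q^[l] (w (k + 1) u) = w k u ∧ w (k + 1) u ∈ nbh (sPt (i (k + 1))) l ∧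
        ‖w (k + 1) u - b (k + 1)‖ ≤ 1 / 10 ^ 13 * (1 / 100) ^ k) ∧
      ∀ u' ∈ core l j, ∀ k, ‖w (k + 1) u - w (k + 1) u'‖ ≤ 1 / 10 ^ 14 * ‖u - u'‖ := by
  -- Choosing j different from the symbol at time -1 makes the connecting angle ±π/3 rather than π,
  -- as the inverse branch requires.
  obtain ⟨j, hj⟩ : ∃ j, i 1 ≠ j := ⟨i 1 + 1, by generalize i 1 = m; revert m; decide⟩
  have hr := radius_le hl
  have h8 := eight_div_le hl
  -- Centres of the lifted histories: the endpoint lies near r_j, whereas all earlier points follow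
  -- the given history near the s_i.
  set c : ℕ → ℂ := fun k => Nat.casesOn k (rPt j) fun k => sPt (i (k + 1)) with hc
  have hex : ∀ k, ∃ ψ : ℂ → ℂ,
      (∀ u, ‖u - c k‖ ≤ 1 / 100 → q^[l] (ψ u) = u ∧ ‖ψ u - c (k + 1)‖ ≤ 9 / 4 / 7 ^ l) ∧
      ∀ u u', ‖u - c k‖ ≤ 1 / 100 → ‖u' - c k‖ ≤ 1 / 100 →
        ‖ψ u - ψ u'‖ ≤ 8 / 7 ^ l * ‖u - u'‖ := by
    rintro (_ | k)
    · obtain ⟨θ, -, -, hθ, h⟩ := sPt_rPt_ratio (i 1) j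
      exact exists_inverse_branch (isTriple_sPt.pow _) h (hθ hj) hl
    · exact isTriple_sPt.exists_branch hl (i (k + 2)) (i (k + 1))
  choose Ψ hΨ hΨL using hex
  set w : ℕ → ℂ → ℂ := fun k u => Nat.rec u (fun k v => Ψ k v) k with hw
  have hwc : ∀ u ∈ core l j, ∀ k, ‖w k u - c k‖ ≤ 9 / 4 / 7 ^ l := by
    intro u hu k
    induction k with
    | zero => exact mem_closedBall_iff_norm.1 hu
    | succ k ih => exact (hΨ k (w k u) (by linarith)).2
  have hwc' : ∀ u ∈ core l j, ∀ k, ‖w k u - c k‖ ≤ 1 / 100 := fun u hu k => by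
    linarith [hwc u hu k]
  have hbc : ∀ k, ‖b (k + 1) - c (k + 1)‖ ≤ 1 / 10 ^ 14 := fun k =>
    norm_sub_le_of_mem_closure (isTriple_sPt.pow _) hl (subset_closure (hb (k + 1)))
  have hmem : ∀ (k : ℕ) (v : ℂ), ‖v - c (k + 1)‖ ≤ 9 / 4 / 7 ^ l →
      v ∈ nbh (sPt (i (k + 1))) l := fun k v hv =>
    closedBall_subset_nbh (isTriple_sPt.pow _) hl (mem_closedBall_iff_norm.2 hv)
  -- Injectivity of `q^[l]` on the neighbourhood shows that the chosen branches also pull the given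
  -- history back along itself, whence the geometric convergence.
  have hΨb : ∀ k, Ψ (k + 1) (b (k + 1)) = b (k + 2) := by
    intro k
    obtain ⟨h1, h2⟩ := hΨ (k + 1) (b (k + 1)) (by linarith [hbc k])
    exact q_iterate_injOn_closure_nbh (isTriple_sPt.pow _) l
      (subset_closure (hmem (k + 1) _ h2)) (subset_closure (hb (k + 2))) (h1.trans (hq _).symm)
  refine ⟨j, w, fun u hu => ⟨rfl, fun k => ⟨(hΨ k _ (hwc' u hu k)).1, hmem k _ (hwc u hu (k + 1)),
    ?_⟩, fun u' hu' k => ?_⟩⟩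
  · induction k with
    | zero =>
      have := norm_sub_le (w 1 u - c 1) (b 1 - c 1)
      rw [sub_sub_sub_cancel_right] at this
      have h2 := hbc 0
      have h3 := hwc u hu 1
      rw [zero_add, pow_zero]
      rw [zero_add] at h2
      linarith
    | succ k ih =>
      have := hΨL (k + 1) (w (k + 1) u) (b (k + 1)) (hwc' u hu (k + 1))
        (by linarith [hbc k])
      rw [hΨb] at this
      calc _ ≤ 8 / 7 ^ l * ‖w (k + 1) u - b (k + 1)‖ := this
        _ ≤ 1 / 100 * (1 / 10 ^ 13 * (1 / 100) ^ k) := by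
          gcongr ?_ * ?_
          exact h8.trans (by norm_num)
        _ = _ := by rw [pow_succ]; ring
  · have hstep : ∀ k, ‖w (k + 1) u - w (k + 1) u'‖ ≤ 1 / 10 ^ 14 * ‖w k u - w k u'‖ := fun k =>
      (hΨL k _ _ (hwc' u hu k) (hwc' u' hu' k)).trans (by gcongr)
    have hall : ∀ k, ‖w k u - w k u'‖ ≤ ‖u - u'‖ := by
      intro k
      induction k with
      | zero => exact le_rfl
      | succ k ih => linarith [hstep k, norm_nonneg (w k u - w k u')]
    exact (hstep k).trans (by gcongr; exact hall k)

lemma unstableManifold_inter_nonempty {l : ℕ} (hl : 20 ≤ l) {x : ℕ → ℂ × ℂ}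
    (hx : x ∈ natExt (G l) (staySet (G l) (closure (saddleBox l)))) :
    (unstableManifold (G l) x ∩ staySet (G l) (closure (repBox l))).Nonempty := by
  have hmem := fun k => staySet_saddleBox_subset hl (hx k).1
  have ha : ∀ k, ‖(x k).1‖ ≤ 1 / 4 := fun k => mem_closedBall_zero_iff.1 (hmem k).1
  choose i hi using fun k => mem_iUnion.1 (hmem k).2
  have hxe : ∀ k, cA (x (k + 1)).2 * (x (k + 1)).1 + cB (x (k + 1)).2 = (x k).1 ∧
      q^[l] (x (k + 1)).2 = (x k).2 := fun k => by
    have := (hx k).2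
    rw [G_apply] at this
    exact Prod.ext_iff.1 this
  obtain ⟨j, w, hw⟩ := exists_base_histories hl hi fun k => (hxe k).2
  have hnear : ∀ u ∈ core l j, ∀ k, ‖w (k + 1) u‖ ≤ 2 ∧ ‖cA (w (k + 1) u)‖ ≤ 991 / 1000 ∧
      ‖cB (w (k + 1) u)‖ ≤ 21 / 1000 := fun u hu k =>
    let ⟨h1, _, h2, _, h3⟩ := near_sPt hl (subset_closure ((hw u hu).2.1 k).2.1)
    ⟨by linarith, h2, h3⟩
  have hex : ∀ u ∈ core l j, ∃ Z : ℕ → ℂ, (∀ k, ‖Z k‖ ≤ 3) ∧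
      ∀ k, Z k = cA (w (k + 1) u) * Z (k + 1) + cB (w (k + 1) u) := by
    intro u hu
    obtain ⟨Z, -, h1, h2⟩ := exists_affine_section (Y := ℕ) (τ := Nat.succ)
      continuous_of_discreteTopology (A := fun k => cA (w (k + 1) u))
      (B := fun k => cB (w (k + 1) u)) continuous_of_discreteTopology
      continuous_of_discreteTopology (c := 991 / 1000) (b := 21 / 1000) (by norm_num)
      (by norm_num) (by norm_num) (fun k => (hnear u hu k).2.1) fun k => (hnear u hu k).2.2
    exact ⟨Z, fun k => (h1 k).trans (by norm_num), h2⟩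
  choose! Z hZb hZ using hex
  -- Comparing the tails from time -k on transfers the geometric closeness of the base histories to
  -- the fibres. At k = 0 it places the graph in the half disc, and as k grows it gives backward
  -- asymptoticity.
  have hdist : ∀ u ∈ core l j, ∀ k, ‖Z u k - (x k).1‖ ≤ 1 / 10 ^ 10 * (1 / 100) ^ k := by
    intro u hu k
    have := norm_sub_le_of_affine (w := fun n => w (k + n + 1) u) (w' := fun n => (x (k + n + 1)).2)
      (Z := fun n => Z u (k + n)) (Z' := fun n => (x (k + n)).1)
      (e := 1 / 10 ^ 13 * (1 / 100) ^ k) (fun n => (hnear u hu _).2.1) (fun n => (hnear u hu _).1)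
      (fun n => by linarith [(near_sPt hl (subset_closure (hi (k + n + 1)))).1])
      (fun n => hZb u hu _) (fun n => by linarith [ha (k + n)])
      (fun n => (((hw u hu).2.1 _).2.2).trans ?_) (fun n => hZ u hu _)
      (fun n => (hxe _).1.symm)
    · exact this.trans_eq (by ring)
    · gcongr 1 / 10 ^ 13 * ?_
      exact pow_le_pow_of_le_one (by norm_num) (by norm_num) (Nat.le_add_right _ _)
  have hgood : IsGoodGraph l j fun u => Z u 0 := by
    refine ⟨fun u hu => ball_half_subset_HSet j ?_, fun u hu u' hu' => ?_⟩
    · have h1 := hdist u hu 0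
      have h2 := norm_add_le (Z u 0 - (x 0).1) (x 0).1
      rw [sub_add_cancel] at h2
      rw [mem_ball_zero_iff]
      rw [pow_zero] at h1
      linarith [ha 0]
    · have := norm_sub_le_of_affine (w := fun n => w (n + 1) u) (w' := fun n => w (n + 1) u')
        (Z := Z u) (Z' := Z u') (fun n => (hnear u hu _).2.1) (fun n => (hnear u hu _).1)
        (fun n => (hnear u' hu' _).1) (hZb u hu) (hZb u' hu') ((hw u hu).2.2 u' hu')
        (hZ u hu) (hZ u' hu')
      linarith [norm_nonneg (u - u')]
  -- The endpoints of the lifted histories form a good graph, so the repelling blender catches one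
  -- of them.
  obtain ⟨u, hu, hstay⟩ := hgood.exists_mem_staySet hl (differentiable_G l).continuous.continuousOn
    fun _ => isClose_self l _
  obtain ⟨hw0, hw1, -⟩ := hw u hu
  refine ⟨_, ⟨fun k => (Z u k, w k u), fun k => ⟨mem_univ _, ?_⟩, by simp only [hw0], ?_⟩,
    fun n => subset_closure (hstay n)⟩
  · rw [G_apply]
    exact Prod.ext (hZ u hu k).symm (hw1 k).1
  · have hlim : Tendsto (fun k : ℕ => (1 / 100 : ℝ) ^ k) atTop (𝓝 0) :=
      tendsto_pow_atTop_nhds_zero_of_lt_one (by norm_num) (by norm_num)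
    refine (tendsto_add_atTop_iff_nat 1).1 (squeeze_zero (fun _ => dist_nonneg) (fun k => ?_) hlim)
    rw [dist_eq_norm, Prod.norm_def]
    have hp : (0 : ℝ) < (1 / 100) ^ k := by positivity
    refine max_le ((hdist u hu (k + 1)).trans ?_) ((hw1 k).2.2.trans (by linarith))
    rw [pow_succ (1 / 100 : ℝ) k]
    linarith

end Blender

theorem mainTheorem10 :
    ∃ V U : ℕ → Fin 3 → Set ℂ, IsNbhdSystem q rPt V ∧ IsNbhdSystem q sPt U ∧
    ∃ H : Fin 3 → Set ℂ, (∀ i, IsOpen (H i)) ∧ (∀ i, Metric.ball 0 (1 / 2) ⊆ H i) ∧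
      ⋃ i, H i = Metric.ball 0 1 ∧
    ∃ α₁ α₂ ε₁ ε₂ R δ : ℝ, α₁ < 1 / 10 ∧ α₂ < α₁ ∧ 0 < α₂ ∧ 0 < ε₁ ∧ 0 < ε₂ ∧ 0 < R ∧ 0 < δ ∧
    ∃ l₀ : ℕ, 1 ≤ l₀ ∧ ∀ l ≥ l₀,
      (∀ j, closure (⋃ i, V l i) ⊆ q^[l] '' U l j) ∧
      ∃ Lr Ls : Set (ℂ × ℂ),
        IsRepellingBlender (F α₁ α₂ ε₁ ε₂ l) H (V l) δ Lr ∧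
        Lr ⊆ Metric.closedBall 0 1 ×ˢ ⋃ i, V l i ∧
        IsSaddleBlender (F α₁ α₂ ε₁ ε₂ l) (Metric.ball 0 (1 / 4) ×ˢ ⋃ i, U l i) Ls ∧
        Ls ⊆ Metric.closedBall 0 (1 / 4) ×ˢ ⋃ i, U l i ∧
        (∀ x ∈ natExt (F α₁ α₂ ε₁ ε₂ l) Ls,
          (unstableManifold (F α₁ α₂ ε₁ ε₂ l) x ∩ Lr).Nonempty) ∧
        ∃ Mr Ms : Set (ℂ × ℂ),
          Mr = maxInvSet (F α₁ α₂ ε₁ ε₂ l) (Metric.ball 0 R ×ˢ ⋃ i, V l i) ∧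
          Ms = maxInvSet (F α₁ α₂ ε₁ ε₂ l) (Metric.ball 0 R ×ˢ ⋃ i, U l i) ∧
          IsBasicSet (F α₁ α₂ ε₁ ε₂ l) Mr 2 ∧ IsBasicSet (F α₁ α₂ ε₁ ε₂ l) Ms 1 ∧
          Lr ⊆ Mr ∧ Ls ⊆ Ms ∧
          IsMixingOn (hatMap (F α₁ α₂ ε₁ ε₂ l)) (natExt (F α₁ α₂ ε₁ ε₂ l) Mr) ∧
          IsMixingOn (hatMap (F α₁ α₂ ε₁ ε₂ l)) (natExt (F α₁ α₂ ε₁ ε₂ l) Ms) ∧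
          Dynamics.coverEntropy (hatMap (F α₁ α₂ ε₁ ε₂ l)) (natExt (F α₁ α₂ ε₁ ε₂ l) Mr)
            = ((Real.log 3 : ℝ) : EReal) ∧
          Dynamics.coverEntropy (hatMap (F α₁ α₂ ε₁ ε₂ l)) (natExt (F α₁ α₂ ε₁ ε₂ l) Ms)
            = ((Real.log 3 : ℝ) : EReal) := by
  refine ⟨fun l i => nbh (rPt i) l, fun l i => nbh (sPt i) l, isTriple_rPt.isNbhdSystem,
    isTriple_sPt.isNbhdSystem, HSet, isOpen_HSet, ball_half_subset_HSet, iUnion_HSet,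
    -- In order: α₁, α₂, ε₁, ε₂, R and δ. The differences α₁ - α₂ = 1/100 and ε₁ - ε₂ = 1/10 govern
    -- the fibres over the r_i, while α₂ and ε₂ govern those over the s_i.
    1 / 50, 1 / 100, 3 / 25, 1 / 50, 20, 1, by norm_num, by norm_num, by norm_num, by norm_num,
    by norm_num, by norm_num, by norm_num, 20, by norm_num, fun l hl => ?_⟩
  change _ ∧ ∃ Lr Ls : Set (ℂ × ℂ), IsRepellingBlender (G l) _ _ _ _ ∧ _
  obtain ⟨Φ, hΦ⟩ := exists_isCoding_rPt hl
  obtain ⟨Ψ, hΨ⟩ := exists_isCoding_sPt hl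
  exact ⟨closure_iUnion_rPt_subset hl, _, _, isRepellingBlender hl, staySet_repBox_subset hl,
    isSaddleBlender hl, staySet_saddleBox_subset hl,
    fun x hx => unstableManifold_inter_nonempty hl hx,
    _, _, congrArg (maxInvSet (G l)) (iUnion_pieces rPt l),
    congrArg (maxInvSet (G l)) (iUnion_pieces sPt l), isBasicSet_rPt hl, isBasicSet_sPt hl,
    staySet_repBox_subset_maxInvSet hl, staySet_saddleBox_subset_maxInvSet hl,
    hΦ.isMixingOn, hΨ.isMixingOn, hΦ.coverEntropy_eq, hΨ.coverEntropy_eq⟩
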